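/- **Setting.** Fix $\alpha\in(0,1)$, $b_1,b_2>0$, $d>2(b_1+b_2)$ and $\gamma_1,\gamma_2\in\mathbb R\setminus\{0\}$ with $\gamma_1+\gamma_2\neq0$. Let $\mathbb T$ be the unit circle; $\int_{\mathbb T}h(\tau)\,d\tau$ denotes the counterclockwise complex line integral. For $f:\mathbb T\to\mathbb C$ let $f'=df/dw$ be the derivative along $\mathbb T$, and $\|f\|_{C^{1+\alpha}}=\|f\|_\infty+\|f'\|_\infty+\sup_{\tau\ne w}\frac{|f'(\tau)-f'(w)|}{|\tau-w|^\alpha}$. Let $X$ be the space of pairs $f=(f_1,f_2)$ of functions in $C^{1+\alpha}(\mathbb T)$ of the form $f_j(w)=\sum_{n\ge1}a^j_n\overline w^{\,n}$ with $a^j_n\in\mathbb R$, with norm $\max_j\|f_j\|_{C^{1+\alpha}}$, and let $B_1$ be its open unit ball. For $\varepsilon\in(-\frac12,\frac12)$, $\Omega,Z\in\mathbb R$, $f\in B_1$, $w\in\mathbb T$ and $j=1,2$ put $$ \begin{aligned} F_j(\varepsilon,\Omega,Z,f_1,f_2)(w)=\mathrm{Im}\Big\{&2\Omega\big[\varepsilon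 b_j(\overline w+\varepsilon b_j\overline{f_j(w)})+(-1)^jZ-(j-1)d\big]w\big(1+\varepsilon b_jf_j'(w)\big)-\gamma_jf_j'(w)\\ &+\varepsilon b_j\gamma_jw\big(1+\varepsilon b_jf_j'(w)\big)\frac1{2\pi i}\int_{\mathbb T}\frac{A\overline{B_j}-\overline AB_j}{A(A+\varepsilon b_jB_j)}\Big[f_j'(\tau)-\frac{B_j}A\Big]d\tau\\ &-\gamma_{3-j}w\big(1+\varepsilon b_jf_j'(w)\big)\frac1{2\pi i}\int_{\mathbb T}\frac{\big(\overline\tau+\varepsilon b_{3-j}\overline{f_{3-j}(\tau)}\big)\big(1+\varepsilon b_{3-j}f_{3-j}'(\tau)\big)}{\varepsilon(b_{3-j}\tau+b_jw)+\varepsilon^2\big(b_{3-j}^2f_{3-j}(\tau)+b_j^2f_j(w)\big)-d}d\tau\Big\}, \end{aligned} $$ where $A=\tau-w$ and $B_j=f_j(\tau)-f_j(w)$, and $F=(F_1,F_2)$. (For $\varepsilon\neq0$ small, $F=0$ is the contour-dynamics system of a pair of vortex patches rotating with angular velocity $\Omega$ about $Z$.) Put $\Omega_0=\frac{\gamma_1+\gamma_2}{2d^2}$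 and $Z_0=\frac{d\gamma_2}{\gamma_1+\gamma_2}$. **Proposition.** (1) There are $\varepsilon_0\in(0,\frac12)$ and a unique $C^1$ function $g=(\Omega,Z,f_1,f_2):[-\varepsilon_0,\varepsilon_0]\to\mathbb R\times\mathbb R\times B_1$ such that $F(\varepsilon,\Omega(\varepsilon),Z(\varepsilon),f_1(\varepsilon),f_2(\varepsilon))=0$ on $\mathbb T$ for all $\varepsilon\in[-\varepsilon_0,\varepsilon_0]$ and $(\Omega(0),Z(0),f_1(0),f_2(0))=(\Omega_0,Z_0,0,0)$. Moreover, $\varepsilon_0$ can be chosen such that (2), the second statement in (3), and (4) hold. (2) For all $\varepsilon\in[-\varepsilon_0,\varepsilon_0]\setminus\{0\}$ one has $(f_1(\varepsilon),f_2(\varepsilon))\neq(0,0)$. (3) If $|\varepsilon|<\frac12$, $\Omega,Z\in\mathbb R$, $(f_1,f_2)\in B_1$ and $F(\varepsilon,\Omega,Z,f_1,f_2)=0$, then $F(-\varepsilon,\Omega,Z,\tilde f_1,\tilde f_2)=0$, where $\tilde f_j(w)=f_j(-w)$. The curve in (1) has the same symmetry: for $|\varepsilon|\le\varepsilon_0$,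 $\Omega(-\varepsilon)=\Omega(\varepsilon)$, $Z(-\varepsilon)=Z(\varepsilon)$, and $f_j(-\varepsilon)(w)=f_j(\varepsilon)(-w)$. (4) For all $\varepsilon\in[-\varepsilon_0,\varepsilon_0]\setminus\{0\}$ and $j=1,2$ the map $\phi_j(w)=w+\varepsilon b_jf_j(\varepsilon)(w)$ is injective on $\mathbb T$, and the region $D_j^\varepsilon$ enclosed by the Jordan curve $\phi_j(\mathbb T)$ has boundary $\phi_j(\mathbb T)$, contains $0$, is contained in $B(0,2)$ and is a strictly convex domain (it is open and convex, and every open segment between distinct points of its closure lies in the interior of the closure). -/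

import Mathlib

open Complex Set
open scoped ComplexConjugate

noncomputable section

namespace VortexPair

/-! ### Functions on the unit circle and the space `X` -/

/-- The derivative `f'(w) = df/dw` along the unit circle of `f : 𝕋 → ℂ`, that is,
`f'(w) = (d/dθ f(w e^{iθ}))_{θ = 0} / (i w)`. -/
def circleDeriv (f : Circle → ℂ) (w : Circle) : ℂ :=
  deriv (fun θ : ℝ => f (w * Circle.exp θ)) 0 / (I * (w : ℂ))

/-- The mean value `(1 / 2πi) ∫_𝕋 h(τ) dτ` (complex line integral over the unit circle). -/
def circleMean (h : Circle → ℂ) : ℂ :=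
  (1 / (2 * (Real.pi : ℂ) * I)) *
    ∫ θ in (0 : ℝ)..(2 * Real.pi), h (Circle.exp θ) * (I * (Circle.exp θ : ℂ))

/-- `f : 𝕋 → ℂ` is of class `C^{1+α}`: it is `C¹` and `f'` is Hölder continuous with
exponent `α`. -/
def IsC1Holder (α : ℝ) (f : Circle → ℂ) : Prop :=
  ContDiff ℝ 1 (fun θ : ℝ => f (Circle.exp θ)) ∧
    ∃ C : ℝ, ∀ τ w : Circle,
      ‖circleDeriv f τ - circleDeriv f w‖ ≤ C * ‖(τ : ℂ) - (w : ℂ)‖ ^ α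

/-- `f(w) = ∑_{n ≥ 1} a_n w̄ⁿ` on the unit circle, with real coefficients `a_n`. -/
def HasRealNegExpansion (f : Circle → ℂ) : Prop :=
  ∃ a : ℕ → ℝ, ∀ w : Circle,
    HasSum (fun n : ℕ => (a n : ℂ) * conj (w : ℂ) ^ (n + 1)) (f w)

lemma hasDerivAt_of_contDiff {f : Circle → ℂ}
    (hf : ContDiff ℝ 1 (fun θ : ℝ => f (Circle.exp θ))) (w : Circle) :
    HasDerivAt (fun θ : ℝ => f (w * Circle.exp θ)) (circleDeriv f w * (I * (w : ℂ))) 0 := by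
  have h1 : (fun θ : ℝ => f (w * Circle.exp θ))
      = fun θ : ℝ => (fun t : ℝ => f (Circle.exp t)) (Complex.arg w + θ) := by
    funext θ
    simp [Circle.exp_add, Circle.exp_arg]
  have h2 : DifferentiableAt ℝ (fun θ : ℝ => f (w * Circle.exp θ)) 0 := by
    rw [h1]
    have h3 := (hf.comp (contDiff_const.add contDiff_id :
      ContDiff ℝ 1 fun θ : ℝ => Complex.arg w + θ)).differentiable one_ne_zero
    exact h3 0
  have h3 : circleDeriv f w * (I * (w : ℂ)) = deriv (fun θ : ℝ => f (w * Circle.exp θ)) 0 := by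
    unfold circleDeriv
    field_simp [I_ne_zero, Circle.coe_ne_zero w]
  rw [h3]
  exact h2.hasDerivAt

lemma circleDeriv_eq {f : Circle → ℂ} {w : Circle} {c : ℂ}
    (h : HasDerivAt (fun θ : ℝ => f (w * Circle.exp θ)) (c * (I * (w : ℂ))) 0) :
    circleDeriv f w = c := by
  unfold circleDeriv
  rw [h.deriv]
  field_simp [I_ne_zero, Circle.coe_ne_zero w]

lemma circleDeriv_add {f g : Circle → ℂ}
    (hf : ContDiff ℝ 1 (fun θ : ℝ => f (Circle.exp θ)))
    (hg : ContDiff ℝ 1 (fun θ : ℝ => g (Circle.exp θ))) (w : Circle) :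
    circleDeriv (f + g) w = circleDeriv f w + circleDeriv g w := by
  apply circleDeriv_eq
  rw [add_mul]
  exact (hasDerivAt_of_contDiff hf w).add (hasDerivAt_of_contDiff hg w)

lemma circleDeriv_smul {f : Circle → ℂ}
    (hf : ContDiff ℝ 1 (fun θ : ℝ => f (Circle.exp θ))) (c : ℝ) (w : Circle) :
    circleDeriv (c • f) w = (c : ℂ) * circleDeriv f w := by
  apply circleDeriv_eq
  have := (hasDerivAt_of_contDiff hf w).const_mul (c : ℂ)
  rw [mul_assoc]
  simpa using this

lemma circleDeriv_zero (w : Circle) : circleDeriv 0 w = 0 := by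
  simp [circleDeriv]

lemma circleDeriv_comp_neg {f : Circle → ℂ}
    (hf : ContDiff ℝ 1 (fun θ : ℝ => f (Circle.exp θ))) (w : Circle) :
    circleDeriv (fun v => f (-v)) w = - circleDeriv f (-w) := by
  apply circleDeriv_eq
  have := hasDerivAt_of_contDiff hf (-w)
  simpa using this

/-- The functions of class `C^{1+α}` on the circle with an expansion
`∑_{n ≥ 1} a_n w̄ⁿ`, `a_n` real, as a real vector space. -/
def submoduleX (α : ℝ) : Submodule ℝ (Circle → ℂ) where
  carrier := {f | IsC1Holder α f ∧ HasRealNegExpansion f}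
  zero_mem' := by
    refine ⟨⟨contDiff_const, 0, fun τ w => ?_⟩, fun _ => 0, fun w => ?_⟩
    · simp [circleDeriv_zero]
    · simp
  add_mem' := by
    rintro f g ⟨⟨hf, C, hC⟩, a, ha⟩ ⟨⟨hg, D, hD⟩, c, hc⟩
    refine ⟨⟨hf.add hg, C + D, fun τ w => ?_⟩, fun n => a n + c n, fun w => ?_⟩
    · rw [circleDeriv_add hf hg, circleDeriv_add hf hg, add_sub_add_comm, add_mul]
      exact (norm_add_le _ _).trans (add_le_add (hC τ w) (hD τ w))
    · have := (ha w).add (hc w)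
      simpa [add_mul] using this
  smul_mem' := by
    rintro r f ⟨⟨hf, C, hC⟩, a, ha⟩
    refine ⟨⟨hf.const_smul r, |r| * C, fun τ w => ?_⟩, fun n => r * a n, fun w => ?_⟩
    · rw [circleDeriv_smul hf, circleDeriv_smul hf, ← mul_sub, norm_mul, mul_assoc]
      simp only [Complex.norm_real, Real.norm_eq_abs]
      exact mul_le_mul_of_nonneg_left (hC τ w) (abs_nonneg r)
    · have := (ha w).mul_left (r : ℂ)
      simpa [mul_assoc] using this

/-- The space of functions of class `C^{1+α}` on the circle with an expansion
`∑_{n ≥ 1} a_n w̄ⁿ`, `a_n` real. It is normed below by the `C^{1+α}` norm; the space `X` of pairs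
`(f₁, f₂)` is `Fin 2 → HolderX α` with the maximum norm. -/
def HolderX (α : ℝ) : Type := submoduleX α

variable {α : ℝ}

instance : AddCommGroup (HolderX α) := inferInstanceAs (AddCommGroup (submoduleX α))

instance : Module ℝ (HolderX α) := inferInstanceAs (Module ℝ (submoduleX α))

/-- The underlying function of an element of `HolderX α`. -/
def HolderX.toFun (f : HolderX α) : Circle → ℂ := @Subtype.val (Circle → ℂ) (· ∈ submoduleX α) f

instance : CoeFun (HolderX α) (fun _ => Circle → ℂ) := ⟨HolderX.toFun⟩

lemma HolderX.isC1Holder (f : HolderX α) : IsC1Holder α f :=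
  (@Subtype.property (Circle → ℂ) (· ∈ submoduleX α) f).1

lemma HolderX.hasRealNegExpansion (f : HolderX α) : HasRealNegExpansion f :=
  (@Subtype.property (Circle → ℂ) (· ∈ submoduleX α) f).2

/-- The `C^{1+α}` norm `‖f‖_∞ + ‖f'‖_∞ + sup_{τ ≠ w} |f'(τ) - f'(w)| / |τ - w|^α`
(the pairs with `τ = w` contribute `0` to the last supremum). -/
instance : Norm (HolderX α) where
  norm f := (⨆ w : Circle, ‖f w‖) + ((⨆ w : Circle, ‖circleDeriv f w‖) +
    ⨆ p : Circle × Circle,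
      ‖circleDeriv f p.1 - circleDeriv f p.2‖ / ‖(p.1 : ℂ) - (p.2 : ℂ)‖ ^ α)

lemma HolderX.norm_def (f : HolderX α) :
    ‖f‖ = (⨆ w : Circle, ‖f w‖) + ((⨆ w : Circle, ‖circleDeriv f w‖) +
    ⨆ p : Circle × Circle,
      ‖circleDeriv f p.1 - circleDeriv f p.2‖ / ‖(p.1 : ℂ) - (p.2 : ℂ)‖ ^ α) := rfl

lemma HolderX.coe_add (f g : HolderX α) : ((f + g : HolderX α) : Circle → ℂ) = ⇑f + ⇑g := rfl

lemma HolderX.coe_smul (r : ℝ) (f : HolderX α) :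
    ((r • f : HolderX α) : Circle → ℂ) = r • ⇑f := rfl

lemma HolderX.contDiff (f : HolderX α) : ContDiff ℝ 1 (fun θ : ℝ => f (Circle.exp θ)) :=
  f.isC1Holder.1

lemma HolderX.bddAbove_norm (f : HolderX α) : BddAbove (range fun w : Circle => ‖f w‖) := by
  have h1 : BddAbove ((fun θ : ℝ => ‖f (Circle.exp θ)‖) '' Icc (-Real.pi) Real.pi) :=
    (isCompact_Icc.image (f.contDiff.continuous.norm)).bddAbove
  refine h1.mono ?_
  rintro _ ⟨w, rfl⟩
  refine ⟨Complex.arg w, ⟨(Complex.neg_pi_lt_arg _).le, Complex.arg_le_pi _⟩, ?_⟩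
  simp [Circle.exp_arg]

lemma HolderX.bddAbove_quot (f : HolderX α) : BddAbove (range fun p : Circle × Circle =>
    ‖circleDeriv f p.1 - circleDeriv f p.2‖ / ‖(p.1 : ℂ) - (p.2 : ℂ)‖ ^ α) := by
  obtain ⟨C, hC⟩ := f.isC1Holder.2
  refine ⟨max C 0, ?_⟩
  rintro _ ⟨⟨τ, w⟩, rfl⟩
  have h0 : 0 ≤ ‖(τ : ℂ) - (w : ℂ)‖ ^ α := by positivity
  refine div_le_of_le_mul₀ h0 (le_max_right _ _) ((hC τ w).trans ?_)
  exact mul_le_mul_of_nonneg_right (le_max_left _ _) h0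

lemma HolderX.bddAbove_deriv (f : HolderX α) :
    BddAbove (range fun w : Circle => ‖circleDeriv f w‖) := by
  have hcont : Continuous (fun t : ℝ => deriv (fun θ : ℝ => f (Circle.exp θ)) t) :=
    f.contDiff.continuous_deriv le_rfl
  have h1 := (isCompact_Icc (a := -Real.pi) (b := Real.pi)).image hcont.norm |>.bddAbove
  refine h1.mono ?_
  rintro _ ⟨w, rfl⟩
  refine ⟨Complex.arg w, ⟨(Complex.neg_pi_lt_arg _).le, Complex.arg_le_pi _⟩, ?_⟩
  have h2 : (fun θ : ℝ => f (w * Circle.exp θ))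
      = fun θ : ℝ => (fun t : ℝ => f (Circle.exp t)) (Complex.arg w + θ) := by
    funext θ
    simp [Circle.exp_add, Circle.exp_arg]
  have h3 : deriv (fun θ : ℝ => f (w * Circle.exp θ)) 0
      = deriv (fun t : ℝ => f (Circle.exp t)) (Complex.arg w) := by
    rw [h2, deriv_comp_const_add (fun t : ℝ => f (Circle.exp t)), add_zero]
  simp only [circleDeriv, h3, norm_div, norm_mul, norm_I, Circle.norm_coe, mul_one, div_one]

lemma HolderX.normCore (α : ℝ) : NormedSpace.Core ℝ (HolderX α) where
  norm_nonneg f := by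
    rw [HolderX.norm_def]
    have h1 : 0 ≤ ⨆ w : Circle, ‖f w‖ := Real.iSup_nonneg fun _ => norm_nonneg _
    have h2 : 0 ≤ ⨆ w : Circle, ‖circleDeriv f w‖ := Real.iSup_nonneg fun _ => norm_nonneg _
    have h3 : 0 ≤ ⨆ p : Circle × Circle,
      ‖circleDeriv f p.1 - circleDeriv f p.2‖ / ‖(p.1 : ℂ) - (p.2 : ℂ)‖ ^ α :=
        Real.iSup_nonneg fun _ => by positivity
    positivity
  norm_smul r f := by
    simp only [HolderX.norm_def, HolderX.coe_smul, circleDeriv_smul f.contDiff, ← mul_sub,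
      norm_mul, Pi.smul_apply, norm_smul, Complex.norm_real, mul_div_assoc,
      ← Real.mul_iSup_of_nonneg (norm_nonneg r), mul_add]
  norm_triangle f g := by
    simp only [HolderX.norm_def, HolderX.coe_add, circleDeriv_add f.contDiff g.contDiff]
    have h1 : (⨆ w : Circle, ‖(⇑f + ⇑g) w‖) ≤ (⨆ w : Circle, ‖f w‖) + ⨆ w : Circle, ‖g w‖ :=
      ciSup_le fun w => (norm_add_le _ _).trans
        (add_le_add (le_ciSup f.bddAbove_norm w) (le_ciSup g.bddAbove_norm w))
    have h2 : (⨆ w : Circle, ‖circleDeriv f w + circleDeriv g w‖)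
        ≤ (⨆ w : Circle, ‖circleDeriv f w‖) + ⨆ w : Circle, ‖circleDeriv g w‖ :=
      ciSup_le fun w => (norm_add_le _ _).trans
        (add_le_add (le_ciSup f.bddAbove_deriv w) (le_ciSup g.bddAbove_deriv w))
    have h3 : (⨆ p : Circle × Circle, ‖circleDeriv f p.1 + circleDeriv g p.1
          - (circleDeriv f p.2 + circleDeriv g p.2)‖ / ‖(p.1 : ℂ) - (p.2 : ℂ)‖ ^ α)
        ≤ (⨆ p : Circle × Circle,
            ‖circleDeriv f p.1 - circleDeriv f p.2‖ / ‖(p.1 : ℂ) - (p.2 : ℂ)‖ ^ α)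
          + ⨆ p : Circle × Circle,
            ‖circleDeriv g p.1 - circleDeriv g p.2‖ / ‖(p.1 : ℂ) - (p.2 : ℂ)‖ ^ α := by
      refine ciSup_le fun p => ?_
      refine le_trans ?_ (add_le_add (le_ciSup f.bddAbove_quot p) (le_ciSup g.bddAbove_quot p))
      rw [← add_div, add_sub_add_comm]
      exact div_le_div_of_nonneg_right (norm_add_le _ _) (by positivity)
    linarith
  norm_eq_zero_iff f := by
    constructor
    · intro h
      rw [HolderX.norm_def] at h
      have h1 : 0 ≤ ⨆ w : Circle, ‖f w‖ := Real.iSup_nonneg fun _ => norm_nonneg _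
      have h2 : 0 ≤ ⨆ w : Circle, ‖circleDeriv f w‖ := Real.iSup_nonneg fun _ => norm_nonneg _
      have h3 : 0 ≤ ⨆ p : Circle × Circle,
        ‖circleDeriv f p.1 - circleDeriv f p.2‖ / ‖(p.1 : ℂ) - (p.2 : ℂ)‖ ^ α :=
          Real.iSup_nonneg fun _ => by positivity
      have h4 : (⨆ w : Circle, ‖f w‖) = 0 := by linarith
      refine Subtype.ext (funext fun w => ?_)
      have h5 := le_ciSup f.bddAbove_norm w
      rw [h4] at h5
      exact norm_le_zero_iff.1 h5
    · rintro rfl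
      have h0 : ((0 : HolderX α) : Circle → ℂ) = 0 := rfl
      simp [HolderX.norm_def, h0, circleDeriv_zero]

instance : NormedAddCommGroup (HolderX α) := NormedAddCommGroup.ofCore (HolderX.normCore α)

instance : NormedSpace ℝ (HolderX α) := NormedSpace.ofCore (HolderX.normCore α)

/-- The reflected function `f̃(w) = f(-w)`. -/
def HolderX.reflect (f : HolderX α) : HolderX α :=
  ⟨fun w => f (-w), by
    obtain ⟨hf, C, hC⟩ := f.isC1Holder
    obtain ⟨a, ha⟩ := f.hasRealNegExpansion
    refine ⟨⟨?_, C, fun τ w => ?_⟩, fun n => a n * (-1) ^ (n + 1), fun w => ?_⟩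
    · have h : (fun θ : ℝ => f (-Circle.exp θ))
          = fun θ : ℝ => (fun t : ℝ => f (Circle.exp t)) (θ + Real.pi) := by
        funext θ
        have : Circle.exp Real.pi = -1 := by
          apply Circle.ext
          simp [Circle.coe_exp, Complex.exp_pi_mul_I]
        simp [Circle.exp_add, this]
      rw [h]
      exact hf.comp (contDiff_id.add contDiff_const)
    · rw [circleDeriv_comp_neg hf, circleDeriv_comp_neg hf]
      have h := hC (-τ) (-w)
      have h2 : ‖((-τ : Circle) : ℂ) - ((-w : Circle) : ℂ)‖ = ‖(τ : ℂ) - (w : ℂ)‖ := by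
        rw [Circle.coe_neg, Circle.coe_neg, neg_sub_neg, norm_sub_rev]
      rw [h2] at h
      rwa [neg_sub_neg, norm_sub_rev]
    · have h := ha (-w)
      have e : (fun n : ℕ => ((a n * (-1) ^ (n + 1) : ℝ) : ℂ) * conj (w : ℂ) ^ (n + 1))
          = fun n : ℕ => (a n : ℂ) * conj ((-w : Circle) : ℂ) ^ (n + 1) := by
        funext n
        rw [Circle.coe_neg, map_neg, neg_pow (conj (w : ℂ))]
        push_cast
        ring
      rw [e]
      exact h⟩

lemma HolderX.reflect_apply (f : HolderX α) (w : Circle) : f.reflect w = f (-w) := rfl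

/-! ### The co-rotating contour-dynamics system -/

/-- The boundary parametrization `φ_j(w) = w + ε b_j f_j(w)` of the `j`-th rescaled patch. -/
def boundaryMap (b : Fin 2 → ℝ) (ε : ℝ) (f : Fin 2 → HolderX α) (j : Fin 2) (w : Circle) : ℂ :=
  (w : ℂ) + ε * b j * f j w

/-- The functional `F_j(ε, Ω, Z, f₁, f₂)(w)` of the contour-dynamics system of a co-rotating pair,
in the form that makes sense for `ε = 0` too. The indices `1, 2` are `0, 1 : Fin 2`, so that the
other index is `1 - j`, and `(-1)^j Z - (j - 1) d` is `-Z` for the first patch and `Z - d` for the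
second one. Below, `A = τ - w` and `B = f_j(τ) - f_j(w)`. -/
def contourF (b γ : Fin 2 → ℝ) (d ε Ω Z : ℝ) (f : Fin 2 → HolderX α) (j : Fin 2)
    (w : Circle) : ℝ :=
  let f' : Fin 2 → Circle → ℂ := fun k => circleDeriv (f k)
  let A : Circle → ℂ := fun τ => (τ : ℂ) - (w : ℂ)
  let B : Circle → ℂ := fun τ => f j τ - f j w
  let k : Fin 2 := 1 - j
  Complex.im
    (2 * Ω * (ε * b j * (conj (w : ℂ) + ε * b j * conj (f j w))
          + ((-1) ^ ((j : ℕ) + 1) * Z - (j : ℕ) * d)) * w * (1 + ε * b j * f' j w)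
      - γ j * f' j w
      + ε * b j * γ j * w * (1 + ε * b j * f' j w) *
          circleMean (fun τ =>
            (A τ * conj (B τ) - conj (A τ) * B τ) / (A τ * (A τ + ε * b j * B τ))
              * (f' j τ - B τ / A τ))
      - γ k * w * (1 + ε * b j * f' j w) *
          circleMean (fun τ =>
            (conj (τ : ℂ) + ε * b k * conj (f k τ)) * (1 + ε * b k * f' k τ)
              / (ε * (b k * τ + b j * w) + ε ^ 2 * (b k ^ 2 * f k τ + b j ^ 2 * f j w) - d)))

/-- `F(ε, Ω, Z, f₁, f₂) = 0`. -/
def IsSolution (b γ : Fin 2 → ℝ) (d ε Ω Z : ℝ) (f : Fin 2 → HolderX α) : Prop :=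
  ∀ (j : Fin 2) (w : Circle), contourF b γ d ε Ω Z f j w = 0

/-- The angular velocity `Ω₀` of the point vortex pair. -/
def Omega0 (γ : Fin 2 → ℝ) (d : ℝ) : ℝ := (γ 0 + γ 1) / (2 * d ^ 2)

/-- The centre of rotation `Z₀` of the point vortex pair. -/
def Z0 (γ : Fin 2 → ℝ) (d : ℝ) : ℝ := d * γ 1 / (γ 0 + γ 1)

/-- `g = (Ω, Z, (f₁, f₂))` is a `C¹` curve on `[-ε₀, ε₀]` with values in `ℝ × ℝ × B₁`, where `B₁` is
the open unit ball of `X`, that solves `F(ε, g(ε)) = 0` and passes through `(Ω₀, Z₀, 0, 0)` at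
`ε = 0`. -/
structure IsSolutionCurve (b γ : Fin 2 → ℝ) (d ε₀ : ℝ)
    (g : ℝ → ℝ × ℝ × (Fin 2 → HolderX α)) : Prop where
  contDiffOn : ContDiffOn ℝ 1 g (Icc (-ε₀) ε₀)
  mem_ball : ∀ ε ∈ Icc (-ε₀) ε₀, (g ε).2.2 ∈ Metric.ball (0 : Fin 2 → HolderX α) 1
  isSolution : ∀ ε ∈ Icc (-ε₀) ε₀, IsSolution b γ d ε (g ε).1 (g ε).2.1 (g ε).2.2
  init : g 0 = (Omega0 γ d, Z0 γ d, 0)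

/-! ### The patches -/

/-- The region enclosed by a closed curve: the union of the bounded connected components of the
complement of the curve. -/
def enclosedRegion (φ : Circle → ℂ) : Set ℂ :=
  {z | z ∉ range φ ∧ Bornology.IsBounded (connectedComponentIn (range φ)ᶜ z)}

/-- The rescaled patch `D_j^ε`: the region enclosed by the curve `φ_j(𝕋)`. -/
def patch (b : Fin 2 → ℝ) (ε : ℝ) (f : Fin 2 → HolderX α) (j : Fin 2) : Set ℂ :=
  enclosedRegion (boundaryMap b ε f j)

/-- A strictly convex planar domain: a nonempty open convex set whose boundary contains no segment,
that is, every open segment between two distinct points of the closure lies in the interior of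
the closure. -/
def IsStrictlyConvexDomain (D : Set ℂ) : Prop :=
  IsOpen D ∧ D.Nonempty ∧ Convex ℝ D ∧ StrictConvex ℝ (closure D)

end VortexPair

end

/-! At `ε = 0` the system decouples. The interaction integral reduces to a multiple of `w`, so that
`F_j` is the imaginary part of `(2Ω((-1)^j Z - (j-1)d) + γ_{3-j}/d) w - γ_j f_j'`, with `j = 1, 2`.
Since `f_j'` only contains the powers `w̄^k` with `k ≥ 2`, the coefficient of `sin θ` gives two
scalar equations for `(Ω, Z)`, solved nondegenerately by `(Ω₀, Z₀)`, and the coefficients of `sin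
kθ`, `k ≥ 2`, determine `f_j` through an isomorphism. The solution curve comes from the implicit
function theorem.

Existence is proved in a space smaller than `C^{1+α}`: the coefficients of `f_j` lie in a weighted
`ℓ¹` space, and functions of `(τ, w)` are elements of a weighted Wiener algebra of Laurent series.
This is a Banach algebra in which difference quotients and the integral over `τ` are bounded linear
maps given on monomials and inversion is smooth at units. No singular integral estimates are needed
(`contDiffAt_sineF`, `isInvertible_fderiv_sineF`, `exists_curve`). The solutions found this way are
even `C^{1,1}`.

Uniqueness concerns all `C^{1+α}` curves and does not follow from uniqueness in the smaller space.
For two solutions at the same `ε`, the `L²` norm of the derivative of the difference serves as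
energy. Functions with negative modes only satisfy `∫ (Im u')² = ½ ∫ |u'|²`, and `Im u'` is
orthogonal to `sin θ`, so the principal part controls the whole distance
(`integral_sin_sub_im_circleDeriv_sq`). All other terms are Lipschitz in this norm with a constant
`O(ε)` (`StatePair.lipBound_remainder`), so the distance is zero for small `ε`
(`exists_forall_isSolution_eq`). This needs bounds on `Ω` and `Z`, which an arbitrary curve gets
from a connectedness argument (`IsSolutionCurve.eqOn`).

The remaining assertions are short consequences. The equations are invariant under `ε ↦ -ε`, `w ↦
-w` (`contourF_reflect`), so uniqueness makes the curve symmetric. For `f = 0` the first equation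
would force `|d - ε b_1 w|` to be constant on the circle (`IsSolution.ne_zero`). A `C^{1,1}`-small
perturbation of the circle lies quadratically below each of its tangents, hence bounds a strictly
convex domain (`strictlyConvex_perturbation`). -/

noncomputable section

namespace VortexPair

open UniformSpace

/-! ### The Wiener algebra of the torus with a polynomial weight -/

/-- The weight `1 + |i| + |j|` of the monomial `τ ^ i * w ^ j`. -/
def weight (n : ℤ × ℤ) : ℝ := 1 + |(n.1 : ℝ)| + |(n.2 : ℝ)|

lemma one_le_weight (n : ℤ × ℤ) : 1 ≤ weight n := by
  unfold weight
  linarith [abs_nonneg (n.1 : ℝ), abs_nonneg (n.2 : ℝ)]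

lemma weight_pos (n : ℤ × ℤ) : 0 < weight n := zero_lt_one.trans_le (one_le_weight n)

/-- Submultiplicativity makes the weighted `ℓ¹` norm of the coefficients an algebra norm. -/
lemma weight_add_le (m n : ℤ × ℤ) : weight (m + n) ≤ weight m * weight n := by
  unfold weight
  have h1 := abs_add_le (m.1 : ℝ) n.1
  have h2 := abs_add_le (m.2 : ℝ) n.2
  push_cast [Prod.fst_add, Prod.snd_add]
  nlinarith [abs_nonneg (m.1 : ℝ), abs_nonneg (m.2 : ℝ), abs_nonneg (n.1 : ℝ),
    abs_nonneg (n.2 : ℝ), mul_nonneg (abs_nonneg (m.1 : ℝ)) (abs_nonneg (n.1 : ℝ)),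
    mul_nonneg (abs_nonneg (m.1 : ℝ)) (abs_nonneg (n.2 : ℝ)),
    mul_nonneg (abs_nonneg (m.2 : ℝ)) (abs_nonneg (n.1 : ℝ)),
    mul_nonneg (abs_nonneg (m.2 : ℝ)) (abs_nonneg (n.2 : ℝ))]

/-- Laurent polynomials in two variables with real coefficients. -/
def LaurentPoly : Type := AddMonoidAlgebra ℝ (ℤ × ℤ)

namespace LaurentPoly

instance : CommRing LaurentPoly := inferInstanceAs (CommRing (AddMonoidAlgebra ℝ (ℤ × ℤ)))

instance : Algebra ℝ LaurentPoly := inferInstanceAs (Algebra ℝ (AddMonoidAlgebra ℝ (ℤ × ℤ)))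

/-- The Laurent polynomial `c * τ ^ n.1 * w ^ n.2`. -/
def term (n : ℤ × ℤ) (c : ℝ) : LaurentPoly := AddMonoidAlgebra.single n c

/-- The coefficients of a Laurent polynomial. -/
def coeffs (p : LaurentPoly) : ℤ × ℤ →₀ ℝ := AddMonoidAlgebra.coeff p

lemma coeffs_add (p q : LaurentPoly) : (p + q).coeffs = p.coeffs + q.coeffs := rfl

lemma coeffs_zero : (0 : LaurentPoly).coeffs = 0 := rfl

lemma coeffs_neg (p : LaurentPoly) : (-p).coeffs = -p.coeffs := rfl

lemma coeffs_smul (c : ℝ) (p : LaurentPoly) : (c • p).coeffs = c • p.coeffs := rfl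

lemma coeffs_term (n : ℤ × ℤ) (c : ℝ) : (term n c).coeffs = Finsupp.single n c := rfl

lemma smul_term (n : ℤ × ℤ) (c : ℝ) : c • term n 1 = term n c := by
  have : c • AddMonoidAlgebra.single n (1 : ℝ) = AddMonoidAlgebra.single n c := by
    simp [AddMonoidAlgebra.smul_single]
  exact this

lemma term_mul_term (m n : ℤ × ℤ) (a b : ℝ) : term m a * term n b = term (m + n) (a * b) :=
  AddMonoidAlgebra.single_mul_single ..

lemma term_zero_one : term 0 1 = 1 := rfl

lemma induction_terms {P : LaurentPoly → Prop} (p : LaurentPoly) (zero : P 0)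
    (add : ∀ p q, P p → P q → P (p + q)) (single : ∀ n c, P (term n c)) : P p :=
  AddMonoidAlgebra.induction_linear p zero add single

/-- The extension of a family indexed by the monomials to a linear map. -/
def liftAux {E : Type*} [AddCommGroup E] [Module ℝ E] (v : ℤ × ℤ → E) : LaurentPoly →ₗ[ℝ] E where
  toFun p := Finsupp.linearCombination ℝ v p.coeffs
  map_add' p q := by rw [coeffs_add, map_add]
  map_smul' c p := by rw [coeffs_smul, map_smul]; rfl

lemma liftAux_term {E : Type*} [AddCommGroup E] [Module ℝ E] (v : ℤ × ℤ → E) (n : ℤ × ℤ) (c : ℝ) :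
    liftAux v (term n c) = c • v n := by
  change Finsupp.linearCombination ℝ v (term n c).coeffs = _
  rw [coeffs_term, Finsupp.linearCombination_single]

instance : Norm LaurentPoly := ⟨fun p => p.coeffs.sum fun n c => |c| * weight n⟩

lemma norm_def (p : LaurentPoly) : ‖p‖ = p.coeffs.sum fun n c => |c| * weight n := rfl

lemma norm_eq_sum (p : LaurentPoly) {s : Finset (ℤ × ℤ)} (h : p.coeffs.support ⊆ s) :
    ‖p‖ = ∑ n ∈ s, |p.coeffs n| * weight n :=
  Finsupp.sum_of_support_subset _ h _ (by simp)

lemma norm_term (n : ℤ × ℤ) (c : ℝ) : ‖term n c‖ = |c| * weight n := by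
  rw [norm_def, coeffs_term, Finsupp.sum_single_index (by simp)]

lemma norm_add_le' (p q : LaurentPoly) : ‖p + q‖ ≤ ‖p‖ + ‖q‖ := by
  classical
  have h1 := norm_eq_sum p (Finset.subset_union_left (s₂ := q.coeffs.support))
  have h2 := norm_eq_sum q (Finset.subset_union_right (s₁ := p.coeffs.support))
  rw [norm_eq_sum (p + q) (coeffs_add p q ▸ Finsupp.support_add), h1, h2, ← Finset.sum_add_distrib]
  refine Finset.sum_le_sum fun n _ => ?_
  rw [← add_mul, coeffs_add, Finsupp.add_apply]
  exact mul_le_mul_of_nonneg_right (abs_add_le _ _) (weight_pos n).le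

instance : SeminormedAddCommGroup LaurentPoly :=
  AddGroupSeminorm.toSeminormedAddCommGroup
    { toFun := fun p => ‖p‖
      map_zero' := by simp [norm_def, coeffs_zero]
      add_le' := norm_add_le'
      neg' := fun p => by
        rw [norm_eq_sum (-p) (by rw [coeffs_neg, Finsupp.support_neg]), norm_def, Finsupp.sum]
        simp [coeffs_neg] }

lemma norm_mul_le' (p q : LaurentPoly) : ‖p * q‖ ≤ ‖p‖ * ‖q‖ := by
  have expand : ∀ r : LaurentPoly, r = ∑ n ∈ r.coeffs.support, term n (r.coeffs n) := fun r =>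
    (AddMonoidAlgebra.sum_coeff_single (R := ℝ) r).symm
  have e : p * q = ∑ m ∈ p.coeffs.support, ∑ n ∈ q.coeffs.support,
      term (m + n) (p.coeffs m * q.coeffs n) := by
    conv_lhs => rw [expand p, expand q, Finset.sum_mul_sum]
    simp only [term_mul_term]
  rw [e, norm_def p, norm_def q, Finsupp.sum, Finsupp.sum, Finset.sum_mul_sum]
  refine (norm_sum_le _ _).trans (Finset.sum_le_sum fun m _ => ?_)
  refine (norm_sum_le _ _).trans (Finset.sum_le_sum fun n _ => ?_)
  rw [norm_term, abs_mul]
  calc |p.coeffs m| * |q.coeffs n| * weight (m + n)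
      ≤ |p.coeffs m| * |q.coeffs n| * (weight m * weight n) :=
        mul_le_mul_of_nonneg_left (weight_add_le m n) (by positivity)
    _ = _ := by ring

instance : SeminormedCommRing LaurentPoly where
  dist_eq := fun _ _ => SeminormedAddGroup.dist_eq _ _
  norm_mul_le := norm_mul_le'
  mul_comm := mul_comm

instance : NormedAlgebra ℝ LaurentPoly where
  norm_smul_le c p := by
    rw [norm_eq_sum (c • p) (s := p.coeffs.support) (by
      rw [coeffs_smul]; exact Finsupp.support_smul), norm_def, Finsupp.sum, Finset.mul_sum]
    refine le_of_eq (Finset.sum_congr rfl fun n _ => ?_)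
    simp [coeffs_smul, abs_mul, mul_assoc]

lemma norm_liftAux_le {E : Type*} [NormedAddCommGroup E] [NormedSpace ℝ E] {v : ℤ × ℤ → E} {C : ℝ}
    (hv : ∀ n, ‖v n‖ ≤ C * weight n) (p : LaurentPoly) : ‖liftAux v p‖ ≤ C * ‖p‖ := by
  change ‖Finsupp.linearCombination ℝ v p.coeffs‖ ≤ _
  rw [Finsupp.linearCombination_apply, Finsupp.sum, norm_def, Finsupp.sum, Finset.mul_sum]
  refine (norm_sum_le _ _).trans (Finset.sum_le_sum fun n _ => ?_)
  rw [norm_smul, Real.norm_eq_abs]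
  nlinarith [mul_le_mul_of_nonneg_left (hv n) (abs_nonneg (p.coeffs n))]

end LaurentPoly

/-- The weighted Wiener algebra: the absolutely convergent Laurent series in two variables. -/
abbrev Wiener : Type := Completion LaurentPoly

namespace Wiener

/-- The monomial `τ ^ i * w ^ j`. -/
def mono (i j : ℤ) : Wiener := ((LaurentPoly.term (i, j) 1 : LaurentPoly) : Completion LaurentPoly)

lemma norm_mono_le (i j : ℤ) : ‖mono i j‖ ≤ weight (i, j) := by
  rw [mono, Completion.norm_coe, LaurentPoly.norm_term]
  simp

lemma mono_mul_mono (i j k l : ℤ) : mono i j * mono k l = mono (i + k) (j + l) := by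
  rw [mono, mono, ← Completion.coe_mul, LaurentPoly.term_mul_term, mul_one]
  rfl

lemma mono_zero : mono 0 0 = 1 := by
  have : LaurentPoly.term (0, 0) 1 = 1 := LaurentPoly.term_zero_one
  rw [mono, this, Completion.coe_one]

/-- The span of the monomials is dense. Every identity between bounded operators on the Wiener
algebra below is reduced to monomials in this way. -/
lemma ext_mono {E : Type*} [NormedAddCommGroup E] [NormedSpace ℝ E] {S T : Wiener →L[ℝ] E}
    (h : ∀ i j, S (mono i j) = T (mono i j)) : S = T := by
  ext x
  induction x using Completion.induction_on with
  | hp => exact isClosed_eq S.continuous T.continuous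
  | ih p =>
    induction p using LaurentPoly.induction_terms with
    | zero => rw [Completion.coe_zero, map_zero, map_zero]
    | add p q hp hq => rw [Completion.coe_add, map_add, map_add, hp, hq]
    | single n c =>
      rw [← LaurentPoly.smul_term, Completion.coe_smul, map_smul, map_smul]
      exact congrArg (c • ·) (h n.1 n.2)

variable {E : Type*} [NormedAddCommGroup E] [NormedSpace ℝ E] [CompleteSpace E]

/-- The continuous linear map on the Wiener algebra with prescribed values on the monomials. -/
def lift (v : ℤ × ℤ → E) : Wiener →L[ℝ] E :=
  (LaurentPoly.liftAux v).extendOfNorm (Completion.toComplL (𝕜 := ℝ) (E := LaurentPoly)).toLinearMap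

/-- The bound `hv` is what allows the linear extension to pass to the completion. -/
lemma lift_mono {v : ℤ × ℤ → E} {C : ℝ} (hv : ∀ n, ‖v n‖ ≤ C * weight n) (i j : ℤ) :
    lift v (mono i j) = v (i, j) := by
  have h := LinearMap.extendOfNorm_eq (f := LaurentPoly.liftAux v)
    (e := (Completion.toComplL (𝕜 := ℝ) (E := LaurentPoly)).toLinearMap)
    Completion.denseRange_coe ⟨C, fun p =>
      (LaurentPoly.norm_liftAux_le hv p).trans_eq
        (congrArg (C * ·) (Completion.norm_coe p).symm)⟩ (LaurentPoly.term (i, j) 1)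
  rw [LaurentPoly.liftAux_term, one_smul] at h
  exact h

/-- Evaluation of an absolutely convergent Laurent series on the torus. -/
def ev : Wiener →L[ℝ] C(Circle × Circle, ℂ) :=
  lift fun n => ⟨fun p => (p.1 : ℂ) ^ n.1 * (p.2 : ℂ) ^ n.2, by
    have h : ∀ k : ℤ, Continuous fun z : Circle => (z : ℂ) ^ k := fun k =>
      Continuous.zpow₀ (by fun_prop) k fun z => Or.inl (Circle.coe_ne_zero z)
    exact ((h n.1).comp continuous_fst).mul ((h n.2).comp continuous_snd)⟩

lemma ev_mono (i j : ℤ) (τ w : Circle) : ev (mono i j) (τ, w) = (τ : ℂ) ^ i * (w : ℂ) ^ j := by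
  rw [ev, lift_mono (C := 1)]
  · rfl
  · intro n
    rw [ContinuousMap.norm_le _ (by linarith [weight_pos n])]
    intro p
    change ‖(p.1 : ℂ) ^ n.1 * (p.2 : ℂ) ^ n.2‖ ≤ _
    simpa [Circle.norm_coe] using one_le_weight n

/-- Both sides are bilinear and continuous: density is used in the right factor with a monomial on
the left, then in the left factor. -/
lemma ev_mul (x y : Wiener) : ev (x * y) = ev x * ev y := by
  have h1 : ∀ i j, (ev.comp (ContinuousLinearMap.mul ℝ Wiener (mono i j)))
      = (ContinuousLinearMap.mul ℝ C(Circle × Circle, ℂ) (ev (mono i j))).comp ev := by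
    intro i j
    refine ext_mono fun k l => ?_
    ext ⟨τ, w⟩
    simp only [ContinuousLinearMap.comp_apply, ContinuousLinearMap.mul_apply', mono_mul_mono,
      ContinuousMap.mul_apply, ev_mono, zpow_add₀ (Circle.coe_ne_zero _)]
    ring
  have h2 : ev.comp ((ContinuousLinearMap.mul ℝ Wiener).flip y)
      = ((ContinuousLinearMap.mul ℝ C(Circle × Circle, ℂ)).flip (ev y)).comp ev := by
    refine ext_mono fun i j => ?_
    exact DFunLike.congr_fun (h1 i j) y
  exact DFunLike.congr_fun h2 x

lemma ev_one : ev 1 = 1 := by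
  ext ⟨τ, w⟩
  rw [← mono_zero, ev_mono]
  simp

/-- Evaluation at a point of the torus as a ring homomorphism. -/
def evHom (τ w : Circle) : Wiener →+* ℂ where
  toFun x := ev x (τ, w)
  map_one' := by rw [ev_one]; rfl
  map_mul' x y := by rw [ev_mul]; rfl
  map_zero' := by rw [map_zero]; rfl
  map_add' x y := by rw [map_add]; rfl

lemma evHom_apply (τ w : Circle) (x : Wiener) : evHom τ w x = ev x (τ, w) := rfl

lemma evHom_mono (τ w : Circle) (i j : ℤ) : evHom τ w (mono i j) = (τ : ℂ) ^ i * (w : ℂ) ^ j :=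
  ev_mono i j τ w

lemma evHom_smul (τ w : Circle) (c : ℝ) (x : Wiener) : evHom τ w (c • x) = c * evHom τ w x := by
  rw [evHom_apply, map_smul]
  simp [evHom_apply]

lemma evHom_inverse (τ w : Circle) {x : Wiener} (hx : IsUnit x) :
    evHom τ w (Ring.inverse x) = (evHom τ w x)⁻¹ := by
  refine eq_inv_of_mul_eq_one_left ?_
  rw [← map_mul, Ring.inverse_mul_cancel x hx, map_one]

lemma evHom_ne_zero (τ w : Circle) {x : Wiener} (hx : IsUnit x) : evHom τ w x ≠ 0 :=
  (hx.map (evHom τ w)).ne_zero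

end Wiener

end VortexPair

end

noncomputable section

namespace VortexPair

/-! ### The mean value over the circle -/

lemma circleMean_zpow (n : ℤ) :
    circleMean (fun τ => (τ : ℂ) ^ n) = if n = -1 then 1 else 0 := by
  have h : circleMean (fun τ => (τ : ℂ) ^ n)
      = (1 / (2 * (Real.pi : ℂ) * I)) * ∮ z in C(0, 1), (z - 0) ^ n := by
    rw [circleMean, circleIntegral]
    congr 1
    refine intervalIntegral.integral_congr fun θ _ => ?_
    simp [circleMap, Circle.coe_exp, mul_comm]
  rw [h]
  have hpi : (Real.pi : ℂ) ≠ 0 := by exact_mod_cast Real.pi_ne_zero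
  split_ifs with hn
  · subst hn
    have := circleIntegral.integral_sub_center_inv (0 : ℂ) (one_ne_zero : (1 : ℝ) ≠ 0)
    simp only [zpow_neg_one]
    rw [this]
    field_simp
  · rw [circleIntegral.integral_sub_zpow_of_ne hn, mul_zero]

lemma norm_circleMean_le {h : Circle → ℂ} {C : ℝ} (hC : ∀ τ, ‖h τ‖ ≤ C) : ‖circleMean h‖ ≤ C := by
  have h1 := intervalIntegral.norm_integral_le_of_norm_le_const (a := 0) (b := 2 * Real.pi) (C := C)
    (f := fun θ : ℝ => h (Circle.exp θ) * (I * (Circle.exp θ : ℂ))) fun θ _ => by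
      simpa [Circle.norm_coe] using hC (Circle.exp θ)
  have hpi := Real.pi_pos
  rw [circleMean, norm_mul]
  have h2 : ‖(1 / (2 * (Real.pi : ℂ) * I))‖ = 1 / (2 * Real.pi) := by
    simp [abs_of_pos hpi]
  rw [h2]
  calc 1 / (2 * Real.pi) * _ ≤ 1 / (2 * Real.pi) * (C * |2 * Real.pi - 0|) :=
        mul_le_mul_of_nonneg_left h1 (by positivity)
    _ = C := by
      rw [sub_zero, abs_of_pos (by positivity)]
      field_simp

lemma circleMean_add {g h : Circle → ℂ} (hg : Continuous g) (hh : Continuous h) :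
    circleMean (fun τ => g τ + h τ) = circleMean g + circleMean h := by
  rw [circleMean, circleMean, circleMean, ← mul_add, ← intervalIntegral.integral_add]
  · simp only [add_mul]
  · exact Continuous.intervalIntegrable (by fun_prop) _ _
  · exact Continuous.intervalIntegrable (by fun_prop) _ _

lemma circleMean_const_mul (c : ℂ) (h : Circle → ℂ) :
    circleMean (fun τ => c * h τ) = c * circleMean h := by
  simp only [circleMean, mul_assoc, intervalIntegral.integral_const_mul]
  ring

/-- The mean value in the first variable, at a fixed second variable. -/
def meanSlice (w : Circle) : C(Circle × Circle, ℂ) →L[ℝ] ℂ :=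
  LinearMap.mkContinuous
    { toFun := fun g => circleMean fun τ => g (τ, w)
      map_add' := fun g h => circleMean_add (by fun_prop) (by fun_prop)
      map_smul' := fun c g => by
        simpa using circleMean_const_mul (c : ℂ) fun τ => g (τ, w) } 1
    fun g => by
      rw [one_mul]
      exact norm_circleMean_le fun τ => g.norm_coe_le_norm (τ, w)

namespace Wiener

/-- The mean value in the first variable. -/
def mean : Wiener →L[ℝ] Wiener := lift fun n => if n.1 = -1 then mono 0 n.2 else 0

lemma mean_mono (i j : ℤ) : mean (mono i j) = if i = -1 then mono 0 j else 0 := by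
  refine lift_mono (C := 1) (fun n => ?_) i j
  split_ifs
  · refine (norm_mono_le _ _).trans ?_
    simp [weight]
  · simpa using (weight_pos n).le

/-- Integration in `τ` picks the coefficient of `τ⁻¹`, so it acts inside the algebra. The result
does not involve the first variable, whence the free point `σ`. -/
lemma evHom_mean (σ w : Circle) (x : Wiener) :
    evHom σ w (mean x) = circleMean fun τ => evHom τ w x := by
  have h : (ContinuousMap.evalCLM ℝ (σ, w)).comp (ev.comp mean) = (meanSlice w).comp ev := by
    refine ext_mono fun i j => ?_
    have h2 : (meanSlice w) (ev (mono i j)) = (if i = -1 then 1 else 0) * (w : ℂ) ^ j := by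
      rw [← circleMean_zpow, mul_comm, ← circleMean_const_mul]
      change circleMean (fun τ => ev (mono i j) (τ, w)) = _
      simp only [ev_mono, mul_comm]
    change ev (mean (mono i j)) (σ, w) = meanSlice w (ev (mono i j))
    rw [h2, mean_mono]
    split_ifs
    · rw [ev_mono]; simp
    · simp
  exact DFunLike.congr_fun h x

end Wiener

/-! ### Absolutely summable sequences -/

/-- The space of absolutely summable real sequences. -/
abbrev Seq : Type := lp (fun _ : ℕ => ℝ) 1

lemma Seq.hasSum_abs (x : Seq) : HasSum (fun n => |x n|) ‖x‖ := by
  have h := lp.hasSum_norm (p := 1) (by simp) x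
  simpa using h

namespace Seq

variable {E : Type*} [NormedAddCommGroup E] [NormedSpace ℝ E]

lemma norm_smul_le {v : ℕ → E} (hv : ∀ n, ‖v n‖ ≤ 1) (x : Seq) (n : ℕ) : ‖x n • v n‖ ≤ |x n| := by
  rw [norm_smul, Real.norm_eq_abs]
  exact mul_le_of_le_one_right (abs_nonneg _) (hv n)

variable [CompleteSpace E]

lemma summable_smul {v : ℕ → E} (hv : ∀ n, ‖v n‖ ≤ 1) (x : Seq) : Summable fun n => x n • v n :=
  Summable.of_norm_bounded x.hasSum_abs.summable (norm_smul_le hv x)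

/-- The continuous linear map `x ↦ ∑ x_n v_n`, for a sequence `v` in the unit ball. -/
def lift (v : ℕ → E) (hv : ∀ n, ‖v n‖ ≤ 1) : Seq →L[ℝ] E :=
  LinearMap.mkContinuous
    { toFun := fun x => ∑' n, x n • v n
      map_add' := fun x y => by
        rw [← (summable_smul hv x).tsum_add (summable_smul hv y)]
        simp [add_smul]
      map_smul' := fun c x => by
        rw [RingHom.id_apply, ← (summable_smul hv x).tsum_const_smul]
        simp [mul_smul] } 1
    fun x => by
      rw [one_mul]
      exact tsum_of_norm_bounded x.hasSum_abs (norm_smul_le hv x)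

lemma hasSum_lift {v : ℕ → E} (hv : ∀ n, ‖v n‖ ≤ 1) (x : Seq) :
    HasSum (fun n => x n • v n) (lift v hv x) := (summable_smul hv x).hasSum

lemma lift_single {v : ℕ → E} (hv : ∀ n, ‖v n‖ ≤ 1) (n : ℕ) (c : ℝ) :
    lift v hv (lp.single 1 n c) = c • v n := by
  refine (hasSum_lift hv _).unique ?_
  convert! hasSum_single n fun m hm => ?_
  · simp
  · simp [Pi.single_eq_of_ne hm]

lemma norm_lift_le {v : ℕ → E} (hv : ∀ n, ‖v n‖ ≤ 1) (x : Seq) : ‖lift v hv x‖ ≤ ‖x‖ :=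
  tsum_of_norm_bounded x.hasSum_abs (norm_smul_le hv x)

end Seq

/-! ### Sine coefficients -/

namespace Wiener

/-- The coefficient of `sin θ` in the imaginary part. -/
def sineOne : Wiener →L[ℝ] ℝ := lift fun n => if n.2 = 1 then 1 else if n.2 = -1 then -1 else 0

lemma sineOne_mono (i j : ℤ) :
    sineOne (mono i j) = if j = 1 then 1 else if j = -1 then -1 else 0 := by
  refine lift_mono (C := 1) (fun n => ?_) i j
  have := one_le_weight n
  split_ifs <;> simp <;> linarith

/-- The weighted coefficients of `sin ((n + 2) θ)` in the imaginary part. -/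
def sineTail : Wiener →L[ℝ] Seq := lift fun n =>
  if 2 ≤ |n.2| then lp.single 1 (n.2.natAbs - 2) (n.2.sign * (|n.2| + 1) : ℝ) else 0

lemma sineTail_mono (i j : ℤ) : sineTail (mono i j)
    = if 2 ≤ |j| then lp.single 1 (j.natAbs - 2) (j.sign * (|j| + 1) : ℝ) else 0 := by
  refine lift_mono (C := 1) (fun n => ?_) i j
  split_ifs with h
  · rw [lp.norm_single one_pos]
    have h1 : |(n.2.sign : ℝ)| = 1 := by
      have : n.2 ≠ 0 := by
        intro h0
        simp [h0] at h
      rcases lt_or_gt_of_ne this with h0 | h0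
      · simp [Int.sign_eq_neg_one_of_neg h0]
      · simp [Int.sign_eq_one_of_pos h0]
    rw [Real.norm_eq_abs, abs_mul, h1, abs_of_nonneg (by positivity), weight]
    push_cast
    linarith [abs_nonneg (n.1 : ℝ)]
  · simpa using (weight_pos n).le

/-- The coefficients are real, so the imaginary part on the circle is a pure sine series, and these
two functionals record all of its coefficients. -/
lemma im_evHom_eq_zero {x : Wiener} (h0 : sineOne x = 0) (h1 : sineTail x = 0) (w : Circle) :
    (evHom 1 w x).im = 0 := by
  -- Division by `n + 3` undoes the factor `|j| + 1` of `sineTail` at `|j| = n + 2`.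
  have hv : ∀ n : ℕ, ‖((w : ℂ) ^ (n + 2)).im / (n + 3)‖ ≤ 1 := fun n => by
    rw [norm_div, Real.norm_eq_abs, Real.norm_of_nonneg (by positivity), div_le_one (by positivity)]
    refine (abs_im_le_norm _).trans ?_
    rw [norm_pow, Circle.norm_coe, one_pow]
    linarith [Nat.cast_nonneg (α := ℝ) n]
  have key : imCLM.comp ((ContinuousMap.evalCLM ℝ ((1 : Circle), w)).comp ev)
      = (w : ℂ).im • sineOne + (Seq.lift _ hv).comp sineTail := by
    refine ext_mono fun i j => ?_
    change (ev (mono i j) (1, w)).im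
      = (w : ℂ).im * sineOne (mono i j) + Seq.lift _ hv (sineTail (mono i j))
    rw [sineOne_mono, sineTail_mono, ev_mono]
    simp only [Circle.coe_one, one_zpow, one_mul]
    have hinv : ∀ k : ℕ, ((w : ℂ) ^ (-(k : ℤ))).im = -((w : ℂ) ^ k).im := fun k => by
      rw [zpow_neg, zpow_natCast, ← Circle.coe_pow, ← Circle.coe_inv, Circle.coe_inv_eq_conj,
        conj_im]
    rcases le_or_gt 2 |j| with hj | hj
    · have h1 : j ≠ 1 := by rintro rfl; simp at hj
      have h2 : j ≠ -1 := by rintro rfl; simp at hj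
      rw [if_neg h1, if_neg h2, if_pos hj, Seq.lift_single, mul_zero, zero_add]
      obtain ⟨k, rfl | rfl⟩ : ∃ k : ℕ, j = ((k + 2 : ℕ) : ℤ) ∨ j = -((k + 2 : ℕ) : ℤ) := by
        refine ⟨j.natAbs - 2, ?_⟩
        have := le_abs.1 hj
        omega
      · rw [zpow_natCast, Int.sign_eq_one_of_pos (by omega), Int.natAbs_natCast, abs_of_nonneg (by positivity)]
        simp only [Nat.add_sub_cancel, smul_eq_mul]
        push_cast
        have : (k : ℝ) + 3 ≠ 0 := by positivity
        field_simp
        ring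
      · rw [hinv, Int.sign_eq_neg_one_of_neg (by omega), Int.natAbs_neg, Int.natAbs_natCast, abs_neg,
          abs_of_nonneg (by positivity)]
        simp only [Nat.add_sub_cancel, smul_eq_mul]
        push_cast
        have : (k : ℝ) + 3 ≠ 0 := by positivity
        field_simp
        ring
    · rw [if_neg (not_le.2 hj), map_zero, add_zero]
      obtain rfl | rfl | rfl : j = 0 ∨ j = 1 ∨ j = -1 := by
        rw [abs_lt] at hj
        omega
      · simp
      · simp
      · simp
  have := DFunLike.congr_fun key x
  change (evHom 1 w x).im = (w : ℂ).im * sineOne x + Seq.lift _ hv (sineTail x) at this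
  rw [this, h0, h1, map_zero, mul_zero, add_zero]

end Wiener

end VortexPair

end

/-! ### The coefficient space and the contour functional on it -/

noncomputable section

namespace VortexPair

/-! ### Boundary perturbations with coefficients in a weighted sequence space -/

/-- The coefficient weights: `x : Seq` describes `∑ x_n / ((n + 1) (n + 3)) w̄ ^ (n + 1)`. -/
def coefWeight (n : ℕ) : ℝ := 1 / ((n + 1) * (n + 3))

lemma coefWeight_nonneg (n : ℕ) : 0 ≤ coefWeight n := by unfold coefWeight; positivity

lemma coefWeight_mul_le {n : ℕ} {c : ℝ} (hc : c ≤ (n + 1) * (n + 3)) : coefWeight n * c ≤ 1 := by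
  rw [coefWeight, one_div, inv_mul_le_iff₀ (by positivity), mul_one]
  exact hc

lemma norm_coefWeight_smul_le {E : Type*} [NormedAddCommGroup E] [NormedSpace ℝ E] {n : ℕ} {v : E}
    (hv : ‖v‖ ≤ (n + 1) * (n + 3)) : ‖coefWeight n • v‖ ≤ 1 := by
  rw [norm_smul, Real.norm_of_nonneg (coefWeight_nonneg n)]
  exact coefWeight_mul_le hv

lemma norm_conj_pow (w : Circle) (k : ℕ) : ‖conj (w : ℂ) ^ k‖ = 1 := by
  simp [Circle.norm_coe]

lemma circle_conj_mul (w : Circle) : conj (w : ℂ) * w = 1 := by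
  rw [mul_comm, Complex.mul_conj, Circle.normSq_coe, ofReal_one]

namespace Seq

/-- The value of the perturbation at a point of the circle. -/
def val (w : Circle) : Seq →L[ℝ] ℂ :=
  lift (fun n => coefWeight n • conj (w : ℂ) ^ (n + 1)) fun n => norm_coefWeight_smul_le <| by
    rw [norm_conj_pow]
    nlinarith [Nat.cast_nonneg (α := ℝ) n]

/-- The value of the derivative of the perturbation at a point of the circle. -/
def der (w : Circle) : Seq →L[ℝ] ℂ :=
  lift (fun n => coefWeight n • (-(n + 1 : ℂ) * conj (w : ℂ) ^ (n + 2))) fun n =>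
    norm_coefWeight_smul_le <| by
      rw [norm_mul, norm_conj_pow, norm_neg]
      have : ‖(n + 1 : ℂ)‖ = n + 1 := by exact_mod_cast Complex.norm_natCast (n + 1)
      rw [this]
      nlinarith [Nat.cast_nonneg (α := ℝ) n]

lemma hasSum_val (x : Seq) (w : Circle) :
    HasSum (fun n => x n • (coefWeight n • conj (w : ℂ) ^ (n + 1))) (val w x) := hasSum_lift _ x

lemma hasSum_der (x : Seq) (w : Circle) :
    HasSum (fun n => x n • (coefWeight n • (-(n + 1 : ℂ) * conj (w : ℂ) ^ (n + 2)))) (der w x) :=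
  hasSum_lift _ x

lemma norm_val_le (x : Seq) (w : Circle) : ‖val w x‖ ≤ ‖x‖ := norm_lift_le _ x

lemma norm_der_le (x : Seq) (w : Circle) : ‖der w x‖ ≤ ‖x‖ := norm_lift_le _ x

lemma norm_pow_sub_pow_le {a b : ℂ} (ha : ‖a‖ ≤ 1) (hb : ‖b‖ ≤ 1) (k : ℕ) :
    ‖a ^ k - b ^ k‖ ≤ k * ‖a - b‖ := by
  induction k with
  | zero => simp
  | succ k ih =>
    have e : a ^ (k + 1) - b ^ (k + 1) = a * (a ^ k - b ^ k) + (a - b) * b ^ k := by ring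
    rw [e]
    refine (norm_add_le _ _).trans ?_
    rw [norm_mul, norm_mul, norm_pow]
    have h1 : ‖a‖ * ‖a ^ k - b ^ k‖ ≤ k * ‖a - b‖ :=
      (mul_le_of_le_one_left (norm_nonneg _) ha).trans ih
    have h2 : ‖a - b‖ * ‖b‖ ^ k ≤ ‖a - b‖ :=
      mul_le_of_le_one_right (norm_nonneg _) (pow_le_one₀ (norm_nonneg _) hb)
    push_cast
    linarith

/-- The coefficient weight absorbs the factor `(n + 1)(n + 2)` of a second derivative. The
perturbations are therefore `C^{1,1}`, which the convexity argument requires. -/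
lemma norm_der_sub_le (x : Seq) (τ w : Circle) :
    ‖der τ x - der w x‖ ≤ ‖x‖ * ‖(τ : ℂ) - w‖ := by
  have h := (hasSum_der x τ).sub (hasSum_der x w)
  rw [← h.tsum_eq]
  refine tsum_of_norm_bounded (x.hasSum_abs.mul_right _) fun n => ?_
  rw [← smul_sub, ← smul_sub, ← mul_sub, norm_smul, norm_smul, norm_mul, norm_neg,
    Real.norm_of_nonneg (coefWeight_nonneg n), Real.norm_eq_abs]
  refine mul_le_mul_of_nonneg_left ?_ (abs_nonneg _)
  have h1 : ‖(n + 1 : ℂ)‖ = n + 1 := by exact_mod_cast Complex.norm_natCast (n + 1)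
  have h2 := norm_pow_sub_pow_le (a := conj (τ : ℂ)) (b := conj (w : ℂ)) (by simp [Circle.norm_coe])
    (by simp [Circle.norm_coe]) (n + 2)
  have h3 : ‖conj (τ : ℂ) - conj (w : ℂ)‖ = ‖(τ : ℂ) - w‖ := by
    rw [← map_sub, RCLike.norm_conj]
  rw [h3] at h2
  rw [h1]
  have h4 : coefWeight n * ((n + 1) * (n + 2)) ≤ 1 := coefWeight_mul_le (by
    nlinarith [Nat.cast_nonneg (α := ℝ) n])
  calc coefWeight n * ((n + 1) * ‖conj (τ : ℂ) ^ (n + 2) - conj (w : ℂ) ^ (n + 2)‖)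
      ≤ coefWeight n * ((n + 1) * ((n + 2 : ℕ) * ‖(τ : ℂ) - w‖)) := by
        have := coefWeight_nonneg n
        gcongr
    _ = coefWeight n * ((n + 1) * (n + 2)) * ‖(τ : ℂ) - w‖ := by push_cast; ring
    _ ≤ ‖(τ : ℂ) - w‖ := mul_le_of_le_one_left (norm_nonneg _) h4

lemma conj_exp_pow (t : ℝ) (k : ℕ) :
    conj (Circle.exp t : ℂ) ^ k = cexp (-(k * I) * t) := by
  rw [Circle.coe_exp, ← Complex.exp_conj, ← Complex.exp_nat_mul]
  congr 1
  simp
  ring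

/-- The series may be differentiated termwise, with the summable majorant `|x n|` for the
derivatives. -/
lemma hasDerivAt_val_exp (x : Seq) (t : ℝ) : HasDerivAt (fun θ : ℝ => val (Circle.exp θ) x)
    (der (Circle.exp t) x * (I * (Circle.exp t : ℂ))) t := by
  have hterm : ∀ (n : ℕ) (θ : ℝ), HasDerivAt
      (fun θ : ℝ => x n • (coefWeight n • conj (Circle.exp θ : ℂ) ^ (n + 1)))
      (x n • (coefWeight n • (-((n + 1 : ℕ) * I) * conj (Circle.exp θ : ℂ) ^ (n + 1)))) θ := by
    intro n θ
    suffices h : HasDerivAt (fun θ : ℝ => conj (Circle.exp θ : ℂ) ^ (n + 1))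
        (-((n + 1 : ℕ) * I) * conj (Circle.exp θ : ℂ) ^ (n + 1)) θ from
      (h.const_smul (coefWeight n)).const_smul (x n : ℝ)
    simp only [conj_exp_pow]
    have h1 : HasDerivAt (fun z : ℂ => cexp (-((n + 1 : ℕ) * I) * z))
        (cexp (-((n + 1 : ℕ) * I) * (θ : ℂ)) * (-((n + 1 : ℕ) * I) * 1)) (θ : ℂ) :=
      ((hasDerivAt_id _).const_mul _).cexp
    convert! h1.comp_ofReal using 1
    ring
  have h := hasDerivAt_tsum (𝕜 := ℝ) x.hasSum_abs.summable hterm (fun n θ => ?_) (y₀ := 0)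
    (hasSum_val x _).summable t
  · have e1 : (fun θ : ℝ => val (Circle.exp θ) x)
        = fun θ => ∑' n, x n • (coefWeight n • conj (Circle.exp θ : ℂ) ^ (n + 1)) := by
      funext θ
      exact (hasSum_val x _).tsum_eq.symm
    rw [e1]
    convert! h using 1
    refine (((hasSum_der x (Circle.exp t)).mul_right _).tsum_eq.symm).trans ?_
    refine tsum_congr fun n => ?_
    have h1 := circle_conj_mul (Circle.exp t)
    rw [smul_mul_assoc, smul_mul_assoc]
    congr 2
    rw [pow_succ (conj (Circle.exp t : ℂ)) (n + 1), Nat.cast_add, Nat.cast_one]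
    linear_combination (-(n + 1 : ℂ) * conj (Circle.exp t : ℂ) ^ (n + 1) * I) * h1
  · refine norm_smul_le (v := fun n => coefWeight n •
      (-((n + 1 : ℕ) * I) * conj (Circle.exp θ : ℂ) ^ (n + 1))) (fun n => ?_) x n
    refine norm_coefWeight_smul_le ?_
    rw [norm_mul, norm_conj_pow, norm_neg, norm_mul, Complex.norm_natCast, norm_I]
    push_cast
    nlinarith [Nat.cast_nonneg (α := ℝ) n]

lemma circleDeriv_val (x : Seq) (w : Circle) : circleDeriv (fun w => val w x) w = der w x := by
  refine circleDeriv_eq ?_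
  have h1 : (fun θ : ℝ => val (w * Circle.exp θ) x)
      = fun θ : ℝ => (fun t : ℝ => val (Circle.exp t) x) (Complex.arg w + θ) := by
    funext θ
    simp [Circle.exp_add, Circle.exp_arg]
  rw [h1]
  have h2 := hasDerivAt_val_exp x (Complex.arg w + 0)
  have h3 := h2.comp_const_add (Complex.arg w) 0
  simpa [Circle.exp_arg] using h3

lemma continuous_der_exp (x : Seq) : Continuous fun t : ℝ => der (Circle.exp t) x := by
  have h : Continuous fun w : Circle => der w x := by
    refine continuous_iff_continuousAt.2 fun w => ?_
    rw [ContinuousAt, tendsto_iff_norm_sub_tendsto_zero]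
    refine squeeze_zero (fun _ => norm_nonneg _) (fun τ => norm_der_sub_le x τ w) ?_
    have h1 : Continuous fun τ : Circle => ‖x‖ * ‖(τ : ℂ) - w‖ := by fun_prop
    simpa using h1.tendsto w
  exact h.comp Circle.exp.continuous

/-- The circle has diameter 2, so `|τ - w|^(1-α) ≤ 2`; Lipschitz derivatives are therefore Hölder
continuous. -/
lemma norm_sub_le_rpow {α : ℝ} (hα₀ : 0 < α) (hα₁ : α < 1) (τ w : Circle) :
    ‖(τ : ℂ) - w‖ ≤ 2 * ‖(τ : ℂ) - w‖ ^ α := by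
  have h2 : ‖(τ : ℂ) - w‖ ≤ 2 := by
    refine (norm_sub_le _ _).trans ?_
    simp [Circle.norm_coe]
    norm_num
  rcases (norm_nonneg ((τ : ℂ) - w)).eq_or_lt with h0 | h0
  · rw [← h0, Real.zero_rpow hα₀.ne']
    simp
  · calc ‖(τ : ℂ) - w‖ = ‖(τ : ℂ) - w‖ ^ (1 - α) * ‖(τ : ℂ) - w‖ ^ α := by
          rw [← Real.rpow_add h0]; simp
      _ ≤ 2 * ‖(τ : ℂ) - w‖ ^ α := by
          refine mul_le_mul_of_nonneg_right ?_ (by positivity)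
          calc ‖(τ : ℂ) - w‖ ^ (1 - α) ≤ 2 ^ (1 - α) :=
                Real.rpow_le_rpow h0.le h2 (by linarith)
            _ ≤ 2 ^ (1 : ℝ) := Real.rpow_le_rpow_of_exponent_le (by norm_num) (by linarith)
            _ = 2 := Real.rpow_one 2

/-- The perturbation as an element of `C^{1+α}`. -/
def toHolderFun (α : ℝ) [hα : Fact (0 < α ∧ α < 1)] (x : Seq) : HolderX α :=
  ⟨fun w => val w x, by
    refine ⟨⟨?_, 2 * ‖x‖, fun τ w => ?_⟩, fun n => x n * coefWeight n, fun w => ?_⟩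
    · rw [contDiff_one_iff_deriv]
      refine ⟨fun t => (hasDerivAt_val_exp x t).differentiableAt, ?_⟩
      have : deriv (fun θ : ℝ => val (Circle.exp θ) x)
          = fun t => der (Circle.exp t) x * (I * (Circle.exp t : ℂ)) :=
        funext fun t => (hasDerivAt_val_exp x t).deriv
      rw [this]
      exact (continuous_der_exp x).mul (by fun_prop)
    · rw [circleDeriv_val, circleDeriv_val]
      refine (norm_der_sub_le x τ w).trans ?_
      have := norm_sub_le_rpow hα.out.1 hα.out.2 τ w
      nlinarith [norm_nonneg x]
    · convert! hasSum_val x w using 2 with n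
      simp [mul_assoc]⟩

lemma toHolderFun_apply (α : ℝ) [Fact (0 < α ∧ α < 1)] (x : Seq) (w : Circle) :
    toHolderFun α x w = val w x := rfl

lemma circleDeriv_toHolderFun (α : ℝ) [Fact (0 < α ∧ α < 1)] (x : Seq) (w : Circle) :
    circleDeriv (toHolderFun α x) w = der w x := circleDeriv_val x w

/-- The continuous linear map from coefficient sequences to `C^{1+α}`. -/
def toHolder (α : ℝ) [hα : Fact (0 < α ∧ α < 1)] : Seq →L[ℝ] HolderX α :=
  LinearMap.mkContinuous
    { toFun := toHolderFun α
      map_add' := fun x y => Subtype.ext (funext fun w => map_add (val w) x y)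
      map_smul' := fun c x => Subtype.ext (funext fun w => map_smul (val w) c x) } 4
    fun x => by
      -- The constant is `4 = 1 + 1 + 2`, from the function, its derivative and the Hölder quotient.
      change ‖toHolderFun α x‖ ≤ _
      rw [HolderX.norm_def]
      simp only [circleDeriv_toHolderFun, toHolderFun_apply]
      have h1 : (⨆ w : Circle, ‖val w x‖) ≤ ‖x‖ := ciSup_le fun w => norm_val_le x w
      have h2 : (⨆ w : Circle, ‖der w x‖) ≤ ‖x‖ := ciSup_le fun w => norm_der_le x w
      have h3 : (⨆ p : Circle × Circle,
          ‖der p.1 x - der p.2 x‖ / ‖(p.1 : ℂ) - (p.2 : ℂ)‖ ^ α) ≤ 2 * ‖x‖ := by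
        refine ciSup_le fun p => ?_
        refine div_le_of_le_mul₀ (by positivity) (by positivity) ?_
        refine (norm_der_sub_le x p.1 p.2).trans ?_
        have := norm_sub_le_rpow hα.out.1 hα.out.2 p.1 p.2
        nlinarith [norm_nonneg x]
      linarith

lemma toHolder_apply (α : ℝ) [Fact (0 < α ∧ α < 1)] (x : Seq) (w : Circle) :
    toHolder α x w = val w x := rfl

lemma circleDeriv_toHolder (α : ℝ) [Fact (0 < α ∧ α < 1)] (x : Seq) (w : Circle) :
    circleDeriv (toHolder α x) w = der w x := circleDeriv_val x w

end Seq

end VortexPair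

end

noncomputable section

namespace VortexPair

/-- The diagonal `τ = w` has to be ignored: a difference quotient in the Wiener algebra takes its
limit value there, while division by zero gives `0` in `contourF`. -/
lemma circleMean_congr {g h : Circle → ℂ} (w : Circle) (hgh : ∀ τ, τ ≠ w → g τ = h τ) :
    circleMean g = circleMean h := by
  rw [circleMean, circleMean]
  congr 1
  refine intervalIntegral.integral_congr_ae ?_
  have hnull : MeasureTheory.volume {θ : ℝ | Circle.exp θ = w} = 0 := by
    refine Set.Countable.measure_zero ?_ _
    refine (countable_range fun m : ℤ => Complex.arg w + m * (2 * Real.pi)).mono ?_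
    intro θ hθ
    have h1 : Circle.exp θ = Circle.exp (Complex.arg w) := by
      rw [Circle.exp_arg]
      exact hθ
    obtain ⟨m, hm⟩ := Circle.exp_eq_exp.1 h1
    exact ⟨m, hm.symm⟩
  filter_upwards [MeasureTheory.compl_mem_ae_iff.2 hnull] with θ hθ _
  rw [hgh _ hθ]

/-! ### Perturbations as elements of the Wiener algebra -/

namespace Wiener

/-- The continuous linear map sending the coefficients of a perturbation to the element of the
Wiener algebra with the monomials replaced by the given elements. -/
def ofSeq (m : ℕ → Wiener) (hm : ∀ n : ℕ, ‖m n‖ ≤ (n + 1) * (n + 3)) : Seq →L[ℝ] Wiener :=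
  Seq.lift (fun n => coefWeight n • m n) fun n => norm_coefWeight_smul_le (hm n)

lemma hasSum_evHom_ofSeq {m : ℕ → Wiener} (hm : ∀ n : ℕ, ‖m n‖ ≤ (n + 1) * (n + 3)) (x : Seq)
    (τ w : Circle) :
    HasSum (fun n => x n • (coefWeight n • evHom τ w (m n))) (evHom τ w (ofSeq m hm x)) := by
  have h := ((ContinuousMap.evalCLM ℝ (τ, w)).comp ev).hasSum (Seq.hasSum_lift
    (fun n => norm_coefWeight_smul_le (hm n)) x)
  convert! h using 2 with n
  rw [map_smul, map_smul]
  rfl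

lemma norm_mono_neg_le {i j : ℤ} {n : ℕ} {C : ℝ} (hi : (|i| + |j| : ℤ) ≤ (n : ℤ))
    (hn : (1 + n : ℝ) ≤ C) : ‖mono i j‖ ≤ C := by
  refine (norm_mono_le i j).trans (le_trans ?_ hn)
  have : ((|i| + |j| : ℤ) : ℝ) ≤ ((n : ℤ) : ℝ) := by exact_mod_cast hi
  push_cast at this
  simp only [weight]
  linarith

/-- `f(τ)` in the Wiener algebra. -/
def valT : Seq →L[ℝ] Wiener := ofSeq (fun n => mono (-((n + 1 : ℕ) : ℤ)) 0) fun n =>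
  norm_mono_neg_le (n := n + 1) (by rw [abs_neg, Nat.abs_cast]; simp) (by
    push_cast; nlinarith [Nat.cast_nonneg (α := ℝ) n])

/-- `f(w)` in the Wiener algebra. -/
def valW : Seq →L[ℝ] Wiener := ofSeq (fun n => mono 0 (-((n + 1 : ℕ) : ℤ))) fun n =>
  norm_mono_neg_le (n := n + 1) (by rw [abs_neg, Nat.abs_cast]; simp) (by
    push_cast; nlinarith [Nat.cast_nonneg (α := ℝ) n])

/-- The conjugate of `f(τ)` in the Wiener algebra. -/
def conjT : Seq →L[ℝ] Wiener := ofSeq (fun n => mono ((n + 1 : ℕ) : ℤ) 0) fun n =>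
  norm_mono_neg_le (n := n + 1) (by rw [Nat.abs_cast]; simp) (by
    push_cast; nlinarith [Nat.cast_nonneg (α := ℝ) n])

/-- The conjugate of `f(w)` in the Wiener algebra. -/
def conjW : Seq →L[ℝ] Wiener := ofSeq (fun n => mono 0 ((n + 1 : ℕ) : ℤ)) fun n =>
  norm_mono_neg_le (n := n + 1) (by rw [Nat.abs_cast]; simp) (by
    push_cast; nlinarith [Nat.cast_nonneg (α := ℝ) n])

/-- This explains the choice of `coefWeight`: the derivative of `w̄^(n+1)` has factor `n + 1` and a
monomial of weight `n + 3`. -/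
lemma norm_der_mono_le {i j : ℤ} {n : ℕ} (hi : (|i| + |j| : ℤ) ≤ ((n + 2 : ℕ) : ℤ)) :
    ‖(-(n + 1 : ℝ)) • mono i j‖ ≤ (n + 1) * (n + 3) := by
  rw [norm_smul, norm_neg, Real.norm_of_nonneg (by positivity)]
  refine mul_le_mul_of_nonneg_left ?_ (by positivity)
  exact norm_mono_neg_le hi (by push_cast; linarith)

/-- `f'(τ)` in the Wiener algebra. -/
def derT : Seq →L[ℝ] Wiener :=
  ofSeq (fun n => (-(n + 1 : ℝ)) • mono (-((n + 2 : ℕ) : ℤ)) 0) fun n =>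
    norm_der_mono_le (by rw [abs_neg, Nat.abs_cast]; simp)

/-- `f'(w)` in the Wiener algebra. -/
def derW : Seq →L[ℝ] Wiener :=
  ofSeq (fun n => (-(n + 1 : ℝ)) • mono 0 (-((n + 2 : ℕ) : ℤ))) fun n =>
    norm_der_mono_le (by rw [abs_neg, Nat.abs_cast]; simp)

/-- A divided difference of `w̄^(n+1)` consists of `n + 1` monomials of weight at most `n + 3`, so
it costs no more than a derivative. -/
lemma norm_sum_mono_le {n : ℕ} {i j : ℕ → ℤ}
    (hij : ∀ k ∈ Finset.range (n + 1), |i k| + |j k| ≤ ((n + 2 : ℕ) : ℤ)) :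
    ‖∑ k ∈ Finset.range (n + 1), mono (i k) (j k)‖ ≤ (n + 1) * (n + 3) := by
  have h : ∀ k ∈ Finset.range (n + 1), ‖mono (i k) (j k)‖ ≤ (n + 3 : ℝ) := fun k hk =>
    norm_mono_neg_le (hij k hk) (by push_cast; linarith)
  refine (norm_sum_le_of_le _ h).trans_eq ?_
  rw [Finset.sum_const, Finset.card_range, nsmul_eq_mul]
  push_cast
  ring

/-- The difference quotient `(f(τ) - f(w)) / (τ - w)` in the Wiener algebra. -/
def quot : Seq →L[ℝ] Wiener :=
  ofSeq (fun n => -∑ k ∈ Finset.range (n + 1), mono (-((k + 1 : ℕ) : ℤ)) (-((n - k + 1 : ℕ) : ℤ)))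
    fun n => by
      rw [norm_neg]
      refine norm_sum_mono_le fun k hk => ?_
      rw [abs_neg, abs_neg, Nat.abs_cast, Nat.abs_cast]
      have := Finset.mem_range.1 hk
      omega

/-- The quotient of the conjugate of `f(τ) - f(w)` by `τ - w` in the Wiener algebra. -/
def quotConj : Seq →L[ℝ] Wiener :=
  ofSeq (fun n => ∑ k ∈ Finset.range (n + 1), mono ((k : ℕ) : ℤ) ((n - k : ℕ) : ℤ))
    fun n => by
      refine norm_sum_mono_le fun k hk => ?_
      rw [Nat.abs_cast, Nat.abs_cast]
      have := Finset.mem_range.1 hk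
      omega

lemma coe_zpow_neg (w : Circle) (k : ℕ) : (w : ℂ) ^ (-(k : ℤ)) = conj (w : ℂ) ^ k := by
  rw [zpow_neg, zpow_natCast, ← inv_pow, ← Circle.coe_inv, Circle.coe_inv_eq_conj]

lemma evHom_valT (x : Seq) (τ w : Circle) : evHom τ w (valT x) = Seq.val τ x := by
  refine (hasSum_evHom_ofSeq _ x τ w).unique ?_
  convert! Seq.hasSum_val x τ using 4 with n
  rw [evHom_mono, coe_zpow_neg, zpow_zero, mul_one]

lemma evHom_valW (x : Seq) (τ w : Circle) : evHom τ w (valW x) = Seq.val w x := by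
  refine (hasSum_evHom_ofSeq _ x τ w).unique ?_
  convert! Seq.hasSum_val x w using 4 with n
  rw [evHom_mono, coe_zpow_neg, zpow_zero, one_mul]

lemma hasSum_conj_val (x : Seq) (w : Circle) :
    HasSum (fun n => x n • (coefWeight n • (w : ℂ) ^ (n + 1))) (conj (Seq.val w x)) := by
  have h := (Complex.hasSum_conj' (f := fun n => x n • (coefWeight n • conj (w : ℂ) ^ (n + 1)))
    (x := Seq.val w x)).2 (Seq.hasSum_val x w)
  convert! h using 2 with n
  simp

lemma evHom_conjT (x : Seq) (τ w : Circle) : evHom τ w (conjT x) = conj (Seq.val τ x) := by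
  refine (hasSum_evHom_ofSeq _ x τ w).unique ?_
  convert! hasSum_conj_val x τ using 4 with n
  rw [evHom_mono, zpow_natCast, zpow_zero, mul_one]

lemma evHom_conjW (x : Seq) (τ w : Circle) : evHom τ w (conjW x) = conj (Seq.val w x) := by
  refine (hasSum_evHom_ofSeq _ x τ w).unique ?_
  convert! hasSum_conj_val x w using 4 with n
  rw [evHom_mono, zpow_natCast, zpow_zero, one_mul]

lemma evHom_derT (x : Seq) (τ w : Circle) : evHom τ w (derT x) = Seq.der τ x := by
  refine (hasSum_evHom_ofSeq _ x τ w).unique ?_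
  convert! Seq.hasSum_der x τ using 4 with n
  rw [evHom_smul, evHom_mono, coe_zpow_neg, zpow_zero, mul_one]
  push_cast
  rfl

lemma evHom_derW (x : Seq) (τ w : Circle) : evHom τ w (derW x) = Seq.der w x := by
  refine (hasSum_evHom_ofSeq _ x τ w).unique ?_
  convert! Seq.hasSum_der x w using 4 with n
  rw [evHom_smul, evHom_mono, coe_zpow_neg, zpow_zero, one_mul]
  push_cast
  rfl

/-- On the circle `τ̄ - w̄ = -τ̄ w̄ (τ - w)`, which turns the geometric sum in `τ̄, w̄` into a
quotient by `τ - w`. -/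
lemma evHom_quot (x : Seq) {τ w : Circle} (h : τ ≠ w) :
    evHom τ w (quot x) = (Seq.val τ x - Seq.val w x) / ((τ : ℂ) - w) := by
  have hA : (τ : ℂ) - w ≠ 0 := sub_ne_zero.2 fun e => h (Circle.ext e)
  rw [eq_div_iff hA]
  refine ((hasSum_evHom_ofSeq _ x τ w).mul_right _).unique ?_
  convert! (Seq.hasSum_val x τ).sub (Seq.hasSum_val x w) using 2 with n
  rw [← smul_sub, ← smul_sub, smul_mul_assoc, smul_mul_assoc]
  congr 2
  rw [← geom_sum₂_mul, map_neg, map_sum]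
  simp only [evHom_mono, coe_zpow_neg]
  have h1 : conj (τ : ℂ) - conj (w : ℂ) = -(conj (τ : ℂ) * conj (w : ℂ)) * ((τ : ℂ) - w) := by
    linear_combination conj (w : ℂ) * circle_conj_mul τ - conj (τ : ℂ) * circle_conj_mul w
  rw [h1, Finset.sum_mul, neg_mul, Finset.sum_mul, ← Finset.sum_neg_distrib]
  refine Finset.sum_congr rfl fun k hk => ?_
  have : n + 1 - 1 - k = n - k := by omega
  rw [this]
  ring

lemma evHom_quotConj (x : Seq) {τ w : Circle} (h : τ ≠ w) :
    evHom τ w (quotConj x) = conj (Seq.val τ x - Seq.val w x) / ((τ : ℂ) - w) := by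
  have hA : (τ : ℂ) - w ≠ 0 := sub_ne_zero.2 fun e => h (Circle.ext e)
  rw [eq_div_iff hA, map_sub]
  refine ((hasSum_evHom_ofSeq _ x τ w).mul_right _).unique ?_
  convert! (hasSum_conj_val x τ).sub (hasSum_conj_val x w) using 2 with n
  rw [← smul_sub, ← smul_sub, smul_mul_assoc, smul_mul_assoc]
  congr 2
  rw [← geom_sum₂_mul, map_sum]
  congr 1
  refine Finset.sum_congr rfl fun k hk => ?_
  have : n + 1 - 1 - k = n - k := by omega
  rw [this, evHom_mono, zpow_natCast, zpow_natCast]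

/-- The powers of `w` in `f'` start at `w̄²`, so the `sin θ` equation is left to the two scalars `Ω`
and `Z`. -/
lemma sineOne_derW (x : Seq) : sineOne (derW x) = 0 := by
  have h := sineOne.hasSum (Seq.hasSum_lift
    (fun n => norm_coefWeight_smul_le (norm_der_mono_le (i := 0) (j := -((n + 2 : ℕ) : ℤ)) (n := n)
      (by rw [abs_neg, Nat.abs_cast]; simp))) x)
  refine h.unique ?_
  convert! hasSum_zero with n
  rw [map_smul, map_smul, map_smul, sineOne_mono, if_neg (by omega), if_neg (by omega)]
  simp

/-- The factors `n + 1` of the derivative and `n + 3` of `sineTail` cancel `coefWeight n` exactly.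
The linearization in `f_j` thus becomes the scalar `-γ_j`, without loss of regularity. -/
lemma sineTail_derW (x : Seq) : sineTail (derW x) = x := by
  have h := sineTail.hasSum (Seq.hasSum_lift
    (fun n => norm_coefWeight_smul_le (norm_der_mono_le (i := 0) (j := -((n + 2 : ℕ) : ℤ)) (n := n)
      (by rw [abs_neg, Nat.abs_cast]; simp))) x)
  refine h.unique ?_
  convert! lp.hasSum_single (p := 1) (by simp) x with n
  rw [map_smul, map_smul, map_smul, sineTail_mono, abs_neg, Nat.abs_cast, if_pos (by omega),
    Int.natAbs_neg, Int.natAbs_natCast, Nat.add_sub_cancel, Int.sign_eq_neg_one_of_neg (by omega),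
    ← lp.single_smul, ← lp.single_smul, ← lp.single_smul]
  congr 1
  simp only [smul_eq_mul, coefWeight]
  push_cast
  have : (n : ℝ) + 3 ≠ 0 := by positivity
  have : (n : ℝ) + 1 ≠ 0 := by positivity
  field_simp
  ring

end Wiener

end VortexPair

end

noncomputable section

namespace VortexPair

open Wiener Filter Topology

/-! ### The functional in the Wiener algebra -/

/-- The state space of the parameters `(Ω, Z)` and the coefficients of `(f₁, f₂)`. -/
abbrev State : Type := ℝ × ℝ × (Fin 2 → Seq)

/-- The factor `1 + ε b_j (f_j(τ) - f_j(w)) / (τ - w)` of the self-interaction denominator. -/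
def selfDenom (b : Fin 2 → ℝ) (j : Fin 2) (p : ℝ × State) : Wiener :=
  1 + (p.1 * b j) • quot (p.2.2.2 j)

/-- The denominator of the interaction of the two patches. -/
def crossDenom (b : Fin 2 → ℝ) (d : ℝ) (j : Fin 2) (p : ℝ × State) : Wiener :=
  p.1 • (b (1 - j) • mono 1 0 + b j • mono 0 1)
    + p.1 ^ 2 • (b (1 - j) ^ 2 • valT (p.2.2.2 (1 - j)) + b j ^ 2 • valW (p.2.2.2 j)) - d • 1

/-- The integral of the self-interaction. -/
def selfInt (b : Fin 2 → ℝ) (j : Fin 2) (p : ℝ × State) : Wiener :=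
  mean ((quotConj (p.2.2.2 j) + mono (-1) (-1) * quot (p.2.2.2 j)) *
    Ring.inverse (selfDenom b j p) * (derT (p.2.2.2 j) - quot (p.2.2.2 j)))

/-- The integral of the interaction of the two patches. -/
def crossInt (b : Fin 2 → ℝ) (d : ℝ) (j : Fin 2) (p : ℝ × State) : Wiener :=
  mean ((mono (-1) 0 + (p.1 * b (1 - j)) • conjT (p.2.2.2 (1 - j))) *
    (1 + (p.1 * b (1 - j)) • derT (p.2.2.2 (1 - j))) * Ring.inverse (crossDenom b d j p))

/-- The expression whose imaginary part is `contourF`, in the Wiener algebra. -/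
def wienerF (b γ : Fin 2 → ℝ) (d : ℝ) (j : Fin 2) (p : ℝ × State) : Wiener :=
  (2 * p.2.1) • (((p.1 * b j) • (mono 0 (-1) + (p.1 * b j) • conjW (p.2.2.2 j))
      + ((-1) ^ ((j : ℕ) + 1) * p.2.2.1 - (j : ℕ) * d) • 1) * mono 0 1
        * (1 + (p.1 * b j) • derW (p.2.2.2 j)))
    - γ j • derW (p.2.2.2 j)
    + (p.1 * b j * γ j) • (mono 0 1 * (1 + (p.1 * b j) • derW (p.2.2.2 j)) * selfInt b j p)
    - γ (1 - j) • (mono 0 1 * (1 + (p.1 * b j) • derW (p.2.2.2 j)) * crossInt b d j p)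

/-- The sine coefficients of `wienerF`. -/
def sineF (b γ : Fin 2 → ℝ) (d : ℝ) (p : ℝ × State) : State :=
  (sineOne (wienerF b γ d 0 p), sineOne (wienerF b γ d 1 p), fun j => sineTail (wienerF b γ d j p))

/-- With numerator and denominator divided by `A²`, only difference quotients remain in the kernel.
On the circle `conj A / A = -1 / (τ w)`, which is the origin of `mono (-1) (-1)` in `selfInt`. -/
lemma contourF_eq {α : ℝ} [Fact (0 < α ∧ α < 1)] (b γ : Fin 2 → ℝ) (d : ℝ) (j : Fin 2)
    (p : ℝ × State) (h1 : IsUnit (selfDenom b j p)) (h2 : IsUnit (crossDenom b d j p))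
    (w : Circle) :
    contourF b γ d p.1 p.2.1 p.2.2.1 (fun j => Seq.toHolder α (p.2.2.2 j)) j w
      = (evHom 1 w (wienerF b γ d j p)).im := by
  have hself : evHom 1 w (selfInt b j p) = circleMean fun τ =>
      (((τ : ℂ) - w) * conj (Seq.val τ (p.2.2.2 j) - Seq.val w (p.2.2.2 j))
        - conj ((τ : ℂ) - w) * (Seq.val τ (p.2.2.2 j) - Seq.val w (p.2.2.2 j)))
        / (((τ : ℂ) - w) * (((τ : ℂ) - w)
          + p.1 * b j * (Seq.val τ (p.2.2.2 j) - Seq.val w (p.2.2.2 j))))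
        * (Seq.der τ (p.2.2.2 j)
          - (Seq.val τ (p.2.2.2 j) - Seq.val w (p.2.2.2 j)) / ((τ : ℂ) - w)) := by
    rw [selfInt, evHom_mean]
    refine circleMean_congr w fun τ hτ => ?_
    have hA : (τ : ℂ) - w ≠ 0 := sub_ne_zero.2 fun e => hτ (Circle.ext e)
    have hne := evHom_ne_zero τ w h1
    rw [map_mul, map_mul, map_add, map_mul, map_sub, evHom_inverse _ _ h1, evHom_quotConj _ hτ,
      evHom_quot _ hτ, evHom_derT, evHom_mono]
    congr 1
    rw [selfDenom, map_add, map_one, evHom_smul, evHom_quot _ hτ] at hne ⊢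
    set B := Seq.val τ (p.2.2.2 j) - Seq.val w (p.2.2.2 j)
    have e1 : (τ : ℂ) ^ (-1 : ℤ) * (w : ℂ) ^ (-1 : ℤ) * ((τ : ℂ) - w) = -conj ((τ : ℂ) - w) := by
      have h1 := coe_zpow_neg τ 1
      have h2 := coe_zpow_neg w 1
      simp only [Nat.cast_one, pow_one] at h1 h2
      rw [h1, h2, map_sub]
      linear_combination conj (w : ℂ) * circle_conj_mul τ - conj (τ : ℂ) * circle_conj_mul w
    have e2 : ((τ : ℂ) - w) + p.1 * b j * B
        = ((τ : ℂ) - w) * (1 + ((p.1 * b j : ℝ) : ℂ) * (B / ((τ : ℂ) - w))) := by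
      field_simp
      push_cast
      ring
    rw [e2, eq_div_iff (mul_ne_zero hA (mul_ne_zero hA hne))]
    set D := 1 + ((p.1 * b j : ℝ) : ℂ) * (B / ((τ : ℂ) - w))
    generalize (τ : ℂ) ^ (-1 : ℤ) * (w : ℂ) ^ (-1 : ℤ) = m at e1 ⊢
    generalize conj ((τ : ℂ) - w) = A' at e1 ⊢
    generalize (τ : ℂ) - w = A at hA e1 ⊢
    field_simp
    linear_combination B * e1
  have hcross : evHom 1 w (crossInt b d j p) = circleMean fun τ =>
      (conj (τ : ℂ) + p.1 * b (1 - j) * conj (Seq.val τ (p.2.2.2 (1 - j))))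
        * (1 + p.1 * b (1 - j) * Seq.der τ (p.2.2.2 (1 - j)))
        / (p.1 * (b (1 - j) * τ + b j * w) + p.1 ^ 2 * (b (1 - j) ^ 2 * Seq.val τ (p.2.2.2 (1 - j))
          + b j ^ 2 * Seq.val w (p.2.2.2 j)) - d) := by
    rw [crossInt, evHom_mean]
    congr 1
    funext τ
    rw [map_mul, map_mul, map_add, map_add, evHom_inverse _ _ h2, crossDenom, map_sub, map_add,
      evHom_smul, evHom_smul, evHom_smul, evHom_smul, map_add, map_add, evHom_smul, evHom_smul,
      evHom_smul, evHom_smul, evHom_smul, map_one, evHom_mono, evHom_mono, evHom_mono, evHom_valT,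
      evHom_valW, evHom_conjT, evHom_derT, div_eq_mul_inv]
    have h1 := coe_zpow_neg τ 1
    simp only [Nat.cast_one, pow_one] at h1
    rw [h1]
    push_cast
    simp
  have hw : conj (w : ℂ) = (w : ℂ) ^ (-1 : ℤ) := by
    have := coe_zpow_neg w 1
    simp only [Nat.cast_one, pow_one] at this
    exact this.symm
  simp only [contourF, Seq.circleDeriv_toHolder, Seq.toHolder_apply]
  rw [← hself, ← hcross, hw, wienerF]
  simp only [map_sub, map_add, map_mul, evHom_smul, map_one, evHom_mono, evHom_conjW, evHom_derW]
  congr 1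
  push_cast
  simp
  ring

lemma isSolution_of_sineF_eq_zero {α : ℝ} [Fact (0 < α ∧ α < 1)] {b γ : Fin 2 → ℝ} {d : ℝ}
    {p : ℝ × State} (h1 : ∀ j, IsUnit (selfDenom b j p)) (h2 : ∀ j, IsUnit (crossDenom b d j p))
    (h : sineF b γ d p = 0) :
    IsSolution b γ d p.1 p.2.1 p.2.2.1 (fun j => Seq.toHolder α (p.2.2.2 j)) := by
  intro j w
  rw [contourF_eq b γ d j p (h1 j) (h2 j)]
  simp only [sineF, Prod.mk_eq_zero] at h
  refine im_evHom_eq_zero ?_ (congrFun h.2.2 j) w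
  fin_cases j
  · exact h.1
  · exact h.2.1

/-- At `ε = 0` the self-interaction drops out, and the other integral is the mean of `-τ⁻¹ / d`,
that is, `-1 / d`. -/
lemma wienerF_zero (b γ : Fin 2 → ℝ) {d : ℝ} (hd : d ≠ 0) (j : Fin 2) (s : State) :
    wienerF b γ d j (0, s)
      = (2 * s.1 * ((-1) ^ ((j : ℕ) + 1) * s.2.1 - (j : ℕ) * d) + γ (1 - j) / d) • mono 0 1
        - γ j • derW (s.2.2 j) := by
  have hinv : Ring.inverse (-(d • 1) : Wiener) = (-d⁻¹) • 1 := by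
    have h : (-(d • 1) : Wiener) * (-d⁻¹) • 1 = 1 := by
      rw [neg_smul, neg_mul_neg, smul_mul_smul_comm, mul_one, mul_inv_cancel₀ hd, one_smul]
    have h' := Ring.inverse_mul_cancel_left _ ((-d⁻¹) • (1 : Wiener))
      (isUnit_iff_exists_inv.2 ⟨_, h⟩)
    rw [h, mul_one] at h'
    exact h'
  have hcross : crossInt b d j (0, s) = (-d⁻¹) • 1 := by
    simp only [crossInt, crossDenom, zero_mul, zero_smul, add_zero, mul_one, ne_eq,
      OfNat.ofNat_ne_zero, not_false_eq_true, zero_pow, zero_sub, hinv, mul_smul_comm, map_smul,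
      mean_mono, if_true, mono_zero]
  simp only [wienerF, hcross, zero_mul, zero_smul, add_zero, zero_add, mul_one]
  rw [smul_mul_assoc, one_mul, smul_smul, mul_smul_comm, mul_one, smul_smul, add_smul]
  have : γ (1 - j) * -d⁻¹ = -(γ (1 - j) / d) := by ring
  rw [this, neg_smul]
  abel

lemma sineF_zero (b γ : Fin 2 → ℝ) {d : ℝ} (hd : d ≠ 0) (s : State) :
    sineF b γ d (0, s) = (2 * s.1 * (-s.2.1) + γ 1 / d, 2 * s.1 * (s.2.1 - d) + γ 0 / d,
      fun j => -(γ j • s.2.2 j)) := by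
  have h1 : sineOne (mono 0 1) = 1 := by rw [sineOne_mono, if_pos rfl]
  have h2 : sineTail (mono 0 1) = 0 := by rw [sineTail_mono, if_neg (by norm_num)]
  simp only [sineF, wienerF_zero b γ hd, map_sub, map_smul, sineOne_derW, sineTail_derW, h1, h2,
    smul_zero, zero_sub, sub_zero, smul_eq_mul, mul_one]
  simp

lemma contDiff_selfDenom (b : Fin 2 → ℝ) (j : Fin 2) : ContDiff ℝ 1 (selfDenom b j) := by
  have : ContDiff ℝ 1 fun p : ℝ × State => quot (p.2.2.2 j) := by fun_prop
  unfold selfDenom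
  fun_prop

lemma contDiff_crossDenom (b : Fin 2 → ℝ) (d : ℝ) (j : Fin 2) :
    ContDiff ℝ 1 (crossDenom b d j) := by
  have h2 : ContDiff ℝ 1 fun p : ℝ × State => valT (p.2.2.2 (1 - j)) := by fun_prop
  have h3 : ContDiff ℝ 1 fun p : ℝ × State => valW (p.2.2.2 j) := by fun_prop
  unfold crossDenom
  fun_prop

lemma selfDenom_zero (b : Fin 2 → ℝ) (j : Fin 2) (s : State) : selfDenom b j (0, s) = 1 := by
  rw [selfDenom, zero_mul, zero_smul, add_zero]

lemma crossDenom_zero (b : Fin 2 → ℝ) (d : ℝ) (j : Fin 2) (s : State) :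
    crossDenom b d j (0, s) = -(d • 1) := by
  rw [crossDenom, zero_smul, zero_pow two_ne_zero, zero_smul, add_zero, zero_sub]

lemma isUnit_neg_smul_one {d : ℝ} (hd : d ≠ 0) : IsUnit (-(d • 1) : Wiener) := by
  refine IsUnit.neg (isUnit_iff_exists_inv.2 ⟨d⁻¹ • 1, ?_⟩)
  rw [smul_mul_smul_comm, mul_one, mul_inv_cancel₀ hd, one_smul]

/-- The functional is built from bounded linear maps, products and two inverses. At `ε = 0` the
inverted elements are the units `1` and `-d`, and inversion in a Banach algebra is smooth at units.
-/
lemma contDiffAt_sineF (b γ : Fin 2 → ℝ) {d : ℝ} (hd : d ≠ 0) (Ω Z : ℝ) :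
    ContDiffAt ℝ 1 (sineF b γ d) (0, Ω, Z, 0) := by
  have hx : ∀ (L : Seq →L[ℝ] Wiener) (j : Fin 2),
      ContDiff ℝ 1 fun p : ℝ × State => L (p.2.2.2 j) := fun L j => by fun_prop
  have hself : ∀ j, ContDiffAt ℝ 1 (fun p => Ring.inverse (selfDenom b j p)) (0, Ω, Z, 0) := by
    intro j
    have h1 := contDiffAt_ringInverse ℝ (1 : Wienerˣ) (n := 1)
    rw [Units.val_one, ← selfDenom_zero b j (Ω, Z, 0)] at h1
    exact h1.comp (f := selfDenom b j) _ (contDiff_selfDenom b j).contDiffAt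
  have hcross : ∀ j, ContDiffAt ℝ 1 (fun p => Ring.inverse (crossDenom b d j p)) (0, Ω, Z, 0) := by
    intro j
    have h1 := contDiffAt_ringInverse ℝ (isUnit_neg_smul_one hd).unit (n := 1)
    rw [IsUnit.unit_spec, ← crossDenom_zero b d j (Ω, Z, 0)] at h1
    exact h1.comp (f := crossDenom b d j) _ (contDiff_crossDenom b d j).contDiffAt
  have hF : ∀ j, ContDiffAt ℝ 1 (wienerF b γ d j) (0, Ω, Z, 0) := by
    intro j
    have h1 := hself j
    have h2 := hcross j
    have h3 := (hx quot j).contDiffAt (x := (0, Ω, Z, 0))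
    have h4 := (hx quotConj j).contDiffAt (x := (0, Ω, Z, 0))
    have h5 := (hx derT j).contDiffAt (x := (0, Ω, Z, 0))
    have h6 := (hx derW j).contDiffAt (x := (0, Ω, Z, 0))
    have h7 := (hx conjW j).contDiffAt (x := (0, Ω, Z, 0))
    have h8 := (hx conjT (1 - j)).contDiffAt (x := (0, Ω, Z, 0))
    have h9 := (hx derT (1 - j)).contDiffAt (x := (0, Ω, Z, 0))
    have h10 : ContDiffAt ℝ 1 (selfInt b j) (0, Ω, Z, 0) :=
      mean.contDiff.contDiffAt.comp _ (by fun_prop)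
    have h11 : ContDiffAt ℝ 1 (crossInt b d j) (0, Ω, Z, 0) :=
      mean.contDiff.contDiffAt.comp _ (by fun_prop)
    unfold wienerF
    fun_prop
  have h0 := hF 0
  have h1 := hF 1
  unfold sineF
  refine ContDiffAt.prodMk (sineOne.contDiff.contDiffAt.comp _ h0)
    (ContDiffAt.prodMk (sineOne.contDiff.contDiffAt.comp _ h1) ?_)
  exact contDiffAt_pi.2 fun j => sineTail.contDiff.contDiffAt.comp _ (hF j)

end VortexPair

end

/-! ### The implicit function theorem at the point vortex pair -/

noncomputable section

namespace VortexPair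

open Wiener Filter Topology

/-- The linearization is block diagonal: multiplication by `-γ_j` on the sequences, and on `(Ω, Z)`
a 2 by 2 matrix of determinant `-4 d Ω₀ ≠ 0`. -/
lemma isInvertible_fderiv_sineF {b γ : Fin 2 → ℝ} {d : ℝ} (hd : d ≠ 0) (hγ : ∀ j, γ j ≠ 0)
    (hsum : γ 0 + γ 1 ≠ 0) :
    (fderiv ℝ (sineF b γ d) (0, Omega0 γ d, Z0 γ d, 0) ∘L .inr ℝ ℝ State).IsInvertible := by
  set Ω := Omega0 γ d with hΩ
  set Z := Z0 γ d with hZ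
  have hΩ0 : Ω ≠ 0 := by
    rw [hΩ, Omega0]
    positivity
  have h1 : HasFDerivAt (fun s : State => sineF b γ d (0, s))
      (fderiv ℝ (sineF b γ d) (0, Ω, Z, 0) ∘L .inr ℝ ℝ State) (Ω, Z, 0) :=
    ((contDiffAt_sineF b γ hd Ω Z).differentiableAt one_ne_zero).hasFDerivAt.comp (Ω, Z, 0)
      (hasFDerivAt_prodMk_right 0 _)
  let pΩ : State →L[ℝ] ℝ := .fst ℝ ℝ _
  let pZ : State →L[ℝ] ℝ := (ContinuousLinearMap.fst ℝ ℝ (Fin 2 → Seq)).comp (.snd ℝ ℝ _)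
  let px : Fin 2 → State →L[ℝ] Seq := fun j => (ContinuousLinearMap.proj j).comp
    ((ContinuousLinearMap.snd ℝ ℝ (Fin 2 → Seq)).comp (.snd ℝ ℝ _))
  let L : State →L[ℝ] State :=
    ((-(2 * Z)) • pΩ + (-(2 * Ω)) • pZ).prod (((2 * (Z - d)) • pΩ + (2 * Ω) • pZ).prod
      (ContinuousLinearMap.pi fun j => -(γ j • px j)))
  have h2 : HasFDerivAt (fun s : State => sineF b γ d (0, s)) L (Ω, Z, 0) := by
    simp only [sineF_zero b γ hd]
    have hpΩ : HasFDerivAt (fun s : State => s.1) pΩ (Ω, Z, 0) := pΩ.hasFDerivAt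
    have hpZ : HasFDerivAt (fun s : State => s.2.1) pZ (Ω, Z, 0) := pZ.hasFDerivAt
    refine HasFDerivAt.prodMk ?_ (HasFDerivAt.prodMk ?_ (hasFDerivAt_pi.2 fun j => ?_))
    · convert! ((hpΩ.const_mul 2).mul hpZ.neg).add_const (γ 1 / d) using 1
      ext <;> simp <;> ring
    · convert! ((hpΩ.const_mul 2).mul (hpZ.sub_const d)).add_const (γ 0 / d) using 1
      ext <;> simp <;> ring
    · exact ((px j).hasFDerivAt.const_smul (γ j)).neg
  rw [h1.unique h2]
  -- The sum of the two scalar equations is `-2 d δΩ = p + q`, which gives `δΩ`; the first equation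
  -- then gives `δZ`.
  let qΩ : State →L[ℝ] ℝ := (-(1 / (2 * d))) • (pΩ + pZ)
  let R : State →L[ℝ] State :=
    qΩ.prod (((-(1 / (2 * Ω))) • (pΩ + (2 * Z) • qΩ)).prod
      (ContinuousLinearMap.pi fun j => -((γ j)⁻¹ • px j)))
  refine ContinuousLinearMap.IsInvertible.of_inverse (g := R) ?_ ?_
  · refine ContinuousLinearMap.ext fun ⟨p, q, x⟩ => ?_
    refine Prod.ext ?_ (Prod.ext ?_ ?_)
    · simp [L, R, qΩ, pΩ, pZ]
      field_simp
      ring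
    · simp [L, R, qΩ, pΩ, pZ]
      field_simp
      ring
    · funext j
      change -(γ j • -((γ j)⁻¹ • x j)) = x j
      rw [smul_neg, neg_neg, smul_inv_smul₀ (hγ j)]
  · refine ContinuousLinearMap.ext fun ⟨p, q, x⟩ => ?_
    refine Prod.ext ?_ (Prod.ext ?_ ?_)
    · simp [L, R, qΩ, pΩ, pZ]
      field_simp
      ring
    · simp [L, R, qΩ, pΩ, pZ]
      field_simp
      ring
    · funext j
      change -((γ j)⁻¹ • -(γ j • x j)) = x j
      rw [smul_neg, neg_neg, inv_smul_smul₀ (hγ j)]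

lemma sineF_base (b γ : Fin 2 → ℝ) {d : ℝ} (hd : d ≠ 0) (hsum : γ 0 + γ 1 ≠ 0) :
    sineF b γ d (0, Omega0 γ d, Z0 γ d, 0) = 0 := by
  rw [sineF_zero b γ hd, Omega0, Z0]
  refine Prod.ext ?_ (Prod.ext ?_ ?_)
  · simp only [Prod.fst_zero]
    field_simp
    ring
  · simp only [Prod.fst_zero, Prod.snd_zero]
    field_simp
    ring
  · funext j
    change -(γ j • (0 : Seq)) = 0
    rw [smul_zero, neg_zero]

lemma eventually_isUnit_selfDenom (b : Fin 2 → ℝ) (j : Fin 2) {s : ℝ → State}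
    (hs : ContinuousAt s 0) : ∀ᶠ ε in 𝓝 (0 : ℝ), IsUnit (selfDenom b j (ε, s ε)) := by
  have hcont : ContinuousAt (fun ε => selfDenom b j (ε, s ε)) 0 :=
    (contDiff_selfDenom b j).continuous.continuousAt.comp (continuousAt_id.prodMk hs)
  refine hcont.eventually (p := fun x => IsUnit x) (Units.isOpen.eventually_mem ?_)
  simp only [selfDenom_zero]
  exact isUnit_one

lemma eventually_isUnit_crossDenom (b : Fin 2 → ℝ) {d : ℝ} (hd : d ≠ 0) (j : Fin 2)
    {s : ℝ → State} (hs : ContinuousAt s 0) :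
    ∀ᶠ ε in 𝓝 (0 : ℝ), IsUnit (crossDenom b d j (ε, s ε)) := by
  have hcont : ContinuousAt (fun ε => crossDenom b d j (ε, s ε)) 0 :=
    (contDiff_crossDenom b d j).continuous.continuousAt.comp (continuousAt_id.prodMk hs)
  refine hcont.eventually (p := fun x => IsUnit x) (Units.isOpen.eventually_mem ?_)
  simp only [crossDenom_zero]
  exact isUnit_neg_smul_one hd

/-- The implicit function gives zeros of `sineF`. These are genuine solutions as long as the
denominators are units, which persists for small `ε` because the units form an open set. -/
lemma exists_curve (α : ℝ) [Fact (0 < α ∧ α < 1)] {b γ : Fin 2 → ℝ} {d : ℝ} (hd : d ≠ 0)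
    (hγ : ∀ j, γ j ≠ 0) (hsum : γ 0 + γ 1 ≠ 0) :
    ∃ s : ℝ → State, ContDiffAt ℝ 1 s 0 ∧ s 0 = (Omega0 γ d, Z0 γ d, 0) ∧
      ∀ᶠ ε in 𝓝 0, IsSolution b γ d ε (s ε).1 (s ε).2.1 fun j => Seq.toHolder α ((s ε).2.2 j) := by
  have hF := contDiffAt_sineF b γ hd (Omega0 γ d) (Z0 γ d)
  have hinv := isInvertible_fderiv_sineF (b := b) hd hγ hsum
  have hs := hF.contDiffAt_implicitFunction one_ne_zero hinv
  have hs0 := hF.implicitFunction_apply_self one_ne_zero hinv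
  have hsF := hF.eventually_apply_implicitFunction one_ne_zero hinv
  set s := hF.implicitFunction one_ne_zero hinv
  refine ⟨s, hs, hs0, ?_⟩
  filter_upwards [hsF, eventually_all.2 fun j => eventually_isUnit_selfDenom b j hs.continuousAt,
    eventually_all.2 fun j =>
    eventually_isUnit_crossDenom b hd j hs.continuousAt] with ε h1 h2 h3
  exact isSolution_of_sineF_eq_zero (p := (ε, s ε)) h2 h3 (h1.trans (sineF_base b γ hd hsum))

end VortexPair

end

/-! ### A convexity criterion for curves close to the unit circle -/

noncomputable section

namespace VortexPair

/-! ### Closed curves with exposed points in all directions -/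

open Filter Topology

lemma exists_riesz (ℓ : ℂ →L[ℝ] ℝ) : ∃ v : ℂ, ∀ z, ℓ z = (z * conj v).re := by
  refine ⟨ℓ 1 + ℓ I * I, fun z => ?_⟩
  have h : ℓ z = z.re * ℓ 1 + z.im * ℓ I := by
    conv_lhs => rw [← Complex.re_add_im z]
    have e : (z.re : ℂ) + z.im * I = z.re • (1 : ℂ) + z.im • I := by simp
    rw [e, map_add, map_smul, map_smul, smul_eq_mul, smul_eq_mul]
  rw [h]
  simp

section Hull

variable {φ : Circle → ℂ}

/-- The functional `ℓ` exposes the point `φ w` of the curve, with a quadratic lower bound. -/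
def Exposes (φ : Circle → ℂ) (ℓ : ℂ →L[ℝ] ℝ) (w : Circle) : Prop :=
  ∃ c > 0, ∀ τ, ℓ (φ τ) + c * ‖φ τ - φ w‖ ^ 2 ≤ ℓ (φ w)

/-- The left side is a continuous convex function of the point, so the inequality passes from the
curve to its closed convex hull. The quadratic term makes the maximizer of `ℓ` unique on the whole
hull. -/
lemma Exposes.add_le {ℓ : ℂ →L[ℝ] ℝ} {w : Circle} (h : Exposes φ ℓ w) :
    ∃ c > 0, ∀ z ∈ closedConvexHull ℝ (range φ), ℓ z + c * ‖z - φ w‖ ^ 2 ≤ ℓ (φ w) := by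
  obtain ⟨c, hc, h⟩ := h
  refine ⟨c, hc, fun z hz => ?_⟩
  refine closedConvexHull_min (t := {z | ℓ z + c * ‖z - φ w‖ ^ 2 ≤ ℓ (φ w)}) ?_ ?_ ?_ hz
  · rintro _ ⟨τ, rfl⟩
    exact h τ
  · have h1 : ConvexOn ℝ univ fun z : ℂ => ‖z - φ w‖ ^ 2 := by
      have h2 : ConvexOn ℝ univ fun z : ℂ => ‖z - φ w‖ := by
        simpa [dist_eq_norm] using convexOn_univ_dist (φ w)
      exact h2.pow (fun _ _ => norm_nonneg _) 2
    have h3 : ConvexOn ℝ univ fun z : ℂ => ℓ z + c * ‖z - φ w‖ ^ 2 :=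
      (ℓ.toLinearMap.convexOn convex_univ).add (h1.smul hc.le)
    simpa using h3.convex_le (ℓ (φ w))
  · exact isClosed_le (by fun_prop) continuous_const

lemma Exposes.le {ℓ : ℂ →L[ℝ] ℝ} {w : Circle} (h : Exposes φ ℓ w) {z : ℂ}
    (hz : z ∈ closedConvexHull ℝ (range φ)) : ℓ z ≤ ℓ (φ w) := by
  obtain ⟨c, hc, h⟩ := h.add_le
  have : 0 ≤ c * ‖z - φ w‖ ^ 2 := by positivity
  linarith [h z hz]

lemma Exposes.eq {ℓ : ℂ →L[ℝ] ℝ} {w : Circle} (h : Exposes φ ℓ w) {z : ℂ}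
    (hz : z ∈ closedConvexHull ℝ (range φ)) (hzw : ℓ (φ w) ≤ ℓ z) : z = φ w := by
  obtain ⟨c, hc, h⟩ := h.add_le
  have h1 : c * ‖z - φ w‖ ^ 2 ≤ 0 := by linarith [h z hz]
  have h2 : ‖z - φ w‖ ^ 2 ≤ 0 := by nlinarith
  exact sub_eq_zero.1 (norm_eq_zero.1 (pow_eq_zero_iff two_ne_zero |>.1
    (le_antisymm h2 (sq_nonneg _))))

lemma isCompact_closedConvexHull_range (hclose : ∀ w : Circle, ‖φ w - w‖ ≤ 1 / 4) :
    IsCompact (closedConvexHull ℝ (range φ)) ∧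
      closedConvexHull ℝ (range φ) ⊆ Metric.closedBall 0 (5 / 4) := by
  have h : closedConvexHull ℝ (range φ) ⊆ Metric.closedBall 0 (5 / 4) := by
    refine closedConvexHull_min ?_ (convex_closedBall _ _) Metric.isClosed_closedBall
    rintro _ ⟨w, rfl⟩
    rw [mem_closedBall_zero_iff]
    have h1 := hclose w
    have h2 : ‖φ w‖ ≤ ‖φ w - w‖ + ‖(w : ℂ)‖ := by
      simpa using norm_add_le (φ w - w) w
    rw [Circle.norm_coe] at h2
    linarith
  exact ⟨(isCompact_closedBall _ _).of_isClosed_subset isClosed_closedConvexHull h, h⟩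

/-- A functional `Re(z v̄)` separating `z` from the hull would be below `|v| / 2` in absolute value
at `z`, but it is at least `3|v| / 4` at the curve point with parameter `v / |v|`. -/
lemma ball_subset_closedConvexHull (hclose : ∀ w : Circle, ‖φ w - w‖ ≤ 1 / 4) :
    Metric.ball (0 : ℂ) (1 / 2) ⊆ closedConvexHull ℝ (range φ) := by
  intro z hz
  rw [mem_ball_zero_iff] at hz
  by_contra hzC
  have hcomp : IsCompact (closedConvexHull ℝ (range φ)) := (isCompact_closedConvexHull_range hclose).1
  obtain ⟨ℓ, u, h1, h2⟩ := geometric_hahn_banach_closed_point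
      (convex_closedConvexHull (𝕜 := ℝ) (s := range φ))
    hcomp.isClosed hzC
  obtain ⟨v, hv⟩ := exists_riesz ℓ
  have hv0 : v ≠ 0 := by
    rintro rfl
    have := h1 (φ 1) (subset_closedConvexHull (mem_range_self 1))
    simp only [hv, map_zero, mul_zero, zero_re] at this h2
    linarith
  have hvn : 0 < ‖v‖ := norm_pos_iff.2 hv0
  let w : Circle := ⟨v / ‖v‖, by
    change v / ‖v‖ ∈ Metric.sphere (0 : ℂ) 1
    rw [mem_sphere_zero_iff_norm, norm_div, norm_real, norm_norm, div_self hvn.ne']⟩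
  have hw : (w : ℂ) = v / ‖v‖ := rfl
  have h3 := h1 (φ w) (subset_closedConvexHull (mem_range_self w))
  have hbound : ∀ x : ℂ, |ℓ x| ≤ ‖x‖ * ‖v‖ := fun x => by
    rw [hv]
    refine (abs_re_le_norm _).trans ?_
    rw [norm_mul, RCLike.norm_conj]
  have h4 : ℓ w = ‖v‖ := by
    rw [hv, hw, div_mul_eq_mul_div, Complex.mul_conj, normSq_eq_norm_sq]
    rw [← ofReal_div, ofReal_re]
    field_simp
  have h5 := hbound (φ w - w)
  have h6 := hbound z
  rw [map_sub, h4] at h5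
  have h7 := (abs_le.1 h5).1
  have h8 := (abs_le.1 h6).2
  have h9 := hclose w
  nlinarith

variable (hclose : ∀ w : Circle, ‖φ w - w‖ ≤ 1 / 4)
  (hexp : ∀ ℓ : ℂ →L[ℝ] ℝ, ℓ ≠ 0 → ∃ w, Exposes φ ℓ w)
  (hpt : ∀ w, ∃ ℓ : ℂ →L[ℝ] ℝ, ℓ ≠ 0 ∧ Exposes φ ℓ w)

include hclose

lemma zero_mem_interior_closedConvexHull : (0 : ℂ) ∈ interior (closedConvexHull ℝ (range φ)) :=
  mem_interior.2 ⟨_, ball_subset_closedConvexHull hclose, Metric.isOpen_ball,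
    Metric.mem_ball_self (by norm_num)⟩

lemma closure_interior_closedConvexHull :
    closure (interior (closedConvexHull ℝ (range φ))) = closedConvexHull ℝ (range φ) := by
  rw [(convex_closedConvexHull (𝕜 := ℝ) (s := range φ)
    ).closure_interior_eq_closure_of_nonempty_interior
    ⟨0, zero_mem_interior_closedConvexHull hclose⟩]
  exact isClosed_closedConvexHull.closure_eq

include hexp

/-- A supporting functional at `z` attains its maximum over the hull at `z`. It also has an exposed
maximum on the curve, and that maximizer is unique. -/
lemma exists_support {z : ℂ} (hz : z ∈ closedConvexHull ℝ (range φ))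
    (hzi : z ∉ interior (closedConvexHull ℝ (range φ))) :
    ∃ (ℓ : ℂ →L[ℝ] ℝ) (w : Circle), Exposes φ ℓ w ∧ z = φ w := by
  obtain ⟨ℓ, hℓ⟩ := geometric_hahn_banach_open_point
    (convex_closedConvexHull (𝕜 := ℝ) (s := range φ)).interior
    isOpen_interior hzi
  have h0 : ℓ ≠ 0 := by
    rintro rfl
    exact lt_irrefl _ (hℓ 0 (zero_mem_interior_closedConvexHull hclose))
  obtain ⟨w, hw⟩ := hexp ℓ h0
  refine ⟨ℓ, w, hw, hw.eq hz ?_⟩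
  have h1 : φ w ∈ closure (interior (closedConvexHull ℝ (range φ))) := by
    rw [closure_interior_closedConvexHull hclose]
    exact subset_closedConvexHull (mem_range_self w)
  have h2 : closure (interior (closedConvexHull ℝ (range φ))) ⊆ {x | ℓ x ≤ ℓ z} :=
    closure_minimal (fun x hx => (hℓ x hx).le) (isClosed_le ℓ.continuous continuous_const)
  exact h2 h1

/-- If an inner point of a segment were on the boundary, its supporting functional would be maximal
at both endpoints too, and uniqueness of the maximizer would identify them. -/
lemma strictConvex_closedConvexHull : StrictConvex ℝ (closedConvexHull ℝ (range φ)) := by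
  intro x hx y hy hne a c ha hc hac
  by_contra hz
  have hzC := (convex_closedConvexHull (𝕜 := ℝ) (s := range φ)) hx hy ha.le hc.le hac
  obtain ⟨ℓ, w, hw, hzw⟩ := exists_support hclose hexp hzC hz
  have h1 := hw.le hx
  have h2 := hw.le hy
  have h3 : ℓ (φ w) = a * ℓ x + c * ℓ y := by
    rw [← hzw, map_add, map_smul, map_smul, smul_eq_mul, smul_eq_mul]
  have e : ℓ (φ w) = a * ℓ (φ w) + c * ℓ (φ w) := by rw [← add_mul, hac, one_mul]
  have h4 : ℓ (φ w) ≤ ℓ x := by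
    by_contra! h
    nlinarith
  have h5 : ℓ (φ w) ≤ ℓ y := by
    by_contra! h
    nlinarith
  exact hne ((hw.eq hx h4).trans (hw.eq hy h5).symm)

include hpt

/-- Boundary points lie on the curve by `exists_support`. Conversely, an exposed point cannot be
interior because a nonzero linear functional has no local maximum. -/
lemma frontier_closedConvexHull : frontier (closedConvexHull ℝ (range φ)) = range φ := by
  have hcl := isClosed_closedConvexHull (𝕜 := ℝ) (s := range φ)
  ext z
  rw [hcl.frontier_eq]
  constructor
  · rintro ⟨hz, hzi⟩
    obtain ⟨ℓ, w, _, hzw⟩ := exists_support hclose hexp hz hzi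
    exact ⟨w, hzw.symm⟩
  · rintro ⟨w, rfl⟩
    refine ⟨subset_closedConvexHull (mem_range_self w), fun hint => ?_⟩
    obtain ⟨ℓ, h0, hw⟩ := hpt w
    have hmax : IsLocalMax ℓ (φ w) := by
      filter_upwards [mem_interior_iff_mem_nhds.1 hint] with x hx
      exact hw.le hx
    exact h0 (hmax.hasFDerivAt_eq_zero ℓ.hasFDerivAt)

/-- The curve is the whole frontier of the hull, so it separates the interior from the exterior.
Exterior points lie on rays that avoid the hull, hence in unbounded components. -/
lemma enclosedRegion_eq : enclosedRegion φ = interior (closedConvexHull ℝ (range φ)) := by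
  have hcomp : IsCompact (closedConvexHull ℝ (range φ)) := (isCompact_closedConvexHull_range hclose).1
  have hfr := frontier_closedConvexHull hclose hexp hpt
  ext z
  constructor
  · rintro ⟨hz, hb⟩
    by_contra hzi
    have hzC : z ∉ closedConvexHull ℝ (range φ) := fun h => hz <| by
      rw [← hfr, hcomp.isClosed.frontier_eq]
      exact ⟨h, hzi⟩
    obtain ⟨ℓ, u, h1, h2⟩ := geometric_hahn_banach_closed_point
      (convex_closedConvexHull (𝕜 := ℝ) (s := range φ))
      hcomp.isClosed hzC
    have h0 : ∃ v, 0 < ℓ v := by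
      refine ⟨z - φ 1, ?_⟩
      rw [map_sub]
      linarith [h1 (φ 1) (subset_closedConvexHull (mem_range_self 1))]
    obtain ⟨v, hv⟩ := h0
    have hray : (fun t : ℝ => z + t • v) '' Ici 0
        ⊆ connectedComponentIn (range φ)ᶜ z := by
      refine IsPreconnected.subset_connectedComponentIn ?_ ⟨0, self_mem_Ici, by simp⟩ ?_
      · exact isPreconnected_Ici.image _ (by fun_prop)
      · rintro _ ⟨t, ht, rfl⟩ hmem
        have := h1 _ (subset_closedConvexHull hmem)
        simp only [map_add, map_smul, smul_eq_mul] at this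
        have ht' : 0 ≤ t := ht
        nlinarith
    have hbℓ : BddAbove (ℓ '' ((fun t : ℝ => z + t • v) '' Ici 0)) := by
      have := ((hb.subset hray).isCompact_closure.image ℓ.continuous).bddAbove
      exact this.mono (image_mono subset_closure)
    obtain ⟨M, hM⟩ := hbℓ
    have hM' : ∀ t : ℝ, 0 ≤ t → ℓ z + t * ℓ v ≤ M := fun t ht => by
      have := hM ⟨_, ⟨t, ht, rfl⟩, rfl⟩
      rwa [map_add, map_smul, smul_eq_mul] at this
    have h3 := hM' ((|M - ℓ z| + 1) / ℓ v) (by positivity)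
    rw [div_mul_cancel₀ _ hv.ne'] at h3
    linarith [le_abs_self (M - ℓ z)]
  · intro hz
    have hz' : z ∈ (range φ)ᶜ := by
      rw [← hfr]
      intro h
      exact h.2 hz
    refine ⟨hz', ?_⟩
    refine (hcomp.isBounded.subset interior_subset).subset ?_
    -- The component avoids the frontier, so it is covered by two disjoint open sets, the interior
    -- of the hull and the complement of the hull, and it meets the first.
    refine IsPreconnected.subset_left_of_subset_union isOpen_interior
      hcomp.isClosed.isOpen_compl ?_ ?_ ⟨z, mem_connectedComponentIn hz', hz⟩
      isPreconnected_connectedComponentIn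
    · exact disjoint_compl_right_iff_subset.2 interior_subset
    · intro x hx
      have hx' : x ∉ range φ := connectedComponentIn_subset _ _ hx
      by_cases h : x ∈ closedConvexHull ℝ (range φ)
      · left
        by_contra h'
        exact hx' (by rw [← hfr, hcomp.isClosed.frontier_eq]; exact ⟨h, h'⟩)
      · exact Or.inr h

/-- A closed curve near the unit circle whose points are exposed, with exposed points in all
directions, bounds a strictly convex domain. -/
lemma enclosedRegion_strictlyConvex :
    frontier (enclosedRegion φ) = range φ ∧ (0 : ℂ) ∈ enclosedRegion φ ∧
      enclosedRegion φ ⊆ Metric.ball 0 2 ∧ IsStrictlyConvexDomain (enclosedRegion φ) := by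
  have hfr := frontier_closedConvexHull hclose hexp hpt
  have hcl := closure_interior_closedConvexHull hclose
  rw [enclosedRegion_eq hclose hexp hpt]
  refine ⟨?_, zero_mem_interior_closedConvexHull hclose, ?_, isOpen_interior,
    ⟨0, zero_mem_interior_closedConvexHull hclose⟩,
    (convex_closedConvexHull (𝕜 := ℝ) (s := range φ)).interior, ?_⟩
  · rw [isOpen_interior.frontier_eq, hcl, ← isClosed_closedConvexHull.frontier_eq, hfr]
  · refine interior_subset.trans ((isCompact_closedConvexHull_range hclose).2.trans ?_)
    exact Metric.closedBall_subset_ball (by norm_num)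
  · rw [hcl]
    exact strictConvex_closedConvexHull hclose hexp

end Hull

end VortexPair

end

noncomputable section

namespace VortexPair

open Filter Topology

/-! ### Chords and arcs of the circle -/

lemma norm_mul_exp_sub_self (w : Circle) (t : ℝ) :
    ‖((w * Circle.exp t : Circle) : ℂ) - w‖ = 2 * |Real.sin (t / 2)| := by
  have h := Complex.norm_exp_I_mul_ofReal_sub_one t
  have e : ((w * Circle.exp t : Circle) : ℂ) - w = w * (cexp (I * t) - 1) := by
    rw [Circle.coe_mul, Circle.coe_exp, mul_comm (t : ℂ)]
    ring
  rw [e, norm_mul, Circle.norm_coe, one_mul, h]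
  simp

lemma norm_mul_exp_sub_self_le (w : Circle) (t : ℝ) :
    ‖((w * Circle.exp t : Circle) : ℂ) - w‖ ≤ |t| := by
  rw [norm_mul_exp_sub_self]
  have := Real.abs_sin_le_abs (x := t / 2)
  rw [abs_div, abs_two] at this
  linarith

lemma abs_le_norm_mul_exp_sub_self (w : Circle) {t : ℝ} (ht : |t| ≤ Real.pi) :
    |t| ≤ 2 * ‖((w * Circle.exp t : Circle) : ℂ) - w‖ := by
  rw [norm_mul_exp_sub_self]
  have h := Real.mul_abs_le_abs_sin (x := t / 2) (by rw [abs_div, abs_two]; linarith)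
  rw [abs_div, abs_two] at h
  have h1 : 2 / Real.pi * (|t| / 2) = |t| / Real.pi := by ring
  rw [h1, div_le_iff₀ Real.pi_pos] at h
  nlinarith [Real.pi_lt_d2, Real.pi_pos, abs_nonneg (Real.sin (t / 2))]

lemma exists_eq_mul_exp (τ w : Circle) :
    ∃ t : ℝ, |t| ≤ Real.pi ∧ τ = w * Circle.exp t := by
  refine ⟨Complex.arg (τ / w : Circle), Complex.abs_arg_le_pi _, ?_⟩
  rw [Circle.exp_arg, mul_div_cancel]

/-- `g'` is the derivative of `g` along the circle. -/
def HasCircleDeriv (g g' : Circle → ℂ) : Prop :=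
  ∀ w : Circle, HasDerivAt (fun θ : ℝ => g (w * Circle.exp θ)) (g' w * (I * (w : ℂ))) 0

lemma HasCircleDeriv.hasDerivAt {g g' : Circle → ℂ} (h : HasCircleDeriv g g') (w : Circle) (t : ℝ) :
    HasDerivAt (fun θ : ℝ => g (w * Circle.exp θ))
      (g' (w * Circle.exp t) * (I * ((w * Circle.exp t : Circle) : ℂ))) t := by
  have h1 := h (w * Circle.exp t)
  have e : (fun θ : ℝ => g (w * Circle.exp t * Circle.exp θ))
      = fun θ : ℝ => (fun s : ℝ => g (w * Circle.exp s)) (t + θ) := by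
    funext θ
    simp [Circle.exp_add, mul_assoc]
  rw [e] at h1
  have h2 := HasDerivAt.comp_const_add (-t) t (f := fun θ : ℝ => (fun s : ℝ =>
    g (w * Circle.exp s)) (t + θ)) (by rwa [neg_add_cancel])
  simpa using h2

lemma hasCircleDeriv_coe : HasCircleDeriv (fun w => (w : ℂ)) fun _ => 1 := by
  intro w
  have h1 : HasDerivAt (fun z : ℂ => (w : ℂ) * cexp (z * I)) ((w : ℂ) * (cexp ((0 : ℝ) * I) * (1 * I)))
      ((0 : ℝ) : ℂ) := (((hasDerivAt_id _).mul_const I).cexp).const_mul _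
  have h2 := h1.comp_ofReal
  simp only [ofReal_zero, zero_mul, Complex.exp_zero, one_mul] at h2
  rw [one_mul, mul_comm I]
  exact h2

lemma HolderX.hasCircleDeriv {α : ℝ} (f : HolderX α) : HasCircleDeriv f (circleDeriv f) :=
  fun w => hasDerivAt_of_contDiff f.contDiff w

/-- Second-order Taylor estimate along the circle for a Lipschitz derivative. -/
lemma HasCircleDeriv.norm_sub_sub_le {g g' : Circle → ℂ} (h : HasCircleDeriv g g') {κ : ℝ}
    (hκ : ∀ τ w : Circle, ‖g' τ - g' w‖ ≤ κ * ‖(τ : ℂ) - w‖) (hκ0 : 0 ≤ κ) (τ w : Circle) :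
    ‖g τ - g w - g' w * ((τ : ℂ) - w)‖ ≤ 4 * κ * ‖(τ : ℂ) - w‖ ^ 2 := by
  obtain ⟨t, ht, rfl⟩ := exists_eq_mul_exp τ w
  have h1 : ∀ s : ℝ, HasDerivAt (fun θ : ℝ => g (w * Circle.exp θ)
      - g' w * ((w * Circle.exp θ : Circle) : ℂ))
      ((g' (w * Circle.exp s) - g' w) * (I * ((w * Circle.exp s : Circle) : ℂ))) s := by
    intro s
    have := (h.hasDerivAt w s).sub ((hasCircleDeriv_coe.hasDerivAt w s).const_mul (g' w))
    convert! this using 1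
    ring
  have h2 : ∀ s ∈ uIcc 0 t, ‖(g' (w * Circle.exp s) - g' w)
      * (I * ((w * Circle.exp s : Circle) : ℂ))‖ ≤ κ * |t| := by
    intro s hs
    rw [norm_mul, norm_mul, norm_I, Circle.norm_coe, mul_one, mul_one]
    refine (hκ _ _).trans (mul_le_mul_of_nonneg_left ?_ hκ0)
    refine (norm_mul_exp_sub_self_le w s).trans ?_
    have := abs_sub_left_of_mem_uIcc hs
    simpa using this
  have h3 := (convex_uIcc (0 : ℝ) t).norm_image_sub_le_of_norm_hasDerivWithin_le
    (fun s _ => (h1 s).hasDerivWithinAt) h2 left_mem_uIcc right_mem_uIcc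
  have h4 := abs_le_norm_mul_exp_sub_self w ht
  simp only [Circle.exp_zero, mul_one, sub_zero, Real.norm_eq_abs] at h3
  have e : g (w * Circle.exp t) - g w - g' w * (((w * Circle.exp t : Circle) : ℂ) - w)
      = g (w * Circle.exp t) - g' w * ((w * Circle.exp t : Circle) : ℂ) - (g w - g' w * w) := by
    ring
  rw [e]
  refine h3.trans ?_
  -- The chord is at least `|t| / 2`; using this twice produces the constant `4`.
  have h5 : |t| * |t| ≤ (2 * ‖((w * Circle.exp t : Circle) : ℂ) - w‖)
      * (2 * ‖((w * Circle.exp t : Circle) : ℂ) - w‖) :=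
    mul_le_mul h4 h4 (abs_nonneg _) (by positivity)
  nlinarith

lemma re_sub_mul_conj (τ w : Circle) :
    (((τ : ℂ) - w) * conj (w : ℂ)).re = -‖(τ : ℂ) - w‖ ^ 2 / 2 := by
  have h1 : ‖(τ : ℂ) - w‖ ^ 2 = normSq ((τ : ℂ) - w) := (normSq_eq_norm_sq _).symm
  rw [h1, normSq_sub, Circle.normSq_coe, Circle.normSq_coe, sub_mul, sub_re, mul_conj]
  simp
  ring

lemma normal_ne_zero {g' : Circle → ℂ} (h1 : ∀ w, ‖g' w‖ ≤ 1 / 100) (w : Circle) :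
    (w : ℂ) * (1 + g' w) ≠ 0 := by
  refine mul_ne_zero (Circle.coe_ne_zero w) fun h => ?_
  have h3 : g' w = -1 := by linear_combination h
  have := h1 w
  rw [h3, norm_neg, norm_one] at this
  norm_num at this

section Perturbation

variable {g g' : Circle → ℂ} (hg : HasCircleDeriv g g') (h0 : ∀ w, ‖g w‖ ≤ 1 / 100)
  (h1 : ∀ w, ‖g' w‖ ≤ 1 / 100)
  (h2 : ∀ τ w : Circle, ‖g' τ - g' w‖ ≤ 1 / 100 * ‖(τ : ℂ) - w‖)

include hg h1 h2

/-- The outer normal is `w (1 + g' w)`. The circle itself contributes `-|1 + g' w|² |τ - w|² / 2`,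
and the second-order Taylor remainder is too small to compensate it. -/
lemma re_chord_mul_conj_normal_le (τ w : Circle) :
    (((τ + g τ) - (w + g w)) * conj ((w : ℂ) * (1 + g' w))).re ≤ -‖(τ : ℂ) - w‖ ^ 2 / 4 := by
  have hE := hg.norm_sub_sub_le h2 (by norm_num) τ w
  set A : ℂ := (τ : ℂ) - w with hA
  set E : ℂ := g τ - g w - g' w * A with hE'
  have e : ((τ + g τ) - (w + g w)) * conj ((w : ℂ) * (1 + g' w))
      = (normSq (1 + g' w) : ℝ) * (A * conj (w : ℂ)) + E * conj ((w : ℂ) * (1 + g' w)) := by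
    rw [← mul_conj, map_mul, hE', hA]
    ring
  rw [e, add_re, re_ofReal_mul, re_sub_mul_conj]
  have h3 : 99 / 100 ≤ ‖1 + g' w‖ := by
    have := norm_sub_norm_le (1 : ℂ) (-g' w)
    rw [sub_neg_eq_add, norm_neg, norm_one] at this
    linarith [h1 w]
  have h4 : ‖1 + g' w‖ ≤ 101 / 100 := by
    have := norm_add_le (1 : ℂ) (g' w)
    rw [norm_one] at this
    linarith [h1 w]
  have h5 : (E * conj ((w : ℂ) * (1 + g' w))).re ≤ 4 * (1 / 100) * ‖A‖ ^ 2 * (101 / 100) := by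
    refine (re_le_norm _).trans ?_
    rw [norm_mul, RCLike.norm_conj, norm_mul, Circle.norm_coe, one_mul]
    exact mul_le_mul hE h4 (norm_nonneg _) (by positivity)
  have h6 : (98 / 100 : ℝ) ≤ normSq (1 + g' w) := by
    rw [normSq_eq_norm_sq]
    nlinarith
  have h7 : 0 ≤ ‖A‖ ^ 2 := sq_nonneg _
  nlinarith

lemma norm_chord_le (τ w : Circle) : ‖((τ : ℂ) + g τ) - (w + g w)‖ ≤ 2 * ‖(τ : ℂ) - w‖ := by
  have hE := hg.norm_sub_sub_le h2 (by norm_num) τ w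
  set A : ℂ := (τ : ℂ) - w with hA
  have e : ((τ : ℂ) + g τ) - (w + g w) = A + (g τ - g w - g' w * A) + g' w * A := by
    rw [hA]
    ring
  have h3 : ‖A‖ ≤ 2 := by
    refine (norm_sub_le _ _).trans ?_
    rw [Circle.norm_coe, Circle.norm_coe]
    norm_num
  have h4 : ‖g' w * A‖ ≤ 1 / 100 * ‖A‖ := by
    rw [norm_mul]
    exact mul_le_mul_of_nonneg_right (h1 w) (norm_nonneg _)
  rw [e]
  refine (norm_add₃_le).trans ?_
  nlinarith [norm_nonneg A]

lemma injective_perturbation : Function.Injective fun w : Circle => (w : ℂ) + g w := by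
  intro τ w h
  have h3 := re_chord_mul_conj_normal_le hg h1 h2 τ w
  simp only at h
  rw [h, sub_self, zero_mul, zero_re] at h3
  have h4 : ‖(τ : ℂ) - w‖ = 0 := by
    have : ‖(τ : ℂ) - w‖ ^ 2 = 0 := le_antisymm (by linarith) (sq_nonneg _)
    exact pow_eq_zero_iff two_ne_zero |>.1 this
  exact Circle.ext (sub_eq_zero.1 (norm_eq_zero.1 h4))

lemma exposes_of_pos {ℓ : ℂ →L[ℝ] ℝ} {w : Circle} {c : ℝ} (hc : 0 < c)
    (hℓ : ∀ z, ℓ z = c * (z * conj ((w : ℂ) * (1 + g' w))).re) :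
    Exposes (fun w : Circle => (w : ℂ) + g w) ℓ w := by
  -- The deficit is at least `c |τ - w|² / 4`, and the chord of the perturbed curve is at most `2 |τ
  -- - w|`.
  refine ⟨c / 16, by positivity, fun τ => ?_⟩
  have h3 := re_chord_mul_conj_normal_le hg h1 h2 τ w
  have h4 := norm_chord_le hg h1 h2 τ w
  have h5 : ℓ ((τ : ℂ) + g τ) - ℓ ((w : ℂ) + g w)
      = c * ((((τ : ℂ) + g τ) - (w + g w)) * conj ((w : ℂ) * (1 + g' w))).re := by
    rw [← map_sub, hℓ]
  have h6 : ‖((τ : ℂ) + g τ) - (w + g w)‖ ^ 2 ≤ (2 * ‖(τ : ℂ) - w‖) ^ 2 :=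
    pow_le_pow_left₀ (norm_nonneg _) h4 2
  nlinarith

lemma exists_exposes_point (w : Circle) :
    ∃ ℓ : ℂ →L[ℝ] ℝ, ℓ ≠ 0 ∧ Exposes (fun w : Circle => (w : ℂ) + g w) ℓ w := by
  set n : ℂ := (w : ℂ) * (1 + g' w) with hn
  have hn0 : n ≠ 0 := normal_ne_zero h1 w
  let ℓ : ℂ →L[ℝ] ℝ := reCLM.comp ((ContinuousLinearMap.mul ℝ ℂ).flip (conj n))
  have hℓ : ∀ z, ℓ z = (z * conj n).re := fun z => rfl
  refine ⟨ℓ, fun h => ?_, exposes_of_pos hg h1 h2 one_pos fun z => by rw [hℓ, one_mul]⟩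
  have h3 := hℓ n
  rw [h, mul_conj, ofReal_re] at h3
  exact hn0 (normSq_eq_zero.1 h3.symm)

/-- At a maximum of `ℓ` on the curve the tangent direction is in the kernel, so `ℓ` is a real
multiple of the normal functional, and it remains to show that the factor is positive. -/
lemma exists_exposes {ℓ : ℂ →L[ℝ] ℝ} (hℓ : ℓ ≠ 0) :
    ∃ w, Exposes (fun w : Circle => (w : ℂ) + g w) ℓ w := by
  have hcont : Continuous g := by
    refine continuous_iff_continuousAt.2 fun w => ?_
    have h3 : Continuous fun τ : Circle => 3 * ‖(τ : ℂ) - w‖ := by fun_prop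
    rw [ContinuousAt, tendsto_iff_norm_sub_tendsto_zero]
    refine squeeze_zero (fun _ => norm_nonneg _) (fun τ => ?_)
      (by simpa using h3.tendsto w)
    have h4 := norm_chord_le hg h1 h2 τ w
    have e : g τ - g w = (((τ : ℂ) + g τ) - (w + g w)) - ((τ : ℂ) - w) := by ring
    rw [e]
    exact (norm_sub_le _ _).trans (by linarith)
  obtain ⟨w, _, hw⟩ := isCompact_univ.exists_isMaxOn (univ_nonempty (α := Circle))
    (f := fun w : Circle => ℓ ((w : ℂ) + g w)) (by fun_prop : Continuous _).continuousOn
  have hmax : ∀ τ : Circle, ℓ ((τ : ℂ) + g τ) ≤ ℓ ((w : ℂ) + g w) := fun τ => hw (mem_univ τ)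
  refine ⟨w, ?_⟩
  set n : ℂ := (w : ℂ) * (1 + g' w) with hn
  have hn0 : n ≠ 0 := normal_ne_zero h1 w
  have hd : HasDerivAt (fun θ : ℝ => ((w * Circle.exp θ : Circle) : ℂ) + g (w * Circle.exp θ))
      (I * n) 0 := by
    convert! (hasCircleDeriv_coe w).add (hg w) using 1
    rw [hn]
    ring
  have hd2 := ℓ.hasFDerivAt.comp_hasDerivAt (0 : ℝ) hd
  have hI : ℓ (I * n) = 0 := by
    refine IsLocalMax.hasDerivAt_eq_zero (a := 0) ?_ hd2
    refine Filter.Eventually.of_forall fun θ => ?_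
    simpa using hmax (w * Circle.exp θ)
  have hN : 0 < normSq n := normSq_pos.2 hn0
  have hform : ∀ z, ℓ z = ℓ n / normSq n * (z * conj n).re := by
    intro z
    have e : (normSq n) • z = (z * conj n).re • n + (z * conj n).im • (I * n) := by
      simp only [real_smul]
      rw [← mul_conj]
      linear_combination (-n) * Complex.re_add_im (z * conj n)
    have h3 := congrArg ℓ e
    rw [map_smul, map_add, map_smul, map_smul, hI, smul_zero, add_zero, smul_eq_mul,
      smul_eq_mul] at h3
    field_simp
    linarith
  have hpos : 0 < ℓ n := by
    have h3 : ℓ n ≠ 0 := fun h => hℓ <| by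
      refine ContinuousLinearMap.ext fun z => ?_
      rw [hform, h, zero_div, zero_mul]
      rfl
    refine lt_of_le_of_ne ?_ h3.symm
    -- Comparison with the antipodal point, whose chord has a strictly negative normal component,
    -- fixes the sign.
    have h4 := hmax (-w)
    have h5 := re_chord_mul_conj_normal_le hg h1 h2 (-w) w
    rw [← sub_nonpos, ← map_sub, hform] at h4
    have h6 : ‖((-w : Circle) : ℂ) - w‖ = 2 := by
      have : ((-w : Circle) : ℂ) - w = -2 * w := by rw [Circle.coe_neg]; ring
      rw [this, norm_mul, Circle.norm_coe, norm_neg]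
      norm_num
    rw [h6] at h5
    by_contra! h7
    have h8 : ℓ n / normSq n < 0 := div_neg_of_neg_of_pos h7 hN
    nlinarith
  exact exposes_of_pos hg h1 h2 (div_pos hpos hN) hform

include h0

/-- A `C^{1,1}`-small perturbation of the unit circle bounds a strictly convex domain. -/
lemma strictlyConvex_perturbation :
    Function.Injective (fun w : Circle => (w : ℂ) + g w) ∧
      frontier (enclosedRegion fun w : Circle => (w : ℂ) + g w)
        = range (fun w : Circle => (w : ℂ) + g w) ∧
      (0 : ℂ) ∈ enclosedRegion (fun w : Circle => (w : ℂ) + g w) ∧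
      enclosedRegion (fun w : Circle => (w : ℂ) + g w) ⊆ Metric.ball 0 2 ∧
      IsStrictlyConvexDomain (enclosedRegion fun w : Circle => (w : ℂ) + g w) := by
  refine ⟨injective_perturbation hg h1 h2, enclosedRegion_strictlyConvex (fun w => ?_)
    (fun ℓ hℓ => exists_exposes hg h1 h2 hℓ) (exists_exposes_point hg h1 h2)⟩
  rw [add_sub_cancel_left]
  linarith [h0 w]

end Perturbation

end VortexPair

end

noncomputable section

namespace VortexPair

/-! ### The reflection symmetry -/

lemma circle_exp_pi : Circle.exp Real.pi = -1 := by
  apply Circle.ext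
  simp [Circle.coe_exp, Complex.exp_pi_mul_I]

/-- The line element `dτ` is odd under `τ ↦ -τ`. -/
lemma circleMean_comp_neg (h : Circle → ℂ) : circleMean (fun τ => h (-τ)) = -circleMean h := by
  set F : ℝ → ℂ := fun θ => h (Circle.exp θ) * (I * (Circle.exp θ : ℂ)) with hF
  have hper : Function.Periodic F (2 * Real.pi) := fun θ => by
    have := Circle.periodic_exp θ
    simp only [hF, this]
  have h1 : ∀ θ : ℝ, h (-Circle.exp θ) * (I * (Circle.exp θ : ℂ)) = -F (θ + Real.pi) := fun θ => by
    simp only [hF, Circle.exp_add, circle_exp_pi, mul_neg, mul_one, Circle.coe_neg, neg_neg]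
  rw [circleMean, circleMean, ← mul_neg]
  congr 1
  simp only [h1]
  rw [intervalIntegral.integral_neg, intervalIntegral.integral_comp_add_right, zero_add,
    add_comm (2 * Real.pi) Real.pi]
  congr 1
  have := hper.intervalIntegral_add_eq Real.pi 0
  rwa [zero_add] at this

lemma circleMean_neg (h : Circle → ℂ) : circleMean (fun τ => -h τ) = -circleMean h := by
  simpa using circleMean_const_mul (-1) h

variable {α : ℝ}

/-- Under `ε ↦ -ε`, `w ↦ -w`, `τ ↦ -τ` the products `ε b_j f_j'` are unchanged. The self-interaction
integral is odd and the other integral even, so with the prefactors `w` and `ε w` the whole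
expression is odd. -/
lemma contourF_reflect (b γ : Fin 2 → ℝ) (d ε Ω Z : ℝ) (f : Fin 2 → HolderX α) (j : Fin 2)
    (w : Circle) : contourF b γ d (-ε) Ω Z (fun j => (f j).reflect) j w
      = -contourF b γ d ε Ω Z f j (-w) := by
  have hd : ∀ k v, circleDeriv ((f k).reflect) v = -circleDeriv (f k) (-v) :=
    fun k v => circleDeriv_comp_neg (f k).contDiff v
  simp only [contourF, hd, HolderX.reflect_apply, Circle.coe_neg]
  set S := circleMean fun τ : Circle => (((τ : ℂ) - -(w : ℂ)) * conj (f j τ - f j (-w))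
    - conj ((τ : ℂ) - -(w : ℂ)) * (f j τ - f j (-w)))
    / (((τ : ℂ) - -(w : ℂ)) * (((τ : ℂ) - -(w : ℂ)) + ε * b j * (f j τ - f j (-w))))
      * (circleDeriv (f j) τ - (f j τ - f j (-w)) / ((τ : ℂ) - -(w : ℂ))) with hS
  set T := circleMean fun τ : Circle =>
    (conj (τ : ℂ) + ε * b (1 - j) * conj (f (1 - j) τ))
      * (1 + ε * b (1 - j) * circleDeriv (f (1 - j)) τ)
      / (ε * (b (1 - j) * τ + b j * -(w : ℂ))
        + ε ^ 2 * (b (1 - j) ^ 2 * f (1 - j) τ + b j ^ 2 * f j (-w)) - d) with hT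
  have h1 : (circleMean fun τ : Circle => (((τ : ℂ) - w) * conj (f j (-τ) - f j (-w))
      - conj ((τ : ℂ) - w) * (f j (-τ) - f j (-w)))
      / (((τ : ℂ) - w) * (((τ : ℂ) - w) + ((-ε : ℝ) : ℂ) * b j * (f j (-τ) - f j (-w))))
        * (-circleDeriv (f j) (-τ) - (f j (-τ) - f j (-w)) / ((τ : ℂ) - w))) = -S := by
    rw [hS, ← circleMean_comp_neg]
    congr 1
    funext τ
    have e1 : ((-τ : Circle) : ℂ) - -(w : ℂ) = -((τ : ℂ) - w) := by rw [Circle.coe_neg]; ring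
    rw [e1]
    generalize (τ : ℂ) - w = A
    generalize f j (-τ) - f j (-w) = B
    have e2 : -A * (-A + ε * b j * B) = A * (A + ((-ε : ℝ) : ℂ) * b j * B) := by
      push_cast
      ring
    rw [e2, map_neg, div_neg]
    ring
  have h2 : (circleMean fun τ : Circle =>
      (conj (τ : ℂ) + ((-ε : ℝ) : ℂ) * b (1 - j) * conj (f (1 - j) (-τ)))
      * (1 + ((-ε : ℝ) : ℂ) * b (1 - j) * -circleDeriv (f (1 - j)) (-τ))
      / (((-ε : ℝ) : ℂ) * (b (1 - j) * τ + b j * w)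
        + ((-ε : ℝ) : ℂ) ^ 2 * (b (1 - j) ^ 2 * f (1 - j) (-τ) + b j ^ 2 * f j (-w)) - d)) = T := by
    rw [hT, ← neg_neg (circleMean _), ← circleMean_comp_neg, ← circleMean_neg]
    congr 1
    funext τ
    rw [← neg_div, Circle.coe_neg, map_neg]
    push_cast
    simp only [neg_neg]
    congr 1 <;> ring
  rw [h1, h2, ← neg_im]
  congr 1
  push_cast
  rw [map_neg]
  ring

lemma IsSolution.reflect {b γ : Fin 2 → ℝ} {d ε Ω Z : ℝ} {f : Fin 2 → HolderX α}
    (h : IsSolution b γ d ε Ω Z f) : IsSolution b γ d (-ε) Ω Z fun j => (f j).reflect := by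
  intro j w
  rw [contourF_reflect, h j (-w), neg_zero]

lemma HolderX.norm_reflect (f : HolderX α) : ‖f.reflect‖ = ‖f‖ := by
  have hd : ∀ v, circleDeriv f.reflect v = -circleDeriv f (-v) :=
    fun v => circleDeriv_comp_neg f.contDiff v
  rw [HolderX.norm_def, HolderX.norm_def]
  simp only [hd, HolderX.reflect_apply, norm_neg]
  congr 1
  · exact (Equiv.neg Circle).iSup_congr fun _ => rfl
  congr 1
  · exact (Equiv.neg Circle).iSup_congr fun _ => rfl
  · refine ((Equiv.neg Circle).prodCongr (Equiv.neg Circle)).iSup_congr fun p => ?_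
    simp only [Equiv.prodCongr_apply, Prod.map, Equiv.neg_apply, Circle.coe_neg]
    congr 1
    · rw [neg_sub_neg, norm_sub_rev]
    · rw [neg_sub_neg, norm_sub_rev]

/-- The reflection of a pair of perturbations as a continuous linear map. -/
def reflectCLM : (Fin 2 → HolderX α) →L[ℝ] (Fin 2 → HolderX α) :=
  ContinuousLinearMap.pi fun j => (LinearMap.mkContinuous
    { toFun := HolderX.reflect
      map_add' := fun _ _ => rfl
      map_smul' := fun _ _ => rfl } 1
    fun f => by rw [one_mul]; exact f.norm_reflect.le).comp (ContinuousLinearMap.proj j)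

lemma reflectCLM_apply (f : Fin 2 → HolderX α) : reflectCLM f = fun j => (f j).reflect := rfl

lemma norm_reflectCLM (f : Fin 2 → HolderX α) : ‖reflectCLM f‖ = ‖f‖ := by
  rw [reflectCLM_apply, Pi.norm_def, Pi.norm_def]
  congr 2
  funext j
  exact NNReal.eq (f j).norm_reflect

end VortexPair

end

noncomputable section

namespace VortexPair

/-! ### The perturbations do not vanish -/

/-- Since `τ̄ = 1 / τ`, this is Cauchy's formula at `0` for `1 / (c z + e)`, which is holomorphic on
the closed disc because `‖c‖ < ‖e‖`. -/
lemma circleMean_conj_div {c e : ℂ} (h : ‖c‖ < ‖e‖) :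
    circleMean (fun τ => conj (τ : ℂ) / (c * τ + e)) = 1 / e := by
  have hne : ∀ z ∈ Metric.closedBall (0 : ℂ) 1, c * z + e ≠ 0 := fun z hz h0 => by
    rw [mem_closedBall_zero_iff] at hz
    have h1 : e = -(c * z) := by linear_combination h0
    rw [h1, norm_neg, norm_mul] at h
    exact absurd h (not_lt.2 (mul_le_of_le_one_right (norm_nonneg _) hz))
  have hd : DifferentiableOn ℂ (fun z : ℂ => 1 / (c * z + e)) (Metric.closedBall 0 1) :=
    (differentiableOn_const _).div (by fun_prop) hne
  have h1 := hd.circleIntegral_sub_inv_smul (w := 0) (Metric.mem_ball_self one_pos)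
  have h2 : circleMean (fun τ => conj (τ : ℂ) / (c * τ + e))
      = (1 / (2 * (Real.pi : ℂ) * I)) * ∮ z in C(0, 1), (z - 0)⁻¹ • (1 / (c * z + e)) := by
    rw [circleMean, circleIntegral]
    congr 1
    refine intervalIntegral.integral_congr fun θ _ => ?_
    have h3 : circleMap 0 1 θ = (Circle.exp θ : ℂ) := by simp [circleMap, Circle.coe_exp]
    simp only [deriv_circleMap, h3, sub_zero, smul_eq_mul]
    rw [← Circle.coe_inv_eq_conj, Circle.coe_inv]
    ring
  have hpi : (Real.pi : ℂ) ≠ 0 := by exact_mod_cast Real.pi_ne_zero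
  rw [h2, h1, smul_eq_mul, mul_zero, zero_add]
  field_simp

lemma normSq_sub_mul_exp (d β t : ℝ) :
    normSq ((d : ℂ) - β * (Circle.exp t : ℂ)) = d ^ 2 + β ^ 2 - 2 * d * β * Real.cos t := by
  rw [Circle.coe_exp, Complex.exp_mul_I, normSq_apply]
  simp [cos_ofReal_re, sin_ofReal_re]
  linear_combination β ^ 2 * Real.sin_sq_add_cos_sq t

/-- For `f = 0` the integrals are explicit, and the first equation becomes `sin t · (γ₂ d / |d - β
w|² - 2 Ω Z) = 0`, in the numbering of patches from 1. But `|d - β w|²` varies with `t` when `β ≠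
0`. -/
lemma IsSolution.ne_zero {α : ℝ} {b γ : Fin 2 → ℝ} {d ε Ω Z : ℝ} {f : Fin 2 → HolderX α}
    (h : IsSolution b γ d ε Ω Z f) (hb : ∀ j, 0 < b j) (hd : 2 * (b 0 + b 1) < d)
    (hγ : ∀ j, γ j ≠ 0) (hε : ε ≠ 0) (hε1 : |ε| < 1) : f ≠ 0 := by
  rintro rfl
  have hb0 := hb 0
  have hb1 := hb 1
  have hd0 : 0 < d := by linarith
  set β := ε * b 0 with hβ
  have hβ0 : β ≠ 0 := mul_ne_zero hε hb0.ne'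
  have hβd : |β| + |ε * b 1| < d := by
    rw [hβ, abs_mul, abs_mul, abs_of_pos hb0, abs_of_pos hb1]
    nlinarith
  have key : ∀ t : ℝ, Real.sin t ≠ 0 →
      2 * Ω * Z * (d ^ 2 + β ^ 2 - 2 * d * β * Real.cos t) = γ 1 * d := by
    intro t ht
    have h1 := h 0 (Circle.exp t)
    set w := Circle.exp t with hw
    have hz : HolderX.toFun (0 : HolderX α) = 0 := rfl
    have hlt : ‖((ε * b 1 : ℝ) : ℂ)‖ < ‖(β : ℂ) * w - d‖ := by
      have h2 := norm_sub_norm_le (d : ℂ) (β * w)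
      rw [norm_mul, Circle.norm_coe, mul_one, norm_real, norm_real, Real.norm_eq_abs,
        Real.norm_eq_abs, abs_of_pos hd0] at h2
      rw [norm_real, Real.norm_eq_abs, norm_sub_rev]
      linarith
    have hm : circleMean (fun τ : Circle => conj (τ : ℂ) / (ε * (b 1 * τ + b 0 * w) - d))
        = 1 / (β * w - d) := by
      rw [← circleMean_conj_div hlt]
      congr 1
      funext τ
      congr 1
      rw [hβ]
      push_cast
      ring
    have hne : (d : ℂ) - β * w ≠ 0 := fun h0 => by
      have h3 : (β : ℂ) * w - d = 0 := by linear_combination -h0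
      rw [h3, norm_zero] at hlt
      exact absurd hlt (not_lt.2 (norm_nonneg _))
    have hmul : conj (w : ℂ) * w = 1 := circle_conj_mul w
    have hns : ((d : ℂ) - β * w) * conj ((d : ℂ) - β * w) = (normSq ((d : ℂ) - β * w) : ℝ) :=
      mul_conj _
    have hns0 : ((normSq ((d : ℂ) - β * w) : ℝ) : ℂ) ≠ 0 := by
      exact_mod_cast (normSq_pos.2 hne).ne'
    have hinv : 1 / ((β : ℂ) * w - d)
        = -(conj ((d : ℂ) - β * w) / (normSq ((d : ℂ) - β * w) : ℝ)) := by
      have hc : conj ((d : ℂ) - β * w) ≠ 0 := (map_ne_zero _).2 hne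
      rw [← hns, div_mul_cancel_right₀ hc, ← neg_sub (d : ℂ), one_div, inv_neg]
    simp only [contourF, Pi.zero_apply, hz, circleDeriv_zero, map_zero, mul_zero, add_zero, mul_one,
      sub_zero, zero_mul, Fin.isValue, Fin.val_zero, zero_add, pow_one, sub_self,
      Nat.cast_zero, zero_div] at h1
    have hm0 : circleMean (fun _ => 0) = 0 := by simp [circleMean]
    rw [hm, hinv, hm0, mul_zero, add_zero] at h1
    have h4 : 2 * (Ω : ℂ) * (ε * b 0 * conj (w : ℂ) + -1 * Z) * w
        - γ 1 * w * -(conj ((d : ℂ) - β * w) / (normSq ((d : ℂ) - β * w) : ℝ))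
        = ((2 * Ω * β - γ 1 * β / normSq ((d : ℂ) - β * w) : ℝ) : ℂ)
          + ((-(2 * Ω * Z) + γ 1 * d / normSq ((d : ℂ) - β * w) : ℝ) : ℂ) * w := by
      have hb' : (β : ℂ) = ε * b 0 := by rw [hβ]; push_cast; rfl
      have hc : conj ((d : ℂ) - β * w) = d - β * conj (w : ℂ) := by simp
      rw [hc]
      push_cast
      rw [hb']
      linear_combination (2 * (Ω : ℂ) * (ε * b 0)
        - γ 1 * (ε * b 0) / ((normSq ((d : ℂ) - ε * b 0 * w) : ℝ) : ℂ)) * hmul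
    have hi : (w : ℂ).im = Real.sin t := by
      rw [hw, Circle.coe_exp, exp_ofReal_mul_I_im]
    rw [h4, add_im, ofReal_im, zero_add, im_ofReal_mul, hi] at h1
    have h5 := (mul_eq_zero.1 h1).resolve_right ht
    have h6 : normSq ((d : ℂ) - β * w) ≠ 0 := (normSq_pos.2 hne).ne'
    rw [← normSq_sub_mul_exp, ← hw]
    field_simp at h5
    linarith
  -- Two angles with different cosines force `Ω Z = 0`, which contradicts `γ 1 * d ≠ 0`.
  have h2 := key (Real.pi / 2) (by rw [Real.sin_pi_div_two]; norm_num)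
  have h3 := key (Real.pi / 3) (by rw [Real.sin_pi_div_three]; positivity)
  rw [Real.cos_pi_div_two] at h2
  rw [Real.cos_pi_div_three] at h3
  have h4 : 2 * Ω * Z * (d * β) = 0 := by linarith
  have h5 : 2 * Ω * Z = 0 := (mul_eq_zero.1 h4).resolve_right (mul_ne_zero hd0.ne' hβ0)
  rw [h5, zero_mul] at h2
  exact mul_ne_zero (hγ 1) hd0.ne' h2.symm

end VortexPair

end

/-! ### Uniqueness among `C^{1+α}` solutions by energy estimates -/

noncomputable section

namespace VortexPair

/-! ### Orthogonality relations -/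

open MeasureTheory Filter Topology

lemma continuous_of_comp_exp {h : Circle → ℂ} (hh : Continuous fun θ : ℝ => h (Circle.exp θ)) :
    Continuous h :=
  (isLocalHomeomorph_circleExp.isOpenMap.isQuotientMap Circle.exp.continuous
    Circle.exp_surjective).continuous_iff.2 hh

lemma HolderX.continuous (u : HolderX α) : Continuous (u : Circle → ℂ) :=
  continuous_of_comp_exp u.contDiff.continuous

lemma HolderX.hasDerivAt_exp (u : HolderX α) (t : ℝ) :
    HasDerivAt (fun θ : ℝ => u (Circle.exp θ))
      (circleDeriv u (Circle.exp t) * (I * (Circle.exp t : ℂ))) t := by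
  simpa using u.hasCircleDeriv.hasDerivAt 1 t

lemma HolderX.continuous_circleDeriv (u : HolderX α) : Continuous (circleDeriv u) := by
  refine continuous_of_comp_exp ?_
  have h1 : (fun θ : ℝ => circleDeriv u (Circle.exp θ))
      = fun θ : ℝ => deriv (fun θ : ℝ => u (Circle.exp θ)) θ / (I * (Circle.exp θ : ℂ)) := by
    funext θ
    rw [(u.hasDerivAt_exp θ).deriv]
    field_simp [I_ne_zero, Circle.coe_ne_zero]
  rw [h1]
  refine (u.contDiff.continuous_deriv le_rfl).div (by fun_prop) fun θ => ?_
  exact mul_ne_zero I_ne_zero (Circle.coe_ne_zero _)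

lemma HolderX.norm_apply_le (u : HolderX α) (w : Circle) : ‖u w‖ ≤ ‖u‖ := by
  have h0 := le_ciSup u.bddAbove_norm w
  have h2 : 0 ≤ ⨆ w : Circle, ‖circleDeriv u w‖ := Real.iSup_nonneg fun _ => norm_nonneg _
  have h3 : 0 ≤ ⨆ p : Circle × Circle,
      ‖circleDeriv u p.1 - circleDeriv u p.2‖ / ‖(p.1 : ℂ) - (p.2 : ℂ)‖ ^ α :=
    Real.iSup_nonneg fun _ => by positivity
  rw [HolderX.norm_def]
  linarith

lemma HolderX.norm_circleDeriv_le (u : HolderX α) (w : Circle) : ‖circleDeriv u w‖ ≤ ‖u‖ := by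
  have h0 := le_ciSup u.bddAbove_deriv w
  have h2 : 0 ≤ ⨆ w : Circle, ‖u w‖ := Real.iSup_nonneg fun _ => norm_nonneg _
  have h3 : 0 ≤ ⨆ p : Circle × Circle,
      ‖circleDeriv u p.1 - circleDeriv u p.2‖ / ‖(p.1 : ℂ) - (p.2 : ℂ)‖ ^ α :=
    Real.iSup_nonneg fun _ => by positivity
  rw [HolderX.norm_def]
  linarith

lemma circleDeriv_sub (u v : HolderX α) (w : Circle) :
    circleDeriv (u - v : HolderX α) w = circleDeriv u w - circleDeriv v w := by
  have h1 := circleDeriv_add (u - v : HolderX α).contDiff v.contDiff w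
  rw [← HolderX.coe_add, sub_add_cancel] at h1
  rw [h1, add_sub_cancel_right]

/-- If `G` is orthogonal to all negative modes, then it is orthogonal to the elements of `X` and
to all their rotations. -/
lemma integral_mul_eq_zero (u : HolderX α) {G : ℝ → ℂ} (hG : Continuous G)
    (h : ∀ n : ℕ, ∫ θ in (0 : ℝ)..(2 * Real.pi), conj (Circle.exp θ : ℂ) ^ (n + 1) * G θ = 0)
    (t : ℝ) : ∫ θ in (0 : ℝ)..(2 * Real.pi), u (Circle.exp (θ + t)) * G θ = 0 := by
  obtain ⟨a, ha⟩ := u.hasRealNegExpansion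
  -- Convergence at the single point `w = 1` is already absolute, since summability in `ℂ` is
  -- unconditional.
  have hsum : Summable fun n => |a n| := by
    have h1 := (ha 1).summable.norm
    simpa [norm_conj_pow] using h1
  have h1 : HasSum (fun n : ℕ => ∫ θ in (0 : ℝ)..(2 * Real.pi),
      (a n : ℂ) * conj (Circle.exp (θ + t) : ℂ) ^ (n + 1) * G θ)
      (∫ θ in (0 : ℝ)..(2 * Real.pi), u (Circle.exp (θ + t)) * G θ) := by
    refine intervalIntegral.hasSum_integral_of_dominated_convergence
      (fun n θ => |a n| * ‖G θ‖) (fun n => ?_) (fun n => ?_) ?_ ?_ ?_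
    · exact (by fun_prop : Continuous fun θ : ℝ => (a n : ℂ) *
        conj (Circle.exp (θ + t) : ℂ) ^ (n + 1) * G θ).aestronglyMeasurable
    · refine ae_of_all _ fun θ _ => ?_
      rw [norm_mul, norm_mul, norm_conj_pow, mul_one, norm_real, Real.norm_eq_abs]
    · exact ae_of_all _ fun θ _ => hsum.mul_right _
    · simp only [tsum_mul_right]
      exact (by fun_prop : Continuous fun θ : ℝ => (∑' n, |a n|) * ‖G θ‖).intervalIntegrable _ _
    · exact ae_of_all _ fun θ _ => (ha _).mul_right _
  have h2 : ∀ n : ℕ, ∫ θ in (0 : ℝ)..(2 * Real.pi),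
      (a n : ℂ) * conj (Circle.exp (θ + t) : ℂ) ^ (n + 1) * G θ = 0 := fun n => by
    have h3 : ∀ θ : ℝ, (a n : ℂ) * conj (Circle.exp (θ + t) : ℂ) ^ (n + 1) * G θ
        = (a n : ℂ) * conj (Circle.exp t : ℂ) ^ (n + 1)
          * (conj (Circle.exp θ : ℂ) ^ (n + 1) * G θ) := fun θ => by
      rw [Circle.exp_add, Circle.coe_mul, map_mul, mul_pow]
      ring
    simp only [h3, intervalIntegral.integral_const_mul, h n, mul_zero]
  simp only [h2] at h1
  exact h1.unique hasSum_zero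

/-- The integral against every rotation of `u` vanishes; differentiation in the rotation angle
brings in `u'`. Termwise differentiation of the expansion, which need not converge absolutely, is
avoided. -/
lemma integral_deriv_mul_eq_zero (u : HolderX α) {G : ℝ → ℂ} (hG : Continuous G)
    (h : ∀ n : ℕ, ∫ θ in (0 : ℝ)..(2 * Real.pi), conj (Circle.exp θ : ℂ) ^ (n + 1) * G θ = 0) :
    ∫ θ in (0 : ℝ)..(2 * Real.pi),
      circleDeriv u (Circle.exp θ) * (Circle.exp θ : ℂ) * G θ = 0 := by
  have hu := u.continuous
  have hu' := u.continuous_circleDeriv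
  have h1 := (intervalIntegral.hasDerivAt_integral_of_dominated_loc_of_deriv_le (𝕜 := ℝ)
    (μ := volume) (a := 0) (b := 2 * Real.pi) (s := univ) (x₀ := (0 : ℝ))
    (F := fun t θ => u (Circle.exp (θ + t)) * G θ)
    (F' := fun t θ => circleDeriv u (Circle.exp (θ + t)) * (I * (Circle.exp (θ + t) : ℂ)) * G θ)
    (bound := fun θ => ‖u‖ * ‖G θ‖) univ_mem (Eventually.of_forall fun t => ?_) ?_ ?_
    (ae_of_all _ fun θ _ t _ => ?_) ?_ (ae_of_all _ fun θ _ t _ => ?_)).2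
  · simp only [integral_mul_eq_zero u hG h] at h1
    have h2 := h1.unique (hasDerivAt_const (0 : ℝ) (0 : ℂ))
    simp only [add_zero] at h2
    have h3 : ∀ θ : ℝ, circleDeriv u (Circle.exp θ) * (I * (Circle.exp θ : ℂ)) * G θ
        = I * (circleDeriv u (Circle.exp θ) * (Circle.exp θ : ℂ) * G θ) := fun θ => by ring
    simp only [h3, intervalIntegral.integral_const_mul] at h2
    exact (mul_eq_zero.1 h2).resolve_left I_ne_zero
  · exact (by fun_prop : Continuous fun θ : ℝ => u (Circle.exp (θ + t)) * G θ).aestronglyMeasurable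
  · exact (by fun_prop : Continuous fun θ : ℝ =>
      u (Circle.exp (θ + 0)) * G θ).intervalIntegrable _ _
  · exact (by fun_prop : Continuous fun θ : ℝ => circleDeriv u (Circle.exp (θ + 0))
      * (I * (Circle.exp (θ + 0) : ℂ)) * G θ).aestronglyMeasurable
  · rw [norm_mul, norm_mul, norm_mul, norm_I, Circle.norm_coe, mul_one, mul_one]
    exact mul_le_mul_of_nonneg_right (u.norm_circleDeriv_le _) (norm_nonneg _)
  · exact (by fun_prop : Continuous fun θ : ℝ => ‖u‖ * ‖G θ‖).intervalIntegrable _ _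
  · have := (u.hasDerivAt_exp (θ + t)).comp_const_add θ t
    exact this.mul_const _

lemma integral_conj_pow (n : ℕ) :
    ∫ θ in (0 : ℝ)..(2 * Real.pi), conj (Circle.exp θ : ℂ) ^ (n + 1) = 0 := by
  have h := circleMean_zpow (-(n + 2 : ℤ))
  rw [if_neg (by omega), circleMean] at h
  have hpi : (Real.pi : ℂ) ≠ 0 := by exact_mod_cast Real.pi_ne_zero
  have h1 : ∀ θ : ℝ, (Circle.exp θ : ℂ) ^ (-(n + 2 : ℤ)) * (I * (Circle.exp θ : ℂ))
      = I * conj (Circle.exp θ : ℂ) ^ (n + 1) := fun θ => by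
    rw [← Circle.coe_inv_eq_conj, Circle.coe_inv, inv_pow, zpow_neg]
    have h0 := Circle.coe_ne_zero (Circle.exp θ)
    have e : (Circle.exp θ : ℂ) ^ (n + 2 : ℤ) = (Circle.exp θ : ℂ) ^ (n + 1) * Circle.exp θ := by
      rw [← pow_succ]
      norm_cast
    rw [e]
    field_simp
  simp only [h1, intervalIntegral.integral_const_mul] at h
  refine (mul_eq_zero.1 ((mul_eq_zero.1 h).resolve_left ?_)).resolve_left I_ne_zero
  exact one_div_ne_zero (mul_ne_zero (mul_ne_zero two_ne_zero hpi) I_ne_zero)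

lemma integral_apply_eq_zero (u : HolderX α) :
    ∫ θ in (0 : ℝ)..(2 * Real.pi), u (Circle.exp θ) = 0 := by
  have h := integral_mul_eq_zero u (G := fun _ => 1) continuous_const
    (fun n => by simpa using integral_conj_pow n) 0
  simpa using h

lemma integral_circleDeriv_mul_conj_pow (u : HolderX α) (k : ℕ) :
    ∫ θ in (0 : ℝ)..(2 * Real.pi), circleDeriv u (Circle.exp θ) * (Circle.exp θ : ℂ)
      * conj (Circle.exp θ : ℂ) ^ k = 0 :=
  integral_deriv_mul_eq_zero u (by fun_prop) fun n => by
    simp only [← pow_add]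
    rw [show n + 1 + k = n + k + 1 by ring]
    exact integral_conj_pow (n + k)

/-- Heuristically, `u'²` has only modes `w̄^k` with `k ≥ 4`. The orthogonality relation is applied
twice, the second time with a multiple of `u'` itself as test function. -/
lemma integral_circleDeriv_sq (u : HolderX α) :
    ∫ θ in (0 : ℝ)..(2 * Real.pi), circleDeriv u (Circle.exp θ) ^ 2 = 0 := by
  have hu' := u.continuous_circleDeriv
  have h := integral_deriv_mul_eq_zero u
    (G := fun θ => circleDeriv u (Circle.exp θ) * (Circle.exp θ : ℂ)
      * conj (Circle.exp θ : ℂ) ^ 2) (by fun_prop) fun n => by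
    rw [← integral_circleDeriv_mul_conj_pow u (n + 3)]
    refine intervalIntegral.integral_congr fun θ _ => ?_
    ring
  rw [← h]
  refine intervalIntegral.integral_congr fun θ _ => ?_
  linear_combination (-circleDeriv u (Circle.exp θ) ^ 2
    * (1 + conj (Circle.exp θ : ℂ) * (Circle.exp θ : ℂ))) * circle_conj_mul (Circle.exp θ)

/-- The energy `∫₀^{2π} |u'(e^{iθ})|² dθ`. -/
def energy (u : HolderX α) : ℝ :=
  ∫ θ in (0 : ℝ)..(2 * Real.pi), ‖circleDeriv u (Circle.exp θ)‖ ^ 2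

lemma energy_nonneg (u : HolderX α) : 0 ≤ energy u :=
  intervalIntegral.integral_nonneg (by positivity) fun _ _ => by positivity

/-- From `(Im z)² = (|z|² - Re z²) / 2` and the vanishing of `∫ u'²`: the imaginary part carries
half of the energy. -/
lemma integral_im_circleDeriv_sq (u : HolderX α) :
    ∫ θ in (0 : ℝ)..(2 * Real.pi), (circleDeriv u (Circle.exp θ)).im ^ 2 = energy u / 2 := by
  have hu' := u.continuous_circleDeriv
  have h1 : ∀ θ : ℝ, (circleDeriv u (Circle.exp θ)).im ^ 2
      = ‖circleDeriv u (Circle.exp θ)‖ ^ 2 / 2 - reCLM (circleDeriv u (Circle.exp θ) ^ 2) / 2 :=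
    fun θ => by
      rw [← normSq_eq_norm_sq, normSq_apply, sq (circleDeriv u (Circle.exp θ)), reCLM_apply, mul_re]
      ring
  have h2 : ∫ θ in (0 : ℝ)..(2 * Real.pi), reCLM (circleDeriv u (Circle.exp θ) ^ 2) = 0 := by
    rw [ContinuousLinearMap.intervalIntegral_comp_comm _
      ((by fun_prop : Continuous fun θ : ℝ =>
        circleDeriv u (Circle.exp θ) ^ 2).intervalIntegrable _ _), integral_circleDeriv_sq, map_zero]
  simp only [h1]
  rw [intervalIntegral.integral_sub, intervalIntegral.integral_div, intervalIntegral.integral_div,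
    h2, zero_div, sub_zero, energy]
  · exact (by fun_prop : Continuous fun θ : ℝ =>
      ‖circleDeriv u (Circle.exp θ)‖ ^ 2 / 2).intervalIntegrable _ _
  · exact (by fun_prop : Continuous fun θ : ℝ =>
      reCLM (circleDeriv u (Circle.exp θ) ^ 2) / 2).intervalIntegrable _ _

lemma integral_sin_mul_im_circleDeriv (u : HolderX α) :
    ∫ θ in (0 : ℝ)..(2 * Real.pi), Real.sin θ * (circleDeriv u (Circle.exp θ)).im = 0 := by
  have hu' := u.continuous_circleDeriv
  have h1 : ∀ θ : ℝ, Real.sin θ * (circleDeriv u (Circle.exp θ)).im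
      = reCLM (circleDeriv u (Circle.exp θ) * (Circle.exp θ : ℂ) * conj (Circle.exp θ : ℂ) ^ 2
        - circleDeriv u (Circle.exp θ) * (Circle.exp θ : ℂ) * conj (Circle.exp θ : ℂ) ^ 0) / 2 :=
    fun θ => by
      have e : circleDeriv u (Circle.exp θ) * (Circle.exp θ : ℂ) * conj (Circle.exp θ : ℂ) ^ 2
          = circleDeriv u (Circle.exp θ) * conj (Circle.exp θ : ℂ) := by
        linear_combination circleDeriv u (Circle.exp θ) * conj (Circle.exp θ : ℂ)
          * circle_conj_mul (Circle.exp θ)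
      have hi : (Circle.exp θ : ℂ).im = Real.sin θ := by
        rw [Circle.coe_exp, exp_ofReal_mul_I_im]
      rw [e, pow_zero, mul_one, ← mul_sub, reCLM_apply, mul_re, sub_re, sub_im, conj_re, conj_im, hi]
      ring
  simp only [h1]
  rw [intervalIntegral.integral_div, ContinuousLinearMap.intervalIntegral_comp_comm,
    intervalIntegral.integral_sub, integral_circleDeriv_mul_conj_pow,
    integral_circleDeriv_mul_conj_pow, sub_zero, map_zero, zero_div]
  all_goals exact Continuous.intervalIntegrable (by fun_prop) _ _

/-- Coercivity of the principal part: its `L²` norm controls both the scalar difference and the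
energy of the perturbation, because the cross term vanishes. -/
lemma integral_sin_sub_im_circleDeriv_sq (u : HolderX α) (p c : ℝ) :
    ∫ θ in (0 : ℝ)..(2 * Real.pi), (p * Real.sin θ - c * (circleDeriv u (Circle.exp θ)).im) ^ 2
      = Real.pi * p ^ 2 + c ^ 2 * (energy u / 2) := by
  have hu' : Continuous fun θ : ℝ => (circleDeriv u (Circle.exp θ)).im :=
    Complex.continuous_im.comp (u.continuous_circleDeriv.comp Circle.exp.continuous)
  have h1 : ∀ θ : ℝ, (p * Real.sin θ - c * (circleDeriv u (Circle.exp θ)).im) ^ 2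
      = p ^ 2 * Real.sin θ ^ 2 + c ^ 2 * (circleDeriv u (Circle.exp θ)).im ^ 2
        - 2 * p * c * (Real.sin θ * (circleDeriv u (Circle.exp θ)).im) := fun θ => by ring
  simp only [h1]
  rw [intervalIntegral.integral_sub, intervalIntegral.integral_add,
    intervalIntegral.integral_const_mul, intervalIntegral.integral_const_mul,
    intervalIntegral.integral_const_mul, integral_im_circleDeriv_sq,
    integral_sin_mul_im_circleDeriv, integral_sin_sq]
  · simp
    ring
  all_goals exact Continuous.intervalIntegrable (by fun_prop) _ _

end VortexPair

end

noncomputable section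

namespace VortexPair

/-! ### Bounds in terms of the energy -/

open MeasureTheory

lemma integral_comp_mul_exp {E : Type*} [NormedAddCommGroup E] [NormedSpace ℝ E] (h : Circle → E)
    (w : Circle) (a : ℝ) :
    ∫ t in a..a + 2 * Real.pi, h (w * Circle.exp t)
      = ∫ θ in (0 : ℝ)..(2 * Real.pi), h (Circle.exp θ) := by
  have hper : Function.Periodic (fun θ : ℝ => h (Circle.exp θ)) (2 * Real.pi) := fun θ => by
    have := Circle.periodic_exp θ
    simp only [this]
  have h1 : ∀ t : ℝ, h (w * Circle.exp t) = h (Circle.exp (t + Complex.arg w)) := fun t => by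
    rw [Circle.exp_add, Circle.exp_arg, mul_comm]
  simp only [h1]
  rw [intervalIntegral.integral_comp_add_right (fun θ : ℝ => h (Circle.exp θ)),
    add_right_comm, hper.intervalIntegral_add_eq _ 0, zero_add]

lemma HolderX.norm_sub_le (u : HolderX α) (τ w : Circle) :
    ‖u τ - u w‖ ≤ 2 * ‖u‖ * ‖(τ : ℂ) - w‖ := by
  obtain ⟨t, ht, rfl⟩ := exists_eq_mul_exp τ w
  have h3 := (convex_uIcc (0 : ℝ) t).norm_image_sub_le_of_norm_hasDerivWithin_le (C := ‖u‖)
    (fun s _ => (u.hasCircleDeriv.hasDerivAt w s).hasDerivWithinAt)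
    (fun s _ => by
      rw [norm_mul, norm_mul, norm_I, Circle.norm_coe, mul_one, mul_one]
      exact u.norm_circleDeriv_le _) left_mem_uIcc right_mem_uIcc
  simp only [Circle.exp_zero, mul_one, sub_zero, Real.norm_eq_abs] at h3
  refine h3.trans ?_
  have h4 := mul_le_mul_of_nonneg_left (abs_le_norm_mul_exp_sub_self w ht) (norm_nonneg u)
  linarith

lemma HolderX.norm_quot_le (u : HolderX α) (τ w : Circle) :
    ‖(u τ - u w) / ((τ : ℂ) - w)‖ ≤ 2 * ‖u‖ := by
  rw [norm_div]
  exact div_le_of_le_mul₀ (norm_nonneg _) (by positivity) (u.norm_sub_le τ w)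

lemma HolderX.intervalIntegrable_quot (u : HolderX α) (w : Circle) (a c : ℝ) (v : Circle) :
    IntervalIntegrable (fun θ : ℝ => ‖(u (v * Circle.exp θ) - u w)
      / (((v * Circle.exp θ : Circle) : ℂ) - w)‖) volume a c := by
  have hu := u.continuous
  refine (intervalIntegrable_const (c := 2 * ‖u‖)).mono_fun ?_ (ae_of_all _ fun θ => ?_)
  · exact ((by fun_prop : Continuous fun θ : ℝ => u (v * Circle.exp θ) - u w).measurable.div
      (by fun_prop : Continuous fun θ : ℝ =>
        ((v * Circle.exp θ : Circle) : ℂ) - w).measurable).norm.aestronglyMeasurable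
  · beta_reduce
    rw [norm_norm, Real.norm_eq_abs, abs_of_nonneg (by positivity : 0 ≤ 2 * ‖u‖)]
    exact u.norm_quot_le _ _

section Energy

variable {u : HolderX α} {N : ℝ}

/-- Young's inequality with parameter `N` replaces Cauchy–Schwarz: `2π · N / 2 + N / 2 ≤ 5 N`. -/
lemma integral_norm_circleDeriv_le (hN : 0 < N) (hE : energy u ≤ N ^ 2) :
    ∫ θ in (0 : ℝ)..(2 * Real.pi), ‖circleDeriv u (Circle.exp θ)‖ ≤ 5 * N := by
  have hu' := u.continuous_circleDeriv
  have h1 : ∫ θ in (0 : ℝ)..(2 * Real.pi), ‖circleDeriv u (Circle.exp θ)‖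
      ≤ ∫ θ in (0 : ℝ)..(2 * Real.pi),
        (N / 2 + 1 / (2 * N) * ‖circleDeriv u (Circle.exp θ)‖ ^ 2) := by
    refine intervalIntegral.integral_mono_on (by positivity)
      (Continuous.intervalIntegrable (by fun_prop) _ _)
      (Continuous.intervalIntegrable (by fun_prop) _ _) fun θ _ => ?_
    have h2 := sq_nonneg (N - ‖circleDeriv u (Circle.exp θ)‖)
    rw [show N / 2 + 1 / (2 * N) * ‖circleDeriv u (Circle.exp θ)‖ ^ 2
      = (N ^ 2 + ‖circleDeriv u (Circle.exp θ)‖ ^ 2) / (2 * N) by field_simp, le_div_iff₀ (by positivity)]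
    linarith
  rw [intervalIntegral.integral_add (Continuous.intervalIntegrable (by fun_prop) _ _)
    (Continuous.intervalIntegrable (by fun_prop) _ _), intervalIntegral.integral_const_mul,
    intervalIntegral.integral_const, smul_eq_mul, sub_zero] at h1
  have h3 : 1 / (2 * N) * energy u ≤ N / 2 := by
    have := mul_le_mul_of_nonneg_left hE (by positivity : 0 ≤ 1 / (2 * N))
    refine this.trans (le_of_eq ?_)
    field_simp
  have hpi := Real.pi_lt_four
  change _ ≤ _ + 1 / (2 * N) * energy u at h1
  nlinarith

/-- The embedding of `H¹` into Hölder `1/2`, again by Young's inequality, now with weights `N` and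
`√t`. -/
lemma norm_sub_le_sqrt (hN : 0 < N) (hE : energy u ≤ N ^ 2) (w : Circle) {t : ℝ} (ht : 0 ≤ t)
    (ht2 : t ≤ 2 * Real.pi) : ‖u (w * Circle.exp t) - u w‖ ≤ N * √t := by
  rcases ht.eq_or_lt with rfl | ht0
  · simp
  have hu' := u.continuous_circleDeriv
  have hs : 0 < √t := Real.sqrt_pos.2 ht0
  have hss : √t * √t = t := Real.mul_self_sqrt ht
  have hc : Continuous fun s : ℝ => ‖circleDeriv u (w * Circle.exp s)‖ ^ 2 := by fun_prop
  have h1 : ∫ s in (0 : ℝ)..t, circleDeriv u (w * Circle.exp s) * (I * ((w * Circle.exp s : Circle) : ℂ))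
      = u (w * Circle.exp t) - u w := by
    rw [intervalIntegral.integral_eq_sub_of_hasDerivAt
      (fun s _ => u.hasCircleDeriv.hasDerivAt w s) (Continuous.intervalIntegrable (by fun_prop) _ _)]
    simp
  rw [← h1]
  have h2 := intervalIntegral.norm_integral_le_of_norm_le (μ := volume) ht (f := fun s : ℝ =>
      circleDeriv u (w * Circle.exp s) * (I * ((w * Circle.exp s : Circle) : ℂ)))
    (g := fun s => N / (2 * √t) + √t / (2 * N) * ‖circleDeriv u (w * Circle.exp s)‖ ^ 2)
    (ae_of_all _ fun s _ => by
      rw [norm_mul, norm_mul, norm_I, Circle.norm_coe, mul_one, mul_one]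
      have h2 := sq_nonneg (N - √t * ‖circleDeriv u (w * Circle.exp s)‖)
      rw [show N / (2 * √t) + √t / (2 * N) * ‖circleDeriv u (w * Circle.exp s)‖ ^ 2
        = (N ^ 2 + (√t * ‖circleDeriv u (w * Circle.exp s)‖) ^ 2) / (2 * N * √t) by
          field_simp, le_div_iff₀ (by positivity)]
      linarith)
    (Continuous.intervalIntegrable (by fun_prop) _ _)
  rw [intervalIntegral.integral_add (Continuous.intervalIntegrable (by fun_prop) _ _)
    (Continuous.intervalIntegrable (by fun_prop) _ _), intervalIntegral.integral_const_mul,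
    intervalIntegral.integral_const, smul_eq_mul, sub_zero] at h2
  have h3 : ∫ s in (0 : ℝ)..t, ‖circleDeriv u (w * Circle.exp s)‖ ^ 2 ≤ N ^ 2 := by
    refine le_trans ?_ hE
    rw [energy, ← integral_comp_mul_exp (fun τ => ‖circleDeriv u τ‖ ^ 2) w 0, zero_add,
      ← intervalIntegral.integral_add_adjacent_intervals (hc.intervalIntegrable 0 t)
        (hc.intervalIntegrable t (2 * Real.pi))]
    have : 0 ≤ ∫ s in t..(2 * Real.pi), ‖circleDeriv u (w * Circle.exp s)‖ ^ 2 :=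
      intervalIntegral.integral_nonneg ht2 fun _ _ => by positivity
    linarith
  have h4 := mul_le_mul_of_nonneg_left h3 (by positivity : 0 ≤ √t / (2 * N))
  refine h2.trans ((add_le_add_right h4 _).trans (le_of_eq ?_))
  field_simp
  linear_combination -hss

lemma norm_sub_le_sqrt_abs (hN : 0 < N) (hE : energy u ≤ N ^ 2) (w : Circle) {t : ℝ}
    (ht : |t| ≤ Real.pi) : ‖u (w * Circle.exp t) - u w‖ ≤ N * √|t| := by
  have hpi := Real.pi_pos
  rcases le_total 0 t with h | h
  · rw [abs_of_nonneg h] at ht ⊢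
    exact norm_sub_le_sqrt hN hE w h (by linarith)
  · rw [abs_of_nonpos h] at ht ⊢
    have h1 := norm_sub_le_sqrt hN hE (w * Circle.exp t) (t := -t) (by linarith) (by linarith)
    rw [mul_assoc, ← Circle.exp_add, add_neg_cancel, Circle.exp_zero, mul_one, norm_sub_rev] at h1
    exact h1

/-- The mean over the angle of `u` is zero, so `u(w)` is bounded by the mean oscillation, and `√(2π)
≤ 3`. -/
lemma norm_le_of_energy_le (hN : 0 < N) (hE : energy u ≤ N ^ 2) (w : Circle) :
    ‖u w‖ ≤ 3 * N := by
  have hu := u.continuous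
  have hpi := Real.pi_pos
  have h1 : ∫ t in (0 : ℝ)..(2 * Real.pi), (u (w * Circle.exp t) - u w)
      = -((2 * Real.pi : ℝ) • u w) := by
    rw [intervalIntegral.integral_sub (Continuous.intervalIntegrable (by fun_prop) _ _)
      (Continuous.intervalIntegrable (by fun_prop) _ _)]
    have h2 := integral_comp_mul_exp (fun τ => u τ) w 0
    rw [zero_add, integral_apply_eq_zero] at h2
    rw [h2, intervalIntegral.integral_const, sub_zero, zero_sub]
  have h2 := intervalIntegral.norm_integral_le_of_norm_le_const (a := 0) (b := 2 * Real.pi)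
    (C := N * 3) (f := fun t : ℝ => u (w * Circle.exp t) - u w) fun t ht => by
      rw [uIoc_of_le (by positivity)] at ht
      refine (norm_sub_le_sqrt hN hE w ht.1.le ht.2).trans (mul_le_mul_of_nonneg_left ?_ hN.le)
      rw [Real.sqrt_le_left (by norm_num)]
      linarith [ht.2, Real.pi_lt_four]
  rw [h1, norm_neg, norm_smul, Real.norm_eq_abs, sub_zero, abs_of_pos (by positivity : 0 < 2 * Real.pi),
    mul_comm (N * 3)] at h2
  have := le_of_mul_le_mul_left h2 (by positivity)
  linarith

/-- By the Hölder bound the quotient is at most `2 N |t|^(-1/2)`, which is integrable, with total at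
most `8 N √π ≤ 16 N`. -/
lemma integral_norm_quot_le (hN : 0 < N) (hE : energy u ≤ N ^ 2) (w : Circle) :
    ∫ θ in (0 : ℝ)..(2 * Real.pi), ‖(u (Circle.exp θ) - u w) / ((Circle.exp θ : ℂ) - w)‖
      ≤ 16 * N := by
  have hpi := Real.pi_pos
  set g : ℝ → ℝ := fun t => ‖(u (w * Circle.exp t) - u w) / (((w * Circle.exp t : Circle) : ℂ) - w)‖
    with hg
  have hint : ∀ a c : ℝ, IntervalIntegrable g volume a c := fun a c =>
    u.intervalIntegrable_quot w a c w
  have hneg : IntervalIntegrable (fun t => g (-t)) volume 0 Real.pi := by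
    simpa using (IntervalIntegrable.iff_comp_neg enorm_ne_top).1 (hint 0 (-Real.pi))
  have hbound : ∀ t : ℝ, 0 < |t| → |t| ≤ Real.pi → g t ≤ 2 * N * |t| ^ (-(1 / 2) : ℝ) := by
    intro t h0 ht
    have h1 := norm_sub_le_sqrt_abs hN hE w ht
    have h2 := abs_le_norm_mul_exp_sub_self w ht
    rw [hg]
    simp only
    rw [norm_div, div_le_iff₀ (by linarith)]
    refine h1.trans ?_
    rw [Real.rpow_neg (abs_nonneg t), ← Real.sqrt_eq_rpow]
    have hs : 0 < √|t| := Real.sqrt_pos.2 h0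
    have hss : √|t| * √|t| = |t| := Real.mul_self_sqrt (abs_nonneg t)
    rw [show 2 * N * (√|t|)⁻¹ * ‖((w * Circle.exp t : Circle) : ℂ) - w‖
      = N * (2 * ‖((w * Circle.exp t : Circle) : ℂ) - w‖) / √|t| by field_simp, le_div_iff₀ hs,
      mul_assoc, hss]
    exact mul_le_mul_of_nonneg_left h2 hN.le
  have h1 : ∫ t in (-Real.pi)..Real.pi, g t = ∫ t in (0 : ℝ)..Real.pi, (g t + g (-t)) := by
    rw [← intervalIntegral.integral_add_adjacent_intervals (hint (-Real.pi) 0) (hint 0 Real.pi),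
      intervalIntegral.integral_add (hint _ _) hneg, intervalIntegral.integral_comp_neg, neg_zero,
      add_comm]
  have h2 : ∫ t in (0 : ℝ)..Real.pi, (g t + g (-t))
      ≤ ∫ t in (0 : ℝ)..Real.pi, 4 * N * t ^ (-(1 / 2) : ℝ) := by
    refine intervalIntegral.integral_mono_on_of_le_Ioo hpi.le ((hint _ _).add hneg)
      ((intervalIntegral.intervalIntegrable_rpow' (by norm_num)).const_mul _) fun t ht => ?_
    · have e : |t| = t := abs_of_pos ht.1
      have h3 := hbound t (by rw [e]; exact ht.1) (by rw [e]; exact ht.2.le)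
      have h4 := hbound (-t) (by rw [abs_neg, e]; exact ht.1) (by rw [abs_neg, e]; exact ht.2.le)
      rw [abs_neg, e] at h4
      rw [e] at h3
      linarith
  rw [intervalIntegral.integral_const_mul, integral_rpow (Or.inl (by norm_num))] at h2
  have h5 := integral_comp_mul_exp (fun τ => ‖(u τ - u w) / ((τ : ℂ) - w)‖) w (-Real.pi)
  rw [show -Real.pi + 2 * Real.pi = Real.pi by ring] at h5
  rw [← h5]
  change ∫ t in (-Real.pi)..Real.pi, g t ≤ _
  rw [h1]
  refine h2.trans ?_
  have h6 : Real.pi ^ (-(1 / 2) + 1 : ℝ) ≤ 2 := by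
    rw [show (-(1 / 2) + 1 : ℝ) = 1 / 2 by norm_num, ← Real.sqrt_eq_rpow,
      Real.sqrt_le_left (by norm_num)]
    linarith [Real.pi_lt_four]
  rw [Real.zero_rpow (by norm_num), sub_zero]
  norm_num at h6 ⊢
  nlinarith

end Energy

end VortexPair

end

noncomputable section

namespace VortexPair

/-! ### Lipschitz estimates for pairs of states -/

open MeasureTheory

/-- The two-valued families `F` over `σ` that are uniformly bounded and whose two values differ by
at most a constant times `η`. -/
def LipBound {σ : Type*} (η : σ → ℝ) (F : σ → Bool → ℂ) : Prop :=
  ∃ M, 0 ≤ M ∧ ∀ s, (∀ i, ‖F s i‖ ≤ M) ∧ ‖F s true - F s false‖ ≤ M * η s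

namespace LipBound

variable {σ : Type*} {η η' : σ → ℝ} {F G : σ → Bool → ℂ}

lemma add (hF : LipBound η F) (hG : LipBound η G) : LipBound η fun s i => F s i + G s i := by
  obtain ⟨M, hM, hF⟩ := hF
  obtain ⟨L, hL, hG⟩ := hG
  refine ⟨M + L, by positivity, fun s => ⟨fun i => ?_, ?_⟩⟩
  · exact (norm_add_le _ _).trans (add_le_add ((hF s).1 i) ((hG s).1 i))
  · rw [add_sub_add_comm, add_mul]
    exact (norm_add_le _ _).trans (add_le_add (hF s).2 (hG s).2)

lemma neg (hF : LipBound η F) : LipBound η fun s i => -F s i := by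
  obtain ⟨M, hM, hF⟩ := hF
  refine ⟨M, hM, fun s => ⟨fun i => ?_, ?_⟩⟩
  · rw [norm_neg]
    exact (hF s).1 i
  · rw [neg_sub_neg, norm_sub_rev]
    exact (hF s).2

lemma sub (hF : LipBound η F) (hG : LipBound η G) : LipBound η fun s i => F s i - G s i := by
  simpa only [sub_eq_add_neg] using hF.add hG.neg

lemma mul (hF : LipBound η F) (hG : LipBound η G) : LipBound η fun s i => F s i * G s i := by
  obtain ⟨M, hM, hF⟩ := hF
  obtain ⟨L, hL, hG⟩ := hG
  refine ⟨2 * (M * L), by positivity, fun s => ⟨fun i => ?_, ?_⟩⟩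
  · rw [norm_mul]
    have := mul_le_mul ((hF s).1 i) ((hG s).1 i) (norm_nonneg _) hM
    have : 0 ≤ M * L := by positivity
    linarith
  · have e : F s true * G s true - F s false * G s false
        = F s true * (G s true - G s false) + (F s true - F s false) * G s false := by ring
    have h1 := mul_le_mul ((hF s).1 true) (hG s).2 (norm_nonneg _) hM
    have h2 := mul_le_mul (hF s).2 ((hG s).1 false) (norm_nonneg _)
      ((norm_nonneg _).trans (hF s).2)
    rw [e]
    refine (norm_add_le _ _).trans ?_
    rw [norm_mul, norm_mul]
    linarith

lemma conjugate (hF : LipBound η F) : LipBound η fun s i => conj (F s i) := by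
  obtain ⟨M, hM, hF⟩ := hF
  refine ⟨M, hM, fun s => ⟨fun i => ?_, ?_⟩⟩
  · rw [RCLike.norm_conj]
    exact (hF s).1 i
  · rw [← map_sub, RCLike.norm_conj]
    exact (hF s).2

lemma of_eq {c : σ → ℂ} {M : ℝ} (hη : ∀ s, 0 ≤ η s) (hc : ∀ s, ‖c s‖ ≤ M) :
    LipBound η fun s _ => c s := by
  refine ⟨max M 0, le_max_right _ _, fun s => ⟨fun i => (hc s).trans (le_max_left _ _), ?_⟩⟩
  rw [sub_self, norm_zero]
  exact mul_nonneg (le_max_right _ _) (hη s)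

lemma const (hη : ∀ s, 0 ≤ η s) (c : ℂ) : LipBound η fun (_ : σ) _ => c :=
  of_eq hη fun _ => le_rfl

lemma inv (hη : ∀ s, 0 ≤ η s) (hF : LipBound η F) {m : ℝ} (hm : 0 < m)
    (h : ∀ s i, m ≤ ‖F s i‖) : LipBound η fun s i => (F s i)⁻¹ := by
  obtain ⟨M, hM, hF⟩ := hF
  have h0 : ∀ s i, F s i ≠ 0 := fun s i => norm_pos_iff.1 (hm.trans_le (h s i))
  refine ⟨m⁻¹ + M / m ^ 2, by positivity, fun s => ⟨fun i => ?_, ?_⟩⟩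
  · rw [norm_inv]
    have h1 : ‖F s i‖⁻¹ ≤ m⁻¹ := inv_anti₀ hm (h s i)
    have : 0 ≤ M / m ^ 2 := by positivity
    linarith
  · rw [inv_sub_inv (h0 s _) (h0 s _), norm_div, norm_mul, norm_sub_rev]
    have h1 : m ^ 2 ≤ ‖F s true‖ * ‖F s false‖ := by
      rw [sq]
      exact mul_le_mul (h s true) (h s false) hm.le (norm_nonneg _)
    have h2 := div_le_div₀ ((norm_nonneg _).trans (hF s).2) (hF s).2 (by positivity) h1
    have h3 : 0 ≤ m⁻¹ * η s := mul_nonneg (by positivity) (hη s)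
    rw [add_mul]
    have h4 : M * η s / m ^ 2 = M / m ^ 2 * η s := by ring
    linarith

lemma mono (hF : LipBound η F) {C : ℝ} (hC : 0 ≤ C) (h : ∀ s, η s ≤ C * η' s)
    (hη' : ∀ s, 0 ≤ η' s) : LipBound η' F := by
  obtain ⟨M, hM, hF⟩ := hF
  refine ⟨M + M * C, by positivity, fun s => ⟨fun i => ((hF s).1 i).trans ?_,
    (hF s).2.trans ?_⟩⟩
  · have : 0 ≤ M * C := by positivity
    linarith
  · have h1 := mul_le_mul_of_nonneg_left (h s) hM
    have h2 : 0 ≤ M * η' s := mul_nonneg hM (hη' s)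
    linarith

/-- A small factor improves the estimate of the difference. -/
lemma mul_small {κ : σ → ℂ} (hκ : ∀ s, ‖κ s‖ ≤ 1) (hF : LipBound η F) :
    LipBound (fun s => ‖κ s‖ * η s) fun s i => κ s * F s i := by
  obtain ⟨M, hM, hF⟩ := hF
  refine ⟨M, hM, fun s => ⟨fun i => ?_, ?_⟩⟩
  · rw [norm_mul]
    have := mul_le_mul (hκ s) ((hF s).1 i) (norm_nonneg _) zero_le_one
    linarith
  · rw [← mul_sub, norm_mul]
    have := mul_le_mul_of_nonneg_left (hF s).2 (norm_nonneg (κ s))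
    linarith

/-- The weight `η₂` may depend on `τ`: only its integral enters. This is how the energy, which does
not bound `u'` pointwise, still controls the integrals. -/
lemma mean {η₂ : σ × Circle → ℝ} {F : σ × Circle → Bool → ℂ} (hF : LipBound η₂ F) {C : ℝ}
    (hC : 0 ≤ C) (hη : ∀ s, 0 ≤ η s)
    (hη₂ : ∀ s, IntervalIntegrable (fun θ => η₂ (s, Circle.exp θ)) volume 0 (2 * Real.pi))
    (hint : ∀ s, ∫ θ in (0 : ℝ)..(2 * Real.pi), η₂ (s, Circle.exp θ) ≤ C * η s)
    (hmeas : ∀ s i, Measurable fun θ : ℝ => F (s, Circle.exp θ) i) :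
    LipBound η fun s i => circleMean fun τ => F (s, τ) i := by
  obtain ⟨M, hM, hF⟩ := hF
  have hpi := Real.pi_pos
  have hpi3 := Real.pi_gt_three
  have hn : ‖(1 / (2 * (Real.pi : ℂ) * I))‖ ≤ 1 := by
    simp only [norm_div, norm_mul, norm_I, norm_real, Real.norm_eq_abs, norm_one, mul_one,
      Complex.norm_ofNat, abs_of_pos hpi]
    rw [div_le_one (by positivity)]
    linarith
  have hInt : ∀ s i, IntervalIntegrable (fun θ : ℝ => F (s, Circle.exp θ) i
      * (I * (Circle.exp θ : ℂ))) volume 0 (2 * Real.pi) := fun s i => by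
    refine (intervalIntegrable_const (c := M)).mono_fun ?_ (ae_of_all _ fun θ => ?_)
    · exact ((hmeas s i).mul (by fun_prop : Continuous fun θ : ℝ =>
        I * (Circle.exp θ : ℂ)).measurable).aestronglyMeasurable
    · beta_reduce
      rw [norm_mul, norm_mul, norm_I, Circle.norm_coe, mul_one, mul_one, Real.norm_eq_abs,
        abs_of_nonneg hM]
      exact (hF _).1 i
  refine ⟨M + M * C, by positivity, fun s => ⟨fun i => ?_, ?_⟩⟩
  · refine (norm_circleMean_le fun τ => (hF (s, τ)).1 i).trans ?_
    have : 0 ≤ M * C := by positivity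
    linarith
  · simp only [circleMean]
    rw [← mul_sub,
      ← intervalIntegral.integral_sub (hInt s true) (hInt s false), norm_mul]
    have h1 := intervalIntegral.norm_integral_le_of_norm_le (μ := volume)
      (by positivity : 0 ≤ 2 * Real.pi) (f := fun θ : ℝ =>
        F (s, Circle.exp θ) true * (I * (Circle.exp θ : ℂ))
          - F (s, Circle.exp θ) false * (I * (Circle.exp θ : ℂ)))
      (g := fun θ => M * η₂ (s, Circle.exp θ)) (ae_of_all _ fun θ _ => by
        rw [← sub_mul, norm_mul, norm_mul, norm_I, Circle.norm_coe, mul_one, mul_one]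
        exact (hF _).2) ((hη₂ s).const_mul M)
    rw [intervalIntegral.integral_const_mul] at h1
    have h2 := mul_le_mul_of_nonneg_left (hint s) hM
    have h3 := mul_le_mul hn le_rfl (norm_nonneg (∫ θ in (0 : ℝ)..(2 * Real.pi),
        F (s, Circle.exp θ) true * (I * (Circle.exp θ : ℂ))
          - F (s, Circle.exp θ) false * (I * (Circle.exp θ : ℂ)))) zero_le_one
    have h4 : 0 ≤ M * η s := mul_nonneg hM (hη s)
    linarith

end LipBound

end VortexPair

end

noncomputable section

namespace VortexPair

/-! ### The contour functional at a pair of states -/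

open MeasureTheory

lemma LipBound.congr {σ : Type*} {η : σ → ℝ} {F G : σ → Bool → ℂ} (hF : LipBound η F)
    (h : ∀ s i, F s i = G s i) : LipBound η G := by
  have : F = G := funext fun s => funext fun i => h s i
  rwa [← this]

/-- Two bounded states `(Ω, Z, f)` at the same `ε`, whose distance in the energy norm is at
most `N`. -/
structure StatePair (α r R : ℝ) where
  /-- the common parameter -/
  ε : ℝ
  /-- a bound for the distance -/
  N : ℝ
  /-- the angular velocities -/
  Ω : Bool → ℝ
  /-- the centres of rotation -/
  Z : Bool → ℝ
  /-- the perturbations of the patches -/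
  f : Bool → Fin 2 → HolderX α
  abs_ε_le : |ε| ≤ r
  N_pos : 0 < N
  abs_Ω_le : ∀ i, |Ω i| ≤ R
  abs_Z_le : ∀ i, |Z i| ≤ R
  norm_f_le : ∀ i j, ‖f i j‖ ≤ 1
  abs_Ω_sub_le : |Ω true - Ω false| ≤ N
  abs_Z_sub_le : |Z true - Z false| ≤ N
  energy_le : ∀ j, energy (f true j - f false j) ≤ N ^ 2

namespace StatePair

variable {r R : ℝ}

/-- The difference of the perturbations of the `j`-th patch. -/
def diff (s : StatePair α r R) (j : Fin 2) : HolderX α := s.f true j - s.f false j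

/-- The weight of the estimates of functions of `τ` and `w`. -/
def weight (j : Fin 2) (x : (StatePair α r R × Circle) × Circle) : ℝ :=
  x.1.1.N + ‖circleDeriv (x.1.1.diff j) x.2‖
    + ‖(x.1.1.diff j x.2 - x.1.1.diff j x.1.2) / ((x.2 : ℂ) - x.1.2)‖

lemma weight_nonneg (j : Fin 2) (x : (StatePair α r R × Circle) × Circle) : 0 ≤ weight j x := by
  have := x.1.1.N_pos
  unfold weight
  positivity

lemma N_le_weight (j : Fin 2) (x : (StatePair α r R × Circle) × Circle) :
    x.1.1.N ≤ weight j x := by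
  unfold weight
  rw [add_assoc]
  exact le_add_of_nonneg_right (by positivity)

lemma norm_circleDeriv_le_weight (j : Fin 2) (x : (StatePair α r R × Circle) × Circle) :
    ‖circleDeriv (x.1.1.diff j) x.2‖ ≤ weight j x := by
  have := x.1.1.N_pos
  unfold weight
  rw [add_right_comm]
  exact le_add_of_nonneg_left (by positivity)

lemma norm_quot_le_weight (j : Fin 2) (x : (StatePair α r R × Circle) × Circle) :
    ‖(x.1.1.diff j x.2 - x.1.1.diff j x.1.2) / ((x.2 : ℂ) - x.1.2)‖ ≤ weight j x := by
  have := x.1.1.N_pos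
  unfold weight
  exact le_add_of_nonneg_left (by positivity)

lemma intervalIntegrable_weight (j : Fin 2) (x : StatePair α r R × Circle) :
    IntervalIntegrable (fun θ => weight j (x, Circle.exp θ)) volume 0 (2 * Real.pi) := by
  have h := (x.1.diff j).continuous_circleDeriv
  have h1 := (x.1.diff j).intervalIntegrable_quot x.2 0 (2 * Real.pi) 1
  simp only [one_mul] at h1
  exact ((Continuous.intervalIntegrable (by fun_prop) _ _ :
    IntervalIntegrable (fun θ : ℝ => x.1.N + ‖circleDeriv (x.1.diff j) (Circle.exp θ)‖)
      volume 0 (2 * Real.pi))).add h1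

lemma integral_weight_le (j : Fin 2) (x : StatePair α r R × Circle) :
    ∫ θ in (0 : ℝ)..(2 * Real.pi), weight j (x, Circle.exp θ) ≤ 29 * x.1.N := by
  have h := (x.1.diff j).continuous_circleDeriv
  have h1 := (x.1.diff j).intervalIntegrable_quot x.2 0 (2 * Real.pi) 1
  simp only [one_mul] at h1
  have h2 := integral_norm_circleDeriv_le x.1.N_pos (x.1.energy_le j)
  have h3 := integral_norm_quot_le x.1.N_pos (x.1.energy_le j) x.2
  simp only [weight]
  rw [intervalIntegral.integral_add (Continuous.intervalIntegrable (by fun_prop) _ _) h1,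
    intervalIntegral.integral_add (Continuous.intervalIntegrable (by fun_prop) _ _)
      (Continuous.intervalIntegrable (by fun_prop) _ _), intervalIntegral.integral_const,
    smul_eq_mul, sub_zero]
  have hpi := Real.pi_lt_four
  have hN := x.1.N_pos
  have h4 : 2 * Real.pi * x.1.N ≤ 8 * x.1.N := by nlinarith
  change _ + (∫ θ in (0 : ℝ)..(2 * Real.pi), ‖circleDeriv (x.1.diff j) (Circle.exp θ)‖) +
    (∫ θ in (0 : ℝ)..(2 * Real.pi),
      ‖(x.1.diff j (Circle.exp θ) - x.1.diff j x.2) / ((Circle.exp θ : ℂ) - x.2)‖) ≤ _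
  change (∫ θ in (0 : ℝ)..(2 * Real.pi), ‖circleDeriv (x.1.diff j) (Circle.exp θ)‖) ≤ _ at h2
  change (∫ θ in (0 : ℝ)..(2 * Real.pi),
      ‖(x.1.diff j (Circle.exp θ) - x.1.diff j x.2) / ((Circle.exp θ : ℂ) - x.2)‖) ≤ _ at h3
  linarith

section Atoms

variable {σ : Type*} {η : σ → ℝ} (p : σ → StatePair α r R) (q : σ → Circle) (j : Fin 2)

lemma lipBound_apply (hη : ∀ s, (p s).N ≤ η s) : LipBound η fun s i => (p s).f i j (q s) := by
  refine ⟨3, by norm_num, fun s => ⟨fun i => ?_, ?_⟩⟩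
  · have := ((p s).f i j).norm_apply_le (q s)
    linarith [(p s).norm_f_le i j]
  · refine (norm_le_of_energy_le (p s).N_pos ((p s).energy_le j) (q s)).trans ?_
    linarith [hη s]

lemma lipBound_circleDeriv (hη : ∀ s, ‖circleDeriv ((p s).diff j) (q s)‖ ≤ η s) :
    LipBound η fun s i => circleDeriv ((p s).f i j) (q s) := by
  refine ⟨1, zero_le_one, fun s => ⟨fun i => ?_, ?_⟩⟩
  · exact (((p s).f i j).norm_circleDeriv_le (q s)).trans ((p s).norm_f_le i j)
  · rw [← circleDeriv_sub, one_mul]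
    exact hη s

lemma norm_quot_le (s : StatePair α r R) (i : Bool) (τ w : Circle) :
    ‖(s.f i j τ - s.f i j w) / ((τ : ℂ) - w)‖ ≤ 2 := by
  have := (s.f i j).norm_quot_le τ w
  linarith [s.norm_f_le i j]

lemma lipBound_quot (q' : σ → Circle)
    (hη : ∀ s, ‖((p s).diff j (q s) - (p s).diff j (q' s)) / ((q s : ℂ) - q' s)‖ ≤ η s) :
    LipBound η fun s i => ((p s).f i j (q s) - (p s).f i j (q' s)) / ((q s : ℂ) - q' s) := by
  refine ⟨2, zero_le_two, fun s => ⟨fun i => norm_quot_le j _ _ _ _, ?_⟩⟩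
  rw [← sub_div, sub_sub_sub_comm]
  have h0 := (norm_nonneg _).trans (hη s)
  exact (hη s).trans (by linarith)

lemma lipBound_Ω (hη : ∀ s, (p s).N ≤ η s) : LipBound η fun s i => ((p s).Ω i : ℂ) := by
  refine ⟨max R 1, by positivity, fun s => ⟨fun i => ?_, ?_⟩⟩
  · rw [norm_real]
    exact ((p s).abs_Ω_le i).trans (le_max_left _ _)
  · rw [← ofReal_sub, norm_real]
    refine ((p s).abs_Ω_sub_le.trans (hη s)).trans ?_
    have h0 := ((p s).N_pos.le.trans (hη s))
    have := le_max_right R 1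
    nlinarith

lemma lipBound_Z (hη : ∀ s, (p s).N ≤ η s) : LipBound η fun s i => ((p s).Z i : ℂ) := by
  refine ⟨max R 1, by positivity, fun s => ⟨fun i => ?_, ?_⟩⟩
  · rw [norm_real]
    exact ((p s).abs_Z_le i).trans (le_max_left _ _)
  · rw [← ofReal_sub, norm_real]
    refine ((p s).abs_Z_sub_le.trans (hη s)).trans ?_
    have h0 := ((p s).N_pos.le.trans (hη s))
    have := le_max_right R 1
    nlinarith

lemma lipBound_coe (hη : ∀ s, 0 ≤ η s) : LipBound η fun s _ => ((q s : Circle) : ℂ) :=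
  LipBound.of_eq hη fun s => (Circle.norm_coe (q s)).le

lemma lipBound_ε (hη : ∀ s, 0 ≤ η s) : LipBound η fun s _ => ((p s).ε : ℂ) :=
  LipBound.of_eq (M := r) hη fun s => by
    rw [norm_real]
    exact (p s).abs_ε_le

end Atoms

/-- The right side is a product of bounded factors in `B / A` and `D`, to which the Lipschitz
calculus applies. For `A = 0` both sides are `0`. -/
lemma kernel_eq (A B D δ : ℂ) :
    (A * conj B - conj A * B) / (A * (A + δ * B)) * (D - B / A)
      = conj A / A * (conj (B / A) - B / A) * (1 + δ * (B / A))⁻¹ * (D - B / A) := by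
  rcases eq_or_ne A 0 with rfl | hA
  · simp
  have hA' : conj A ≠ 0 := (map_ne_zero _).2 hA
  congr 1
  have e : A + δ * B = A * (1 + δ * (B / A)) := by field_simp
  rw [e, div_eq_mul_inv, mul_inv, mul_inv, map_div₀]
  field_simp

variable {b : Fin 2 → ℝ} {d : ℝ}

lemma half_le_norm (hb : ∀ j, 0 < b j) (hrb : ∀ j, r * b j ≤ 1 / 4)
    (s : StatePair α r R) (i : Bool) (j : Fin 2) (τ w : Circle) :
    1 / 2 ≤ ‖1 + (s.ε * b j : ℂ) * ((s.f i j τ - s.f i j w) / ((τ : ℂ) - w))‖ := by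
  have h1 := norm_quot_le j s i τ w
  have h2 := norm_sub_le_norm_add (1 : ℂ)
    ((s.ε * b j : ℂ) * ((s.f i j τ - s.f i j w) / ((τ : ℂ) - w)))
  rw [norm_one, norm_mul, norm_mul, norm_real, norm_real, Real.norm_eq_abs, Real.norm_eq_abs,
    abs_of_pos (hb j)] at h2
  have h3 := mul_le_mul_of_nonneg_right s.abs_ε_le (hb j).le
  have h4 := mul_le_mul (h3.trans (hrb j)) h1 (norm_nonneg _) (by norm_num)
  linarith

lemma half_le_norm_den (hr : r ≤ 1 / 2) (hb : ∀ j, 0 < b j) (hrb : ∀ j, r * b j ≤ 1 / 4)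
    (hd : 2 * (b 0 + b 1) < d)
    (s : StatePair α r R) (i : Bool) (j : Fin 2) (τ w : Circle) :
    d / 4 ≤ ‖(s.ε : ℂ) * (b (1 - j) * τ + b j * w)
      + s.ε ^ 2 * (b (1 - j) ^ 2 * s.f i (1 - j) τ + b j ^ 2 * s.f i j w) - d‖ := by
  have hsum : b (1 - j) + b j = b 0 + b 1 := by
    fin_cases j <;> simp [add_comm]
  have hd0 : 0 < d := by linarith [hb 0, hb 1]
  have hε := s.abs_ε_le.trans hr
  have hnorm : ∀ (k : Fin 2) (v : Circle), ‖s.f i k v‖ ≤ 1 := fun k v =>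
    ((s.f i k).norm_apply_le v).trans (s.norm_f_le i k)
  have hk : ∀ k, |s.ε| * b k ≤ 1 / 4 := fun k =>
    (mul_le_mul_of_nonneg_right s.abs_ε_le (hb k).le).trans (hrb k)
  -- Here `5/8 = 1/2 + 1/4 · 1/2`; the two terms together stay below `5d / 16`, since `b 0 + b 1 < d
  -- / 2`.
  have hterm : ∀ (k : Fin 2) (v : Circle),
      ‖(s.ε : ℂ) * b k * v + (s.ε * b k) ^ 2 * s.f i k v‖ ≤ 5 / 8 * b k := by
    intro k v
    refine (norm_add_le _ _).trans ?_
    rw [norm_mul, norm_mul, norm_mul, norm_pow, norm_mul, norm_real, norm_real, Circle.norm_coe,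
      Real.norm_eq_abs, Real.norm_eq_abs, abs_of_pos (hb k), mul_one]
    have h1 : |s.ε| * b k ≤ 1 / 2 * b k := mul_le_mul_of_nonneg_right hε (hb k).le
    have h0 : 0 ≤ |s.ε| * b k := mul_nonneg (abs_nonneg _) (hb k).le
    have h2 : (|s.ε| * b k) ^ 2 * ‖s.f i k v‖ ≤ (|s.ε| * b k) ^ 2 :=
      mul_le_of_le_one_right (sq_nonneg _) (hnorm k v)
    have h3 : (|s.ε| * b k) ^ 2 ≤ 1 / 4 * (|s.ε| * b k) := by
      rw [sq]
      exact mul_le_mul_of_nonneg_right (hk k) h0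
    linarith
  have e : (s.ε : ℂ) * (b (1 - j) * τ + b j * w)
      + s.ε ^ 2 * (b (1 - j) ^ 2 * s.f i (1 - j) τ + b j ^ 2 * s.f i j w) - d
      = -((d : ℂ) - (((s.ε : ℂ) * b (1 - j) * τ + (s.ε * b (1 - j)) ^ 2 * s.f i (1 - j) τ)
        + ((s.ε : ℂ) * b j * w + (s.ε * b j) ^ 2 * s.f i j w))) := by ring
  rw [e, norm_neg]
  have h1 := norm_sub_norm_le (d : ℂ)
    (((s.ε : ℂ) * b (1 - j) * τ + (s.ε * b (1 - j)) ^ 2 * s.f i (1 - j) τ)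
        + ((s.ε : ℂ) * b j * w + (s.ε * b j) ^ 2 * s.f i j w))
  rw [norm_real, Real.norm_eq_abs, abs_of_pos hd0] at h1
  have h2 := (norm_add_le ((s.ε : ℂ) * b (1 - j) * τ + (s.ε * b (1 - j)) ^ 2 * s.f i (1 - j) τ)
    ((s.ε : ℂ) * b j * w + (s.ε * b j) ^ 2 * s.f i j w)).trans
    (add_le_add (hterm (1 - j) τ) (hterm j w))
  linarith

/-- The integrand of the self-interaction. -/
def kernel (δ : ℂ) (f : HolderX α) (w τ : Circle) : ℂ :=
  (((τ : ℂ) - w) * conj (f τ - f w) - conj ((τ : ℂ) - w) * (f τ - f w))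
    / (((τ : ℂ) - w) * (((τ : ℂ) - w) + δ * (f τ - f w)))
    * (circleDeriv f τ - (f τ - f w) / ((τ : ℂ) - w))

lemma lipBound_kernel (hb : ∀ j, 0 < b j) (hrb : ∀ j, r * b j ≤ 1 / 4)
    (j : Fin 2) : LipBound (fun x : StatePair α r R × Circle => x.1.N) fun x i =>
      circleMean fun τ => kernel (x.1.ε * b j) (x.1.f i j) x.2 τ := by
  have hη := weight_nonneg (α := α) (r := r) (R := R) j
  have hq := lipBound_quot (fun x : (StatePair α r R × Circle) × Circle => x.1.1) (fun x => x.2) j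
    (fun x => x.1.2) (norm_quot_le_weight j)
  have hD := lipBound_circleDeriv (fun x : (StatePair α r R × Circle) × Circle => x.1.1)
    (fun x => x.2) j (norm_circleDeriv_le_weight j)
  have hm : LipBound (weight (α := α) (r := r) (R := R) j) fun x _ =>
      conj ((x.2 : ℂ) - x.1.2) / ((x.2 : ℂ) - x.1.2) :=
    LipBound.of_eq hη (M := 1) fun x => by
      rw [norm_div, RCLike.norm_conj]
      exact div_self_le_one _
  have hδ : LipBound (weight (α := α) (r := r) (R := R) j) fun x _ => (x.1.1.ε * b j : ℂ) :=
    (lipBound_ε (fun x => x.1.1) hη).mul (LipBound.const hη _)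
  have hden := ((LipBound.const hη 1).add (hδ.mul hq)).inv hη (m := 1 / 2) (by norm_num)
    fun x i => half_le_norm hb hrb x.1.1 i j x.2 x.1.2
  have hK := (((hm.mul (hq.conjugate.sub hq)).mul hden).mul (hD.sub hq)).congr
    (G := fun x i => kernel (x.1.1.ε * b j) (x.1.1.f i j) x.1.2 x.2)
    fun x i => by rw [kernel, kernel_eq]
  refine hK.mean (by norm_num) (fun x => x.1.N_pos.le) (intervalIntegrable_weight j)
    (integral_weight_le j) fun x i => ?_
  have h1 := (x.1.f i j).continuous
  have h2 := (x.1.f i j).continuous_circleDeriv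
  refine Measurable.mul (Measurable.div (Continuous.measurable ?_) (Continuous.measurable ?_))
    (Measurable.sub (Continuous.measurable ?_)
      (Measurable.div (Continuous.measurable ?_) (Continuous.measurable ?_)))
  all_goals
    dsimp only
    fun_prop

/-- The extra factor `ε` in the estimate is available because the integrand does not depend on the
state when `ε = 0`. -/
lemma lipBound_interaction (hr : r ≤ 1 / 2) (hb : ∀ j, 0 < b j) (hrb : ∀ j, r * b j ≤ 1 / 4)
    (hd : 2 * (b 0 + b 1) < d) (j : Fin 2) :
    LipBound (fun x : StatePair α r R × Circle => ‖(x.1.ε : ℂ)‖ * x.1.N) fun x i =>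
      circleMean fun τ =>
        (conj (τ : ℂ) + x.1.ε * b (1 - j) * conj (x.1.f i (1 - j) τ))
            * (1 + x.1.ε * b (1 - j) * circleDeriv (x.1.f i (1 - j)) τ)
          / (x.1.ε * (b (1 - j) * τ + b j * x.2)
            + x.1.ε ^ 2 * (b (1 - j) ^ 2 * x.1.f i (1 - j) τ + b j ^ 2 * x.1.f i j x.2) - d) := by
  have hd0 : 0 < d := by linarith [hb 0, hb 1]
  have hη := weight_nonneg (α := α) (r := r) (R := R) (1 - j)
  have hηN := N_le_weight (α := α) (r := r) (R := R) (1 - j)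
  have hε : ∀ x : (StatePair α r R × Circle) × Circle, ‖(x.1.1.ε : ℂ)‖ ≤ 1 := fun x => by
    rw [norm_real]
    exact (x.1.1.abs_ε_le.trans hr).trans (by norm_num)
  have hηε : ∀ x : (StatePair α r R × Circle) × Circle,
      0 ≤ ‖(x.1.1.ε : ℂ)‖ * weight (1 - j) x := fun x => mul_nonneg (norm_nonneg _) (hη x)
  have hf := lipBound_apply (fun x : (StatePair α r R × Circle) × Circle => x.1.1) (fun x => x.2)
    (1 - j) hηN
  have hfw := lipBound_apply (fun x : (StatePair α r R × Circle) × Circle => x.1.1)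
    (fun x => x.1.2) j hηN
  have hD := lipBound_circleDeriv (fun x : (StatePair α r R × Circle) × Circle => x.1.1)
    (fun x => x.2) (1 - j) (norm_circleDeriv_le_weight (1 - j))
  have hτ := lipBound_coe (fun x : (StatePair α r R × Circle) × Circle => x.2) hη
  have hw := lipBound_coe (fun x : (StatePair α r R × Circle) × Circle => x.1.2) hη
  have hc := fun c : ℂ => LipBound.const hη c
  have hεη := lipBound_ε (fun x : (StatePair α r R × Circle) × Circle => x.1.1) hη
  have hτε := lipBound_coe (fun x : (StatePair α r R × Circle) × Circle => x.2) hηε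
  have hnum := (hτε.conjugate.add (((hc (b (1 - j))).mul hf.conjugate).mul_small hε)).mul
    ((LipBound.const hηε 1).add (((hc (b (1 - j))).mul hD).mul_small hε))
  have hden : LipBound (fun x : (StatePair α r R × Circle) × Circle => ‖(x.1.1.ε : ℂ)‖ * weight (1 - j) x)
      fun (x : (StatePair α r R × Circle) × Circle) i =>
        (x.1.1.ε : ℂ) * (b (1 - j) * x.2 + b j * x.1.2)
      + x.1.1.ε ^ 2 * (b (1 - j) ^ 2 * x.1.1.f i (1 - j) x.2 + b j ^ 2 * x.1.1.f i j x.1.2) - d :=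
    ((((((hc (b (1 - j))).mul hτ).add ((hc (b j)).mul hw)).add
    (hεη.mul (((hc (b (1 - j) ^ 2)).mul hf).add ((hc (b j ^ 2)).mul hfw)))).mul_small hε).sub
      (LipBound.const hηε d)).congr fun x i => by ring
  have hI := (hnum.mul (hden.inv hηε (m := d / 4) (by positivity)
    fun (x : (StatePair α r R × Circle) × Circle) i => half_le_norm_den hr hb hrb hd x.1.1 i j x.2 x.1.2)).congr
    (G := fun (x : (StatePair α r R × Circle) × Circle) i => (conj (x.2 : ℂ) + x.1.1.ε * b (1 - j) * conj (x.1.1.f i (1 - j) x.2))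
            * (1 + x.1.1.ε * b (1 - j) * circleDeriv (x.1.1.f i (1 - j)) x.2)
          / (x.1.1.ε * (b (1 - j) * x.2 + b j * x.1.2)
            + x.1.1.ε ^ 2 * (b (1 - j) ^ 2 * x.1.1.f i (1 - j) x.2 + b j ^ 2 * x.1.1.f i j x.1.2) - d))
    fun x i => by rw [div_eq_mul_inv]; simp only [mul_assoc]
  refine hI.mean (C := 29) (by norm_num) (fun x => mul_nonneg (norm_nonneg _) x.1.N_pos.le)
    (fun x => (intervalIntegrable_weight (1 - j) x).const_mul ‖(x.1.ε : ℂ)‖) (fun x => ?_) fun x i => ?_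
  · simp only [intervalIntegral.integral_const_mul]
    rw [mul_left_comm]
    exact mul_le_mul_of_nonneg_left (integral_weight_le (1 - j) x) (norm_nonneg _)
  · have h1 := (x.1.f i (1 - j)).continuous
    have h2 := (x.1.f i (1 - j)).continuous_circleDeriv
    refine Measurable.div (Continuous.measurable ?_) (Continuous.measurable ?_)
    all_goals
      dsimp only
      fun_prop

end StatePair

end VortexPair

end

noncomputable section

namespace VortexPair

/-! ### Uniqueness for small `ε` -/

open MeasureTheory

namespace StatePair

variable {r R : ℝ} {b γ : Fin 2 → ℝ} {d : ℝ}

/-- The part of the contour functional that is small for small `ε`. -/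
def remainder (b γ : Fin 2 → ℝ) (d : ℝ) (j : Fin 2) (x : StatePair α r R × Circle) (i : Bool) : ℂ :=
  x.1.ε * (2 * x.1.Ω i * (b j * (conj (x.2 : ℂ) + x.1.ε * (b j * conj (x.1.f i j x.2)))) * x.2
      * (1 + x.1.ε * (b j * circleDeriv (x.1.f i j) x.2)))
    + x.1.ε * (2 * x.1.Ω i * ((-1) ^ ((j : ℕ) + 1) * x.1.Z i - ((j : ℕ) : ℂ) * (d : ℂ)) * x.2
      * (b j * circleDeriv (x.1.f i j) x.2))
    + x.1.ε * (b j * γ j * x.2 * (1 + x.1.ε * (b j * circleDeriv (x.1.f i j) x.2))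
      * circleMean fun τ => kernel (x.1.ε * b j) (x.1.f i j) x.2 τ)
    - γ (1 - j) * x.2 * (1 + x.1.ε * (b j * circleDeriv (x.1.f i j) x.2))
      * circleMean fun τ =>
        (conj (τ : ℂ) + x.1.ε * b (1 - j) * conj (x.1.f i (1 - j) τ))
            * (1 + x.1.ε * b (1 - j) * circleDeriv (x.1.f i (1 - j)) τ)
          / (x.1.ε * (b (1 - j) * τ + b j * x.2)
            + x.1.ε ^ 2 * (b (1 - j) ^ 2 * x.1.f i (1 - j) τ + b j ^ 2 * x.1.f i j x.2) - d)

lemma contourF_eq (s : StatePair α r R) (i : Bool) (j : Fin 2) (w : Circle) :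
    contourF b γ d s.ε (s.Ω i) (s.Z i) (s.f i) j w
      = (2 * s.Ω i * ((-1) ^ ((j : ℕ) + 1) * s.Z i - ((j : ℕ) : ℂ) * (d : ℂ)) * w
        - γ j * circleDeriv (s.f i j) w + remainder b γ d j (s, w) i).im := by
  simp only [contourF, remainder, kernel]
  congr 1
  ring

/-- The first three terms carry an explicit factor `ε`, and the last gains it from
`lipBound_interaction`. The derivative at `w` itself enters only pointwise and stays in the bound,
to be squared and integrated later. -/
lemma lipBound_remainder (hr : r ≤ 1 / 2) (hb : ∀ j, 0 < b j) (hrb : ∀ j, r * b j ≤ 1 / 4)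
    (hd : 2 * (b 0 + b 1) < d) (j : Fin 2) :
    LipBound (fun x : StatePair α r R × Circle =>
      ‖(x.1.ε : ℂ)‖ * (x.1.N + ‖circleDeriv (x.1.diff j) x.2‖)) (remainder b γ d j) := by
  set η : StatePair α r R × Circle → ℝ := fun x => x.1.N + ‖circleDeriv (x.1.diff j) x.2‖ with hη_def
  have hηN : ∀ x, x.1.N ≤ η x := fun x => le_add_of_nonneg_right (norm_nonneg _)
  have hη : ∀ x, 0 ≤ η x := fun x => x.1.N_pos.le.trans (hηN x)
  have hηε : ∀ x : StatePair α r R × Circle, 0 ≤ ‖(x.1.ε : ℂ)‖ * η x :=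
    fun x => mul_nonneg (norm_nonneg _) (hη x)
  have hε : ∀ x : StatePair α r R × Circle, ‖(x.1.ε : ℂ)‖ ≤ 1 := fun x => by
    rw [norm_real]
    exact (x.1.abs_ε_le.trans hr).trans (by norm_num)
  have hf := lipBound_apply (fun x : StatePair α r R × Circle => x.1) (fun x => x.2) j hηN
  have hD := lipBound_circleDeriv (η := η) (fun x : StatePair α r R × Circle => x.1)
    (fun x => x.2) j fun x => le_add_of_nonneg_left x.1.N_pos.le
  have hΩ := lipBound_Ω (fun x : StatePair α r R × Circle => x.1) hηN
  have hZ := lipBound_Z (fun x : StatePair α r R × Circle => x.1) hηN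
  have hw := lipBound_coe (fun x : StatePair α r R × Circle => x.2) hη
  have hwε := lipBound_coe (fun x : StatePair α r R × Circle => x.2) hηε
  have hεη := lipBound_ε (fun x : StatePair α r R × Circle => x.1) hη
  have hc := fun c : ℂ => LipBound.const hη c
  have hJ := (lipBound_kernel (α := α) (R := R) hb hrb j).mono zero_le_one
    (fun x => (one_mul (η x)).symm ▸ hηN x) hη
  have hI := (lipBound_interaction (α := α) (R := R) hr hb hrb hd j).mono zero_le_one
    (fun x => (one_mul (‖(x.1.ε : ℂ)‖ * η x)).symm ▸
      mul_le_mul_of_nonneg_left (hηN x) (norm_nonneg _)) hηε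
  have hφ := (hc 1).add (hεη.mul ((hc (b j)).mul hD))
  have hφε := (LipBound.const hηε 1).add (((hc (b j)).mul hD).mul_small hε)
  have h1 := (((((hc 2).mul hΩ).mul ((hc (b j)).mul (hw.conjugate.add
    (hεη.mul ((hc (b j)).mul hf.conjugate))))).mul hw).mul hφ).mul_small hε
  have h2 := (((((hc 2).mul hΩ).mul (((hc ((-1) ^ ((j : ℕ) + 1))).mul hZ).sub
    (hc (((j : ℕ) : ℂ) * (d : ℂ))))).mul hw).mul ((hc (b j)).mul hD)).mul_small hε
  have h3 := ((((hc (b j * γ j)).mul hw).mul hφ).mul hJ).mul_small hε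
  have h4 := (((LipBound.const hηε (γ (1 - j))).mul hwε).mul hφε).mul hI
  exact (((h1.add h2).add h3).sub h4).congr fun x i => rfl

/-- The difference of the principal parts of the angular velocities. -/
def drift (d : ℝ) (j : Fin 2) (s : StatePair α r R) : ℝ :=
  2 * s.Ω true * ((-1) ^ ((j : ℕ) + 1) * s.Z true - (j : ℕ) * d)
    - 2 * s.Ω false * ((-1) ^ ((j : ℕ) + 1) * s.Z false - (j : ℕ) * d)

/-- Subtraction of the two equations at `w` leaves the difference of the principal parts equal to
minus the difference of the remainders. -/
lemma exists_pointwise_bound (hr : r ≤ 1 / 2) (hb : ∀ j, 0 < b j) (hrb : ∀ j, r * b j ≤ 1 / 4)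
    (hd : 2 * (b 0 + b 1) < d) (j : Fin 2) :
    ∃ C, 0 ≤ C ∧ ∀ s : StatePair α r R,
      (∀ i, IsSolution b γ d s.ε (s.Ω i) (s.Z i) (s.f i)) → ∀ w : Circle,
        |s.drift d j * (w : ℂ).im - γ j * (circleDeriv (s.diff j) w).im|
          ≤ C * (|s.ε| * (s.N + ‖circleDeriv (s.diff j) w‖)) := by
  obtain ⟨C, hC, h⟩ := lipBound_remainder (α := α) (R := R) (γ := γ) hr hb hrb hd j
  refine ⟨C, hC, fun s hs w => ?_⟩
  have h1 := hs true j w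
  have h2 := hs false j w
  rw [contourF_eq] at h1 h2
  have h3 := (h (s, w)).2
  dsimp only at h3
  rw [norm_real, Real.norm_eq_abs] at h3
  refine le_trans (le_of_eq ?_) ((abs_im_le_norm _).trans h3)
  rw [← abs_neg]
  congr 1
  have e : circleDeriv (s.diff j) w = circleDeriv (s.f true j) w - circleDeriv (s.f false j) w :=
    circleDeriv_sub _ _ _
  have e1 : ∀ i, (2 * s.Ω i * ((-1) ^ ((j : ℕ) + 1) * s.Z i - ((j : ℕ) : ℂ) * (d : ℂ)) * w : ℂ).im
      = 2 * s.Ω i * ((-1) ^ ((j : ℕ) + 1) * s.Z i - (j : ℕ) * d) * (w : ℂ).im := fun i => by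
    rw [← im_ofReal_mul]
    push_cast
    rfl
  rw [add_im, sub_im, e1, im_ofReal_mul] at h1 h2
  rw [e, sub_im, sub_im, drift]
  linear_combination h2 - h1

/-- The pointwise bound is squared and integrated; coercivity gives the left side. On the right `2π
N² + N² ≤ 9 N²`, and on the left `π ≥ 3`. -/
lemma sq_drift_add_energy_le {C : ℝ} {s : StatePair α r R} {j : Fin 2} {c : ℝ}
    (h : ∀ w : Circle, |s.drift d j * (w : ℂ).im - c * (circleDeriv (s.diff j) w).im|
          ≤ C * (|s.ε| * (s.N + ‖circleDeriv (s.diff j) w‖))) :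
    3 * s.drift d j ^ 2 + c ^ 2 * (energy (s.diff j) / 2) ≤ 18 * (C * |s.ε| * s.N) ^ 2 := by
  have hcont := (s.diff j).continuous_circleDeriv
  have hi : ∀ θ : ℝ, (Circle.exp θ : ℂ).im = Real.sin θ := fun θ => by
    rw [Circle.coe_exp, exp_ofReal_mul_I_im]
  have h0 := integral_sin_sub_im_circleDeriv_sq (s.diff j) (s.drift d j) c
  have h1 : ∫ θ in (0 : ℝ)..(2 * Real.pi),
      (s.drift d j * Real.sin θ - c * (circleDeriv (s.diff j) (Circle.exp θ)).im) ^ 2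
      ≤ ∫ θ in (0 : ℝ)..(2 * Real.pi), 2 * (C * |s.ε|) ^ 2
        * (s.N ^ 2 + ‖circleDeriv (s.diff j) (Circle.exp θ)‖ ^ 2) := by
    have hpi := Real.pi_pos
    have him : Continuous fun θ : ℝ => (circleDeriv (s.diff j) (Circle.exp θ)).im :=
      Complex.continuous_im.comp (hcont.comp Circle.exp.continuous)
    refine intervalIntegral.integral_mono_on (by positivity)
      (Continuous.intervalIntegrable (by fun_prop) _ _)
      (Continuous.intervalIntegrable (by fun_prop) _ _) fun θ _ => ?_
    have h2 := h (Circle.exp θ)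
    rw [hi] at h2
    have h3 := pow_le_pow_left₀ (abs_nonneg _) h2 2
    rw [sq_abs] at h3
    refine h3.trans ?_
    have h4 : (s.N + ‖circleDeriv (s.diff j) (Circle.exp θ)‖) ^ 2
        ≤ 2 * (s.N ^ 2 + ‖circleDeriv (s.diff j) (Circle.exp θ)‖ ^ 2) := by
      linarith [sq_nonneg (s.N - ‖circleDeriv (s.diff j) (Circle.exp θ)‖)]
    have h5 := mul_le_mul_of_nonneg_left h4 (sq_nonneg (C * |s.ε|))
    linarith
  rw [h0, intervalIntegral.integral_const_mul,
    intervalIntegral.integral_add (Continuous.intervalIntegrable (by fun_prop) _ _)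
      (Continuous.intervalIntegrable (by fun_prop) _ _), intervalIntegral.integral_const,
    smul_eq_mul, sub_zero] at h1
  have h2 : 2 * Real.pi * s.N ^ 2 + energy (s.diff j) ≤ 9 * s.N ^ 2 := by
    have h3 := s.energy_le j
    have h4 := mul_le_mul_of_nonneg_right Real.pi_lt_four.le (sq_nonneg s.N)
    change energy (s.diff j) ≤ _ at h3
    linarith
  have h3 := mul_le_mul_of_nonneg_left h2 (by positivity : 0 ≤ 2 * (C * |s.ε|) ^ 2)
  have h4 := mul_le_mul_of_nonneg_right Real.pi_gt_three.le (sq_nonneg (s.drift d j))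
  have h5 := h1.trans h3
  linarith

end StatePair

lemma HolderX.eq_of_energy_eq_zero {f g : HolderX α} (h : energy (f - g) = 0) : f = g := by
  refine Subtype.ext (funext fun w => ?_)
  have h1 : ‖(f - g : HolderX α) w‖ ≤ 0 := by
    refine le_of_forall_pos_le_add fun δ hδ => ?_
    have := norm_le_of_energy_le (u := f - g) (N := δ / 3) (by positivity)
      (by rw [h]; positivity) w
    linarith
  exact sub_eq_zero.1 (norm_le_zero_iff.1 h1)

/-- Solutions in the unit ball with bounded `Ω`, `Z` and with `Ω` bounded away from zero are unique
for small `ε`. -/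
lemma exists_forall_isSolution_eq {b γ : Fin 2 → ℝ} {d : ℝ} (hb : ∀ j, 0 < b j)
    (hd : 2 * (b 0 + b 1) < d) (hγ : ∀ j, γ j ≠ 0) {R m : ℝ} (hm : 0 < m) :
    ∃ r > 0, ∀ ε, |ε| ≤ r → ∀ (Ω Z : Bool → ℝ) (f : Bool → Fin 2 → HolderX α),
      (∀ i, |Ω i| ≤ R) → (∀ i, |Z i| ≤ R) → (∀ i j, ‖f i j‖ ≤ 1) → m ≤ |Ω true| →
      (∀ i, IsSolution b γ d ε (Ω i) (Z i) (f i)) →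
      Ω true = Ω false ∧ Z true = Z false ∧ f true = f false := by
  have hd0 : 0 < d := by linarith [hb 0, hb 1]
  obtain ⟨r, hr0, hr, hrb⟩ : ∃ r > 0, r ≤ 1 / 2 ∧ ∀ j, r * b j ≤ 1 / 4 := by
    refine ⟨min (1 / 2) (1 / (4 * (b 0 + b 1))), lt_min (by norm_num) ?_, min_le_left _ _,
      fun j => ?_⟩
    · have := hb 0
      have := hb 1
      positivity
    · have h0 := hb 0
      have h1 := hb 1
      have h2 : b j ≤ b 0 + b 1 := by
        fin_cases j
        · exact le_add_of_nonneg_right h1.le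
        · exact le_add_of_nonneg_left h0.le
      refine (mul_le_mul (min_le_right _ _) h2 (hb j).le (by positivity)).trans (le_of_eq ?_)
      field_simp
  choose C hC0 hC using StatePair.exists_pointwise_bound (α := α) (R := R) (γ := γ) hr hb hrb hd
  -- The constants `κ₁`, `κ₂` and the two quotients bound the differences in `Ω`, `Z`, `f₁`, `f₂`,
  -- each in units of `|ε| N`. Division by `2 m` is where `Ω` has to stay away from zero.
  set κ₁ := 3 * (C 0 + C 1) / (2 * d) with hκ₁
  set κ₂ := (3 * C 0 + 2 * |R| * κ₁) / (2 * m) with hκ₂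
  set κ := κ₁ + κ₂ + 6 * C 0 / |γ 0| + 6 * C 1 / |γ 1| with hκ
  have hC00 := hC0 0
  have hC01 := hC0 1
  have hκ₁0 : 0 ≤ κ₁ := by positivity
  have hκ0 : 0 ≤ κ := by positivity
  refine ⟨min r (1 / (2 * (κ + 1))), lt_min hr0 (by positivity), ?_⟩
  intro ε hε Ω Z f hΩ hZ hf hm' hsol
  set N := |Ω true - Ω false| + |Z true - Z false| + √(energy (f true 0 - f false 0))
    + √(energy (f true 1 - f false 1)) with hN
  have hE0 := Real.sqrt_nonneg (energy (f true 0 - f false 0))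
  have hE1 := Real.sqrt_nonneg (energy (f true 1 - f false 1))
  have hΔΩ := abs_nonneg (Ω true - Ω false)
  have hΔZ := abs_nonneg (Z true - Z false)
  have hN0 : 0 ≤ N := by positivity
  -- The energy estimates need `N > 0`. In the other case all differences vanish at once.
  rcases hN0.eq_or_lt with h0 | hpos
  · refine ⟨sub_eq_zero.1 (abs_eq_zero.1 (by linarith)), sub_eq_zero.1 (abs_eq_zero.1 (by linarith)),
      funext fun j => HolderX.eq_of_energy_eq_zero ?_⟩
    have hj : √(energy (f true j - f false j)) = 0 := by
      fin_cases j
      · change √(energy (f true 0 - f false 0)) = 0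
        linarith
      · change √(energy (f true 1 - f false 1)) = 0
        linarith
    exact (Real.sqrt_eq_zero (energy_nonneg _)).1 hj
  exfalso
  let s : StatePair α r R :=
    { ε := ε, N := N, Ω := Ω, Z := Z, f := f
      abs_ε_le := hε.trans (min_le_left _ _)
      N_pos := hpos
      abs_Ω_le := hΩ
      abs_Z_le := hZ
      norm_f_le := hf
      abs_Ω_sub_le := by linarith
      abs_Z_sub_le := by linarith
      energy_le := fun j => by
        refine (Real.sqrt_le_left hN0).1 ?_
        fin_cases j
        · change √(energy (f true 0 - f false 0)) ≤ N
          linarith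
        · change √(energy (f true 1 - f false 1)) ≤ N
          linarith }
  have hmain := fun j => StatePair.sq_drift_add_energy_le (hC j s hsol)
  have hx : ∀ j, 0 ≤ C j * |ε| * N := fun j => by
    have := hC0 j
    positivity
  have hdrift : ∀ j, |s.drift d j| ≤ 3 * (C j * |ε| * N) := fun j => by
    have h1 : 0 ≤ γ j ^ 2 * (energy (s.diff j) / 2) :=
      mul_nonneg (sq_nonneg _) (by linarith [energy_nonneg (s.diff j)])
    have h2 : s.drift d j ^ 2 ≤ (3 * (C j * |ε| * N)) ^ 2 := by
      have h3 : 3 * s.drift d j ^ 2 + _ ≤ 18 * (C j * |ε| * N) ^ 2 := hmain j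
      linarith [sq_nonneg (C j * |ε| * N)]
    exact abs_le_of_sq_le_sq h2 (by linarith [hx j])
  have henergy : ∀ j, √(energy (f true j - f false j)) ≤ 6 * C j / |γ j| * (|ε| * N) := fun j => by
    have hγj : 0 < |γ j| := abs_pos.2 (hγ j)
    have h2 : γ j ^ 2 * (energy (f true j - f false j)) ≤ (6 * (C j * |ε| * N)) ^ 2 := by
      have h3 : _ + γ j ^ 2 * (energy (f true j - f false j) / 2) ≤ 18 * (C j * |ε| * N) ^ 2 :=
        hmain j
      linarith [sq_nonneg (s.drift d j)]
    refine Real.sqrt_le_iff.2 ⟨by have := hC0 j; positivity, ?_⟩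
    rw [show 6 * C j / |γ j| * (|ε| * N) = 6 * (C j * |ε| * N) / |γ j| by ring, div_pow, sq_abs,
      le_div_iff₀ (by have := hγ j; positivity), mul_comm]
    exact h2
  have hd0' := hdrift 0
  have hd1' := hdrift 1
  have e0 : s.drift d 0 = -(2 * (Ω true * (Z true - Z false) + (Ω true - Ω false) * Z false)) := by
    simp [StatePair.drift, s]
    ring
  -- The terms with `Z` cancel in the sum, so the difference in `Ω` is isolated first, and that in
  -- `Z` follows from the first drift.
  have e1 : s.drift d 0 + s.drift d 1 = -(2 * d * (Ω true - Ω false)) := by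
    simp [StatePair.drift, s]
    ring
  have b1 : |Ω true - Ω false| ≤ κ₁ * (|ε| * N) := by
    have h1 := abs_add_le (s.drift d 0) (s.drift d 1)
    rw [e1, abs_neg, abs_mul, abs_of_pos (by positivity : 0 < 2 * d)] at h1
    rw [hκ₁, div_mul_eq_mul_div, le_div_iff₀ (by positivity)]
    linarith
  have b2 : |Z true - Z false| ≤ κ₂ * (|ε| * N) := by
    have h1 : 2 * |Ω true| * |Z true - Z false|
        ≤ |s.drift d 0| + 2 * |Ω true - Ω false| * |Z false| := by
      have h2 := abs_sub_abs_le_abs_add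
        (2 * Ω true * (Z true - Z false)) (2 * (Ω true - Ω false) * Z false)
      rw [e0, abs_neg]
      rw [abs_mul, abs_mul, abs_mul (2 * (Ω true - Ω false)), abs_mul, abs_two] at h2
      rw [show 2 * (Ω true * (Z true - Z false) + (Ω true - Ω false) * Z false)
        = 2 * Ω true * (Z true - Z false) + 2 * (Ω true - Ω false) * Z false by ring]
      linarith
    have h3 := mul_le_mul_of_nonneg_right hm' hΔZ
    have h4 : |Ω true - Ω false| * |Z false| ≤ κ₁ * (|ε| * N) * |R| :=
      mul_le_mul b1 ((hZ false).trans (le_abs_self R)) (abs_nonneg _) (by positivity)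
    rw [hκ₂, div_mul_eq_mul_div, le_div_iff₀ (by positivity)]
    linarith
  have hsum : N ≤ κ * (|ε| * N) := by
    have h0 := henergy 0
    have h1 := henergy 1
    rw [hκ, add_mul, add_mul, add_mul]
    linarith
  -- Contraction: `N ≤ κ |ε| N ≤ N / 2` is impossible for `N > 0`.
  have h1 : κ * |ε| ≤ 1 / 2 := by
    have h2 := mul_le_mul_of_nonneg_left (hε.trans (min_le_right _ _)) hκ0
    refine h2.trans ?_
    rw [mul_one_div, div_le_div_iff₀ (by positivity) (by norm_num)]
    linarith
  have h2 := mul_le_mul_of_nonneg_right h1 hN0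
  linarith

end VortexPair

end

noncomputable section

namespace VortexPair

/-! ### The solution curve -/

open Filter Topology

variable {b γ : Fin 2 → ℝ} {d ε₀ : ℝ}

/-- The realization of states with coefficient sequences as elements of `ℝ × ℝ × X`. -/
def stateToHolder (α : ℝ) [Fact (0 < α ∧ α < 1)] : State →L[ℝ] ℝ × ℝ × (Fin 2 → HolderX α) :=
  (ContinuousLinearMap.id ℝ ℝ).prodMap ((ContinuousLinearMap.id ℝ ℝ).prodMap
    (ContinuousLinearMap.pi fun j => (Seq.toHolder α).comp (ContinuousLinearMap.proj j)))

lemma stateToHolder_apply (α : ℝ) [Fact (0 < α ∧ α < 1)] (x : State) :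
    stateToHolder α x = (x.1, x.2.1, fun j => Seq.toHolder α (x.2.2 j)) := rfl

lemma IsSolutionCurve.reflect {g : ℝ → ℝ × ℝ × (Fin 2 → HolderX α)}
    (hg : IsSolutionCurve b γ d ε₀ g) :
    IsSolutionCurve b γ d ε₀ fun ε => ((g (-ε)).1, (g (-ε)).2.1, reflectCLM (g (-ε)).2.2) where
  contDiffOn := by
    have h1 : ContDiffOn ℝ 1 (fun ε => g (-ε)) (Icc (-ε₀) ε₀) :=
      hg.contDiffOn.comp contDiff_neg.contDiffOn fun ε hε =>
        ⟨neg_le_neg hε.2, neg_le.1 hε.1⟩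
    exact h1.fst.prodMk (h1.snd.fst.prodMk (reflectCLM.contDiff.comp_contDiffOn h1.snd.snd))
  mem_ball ε hε := by
    have := hg.mem_ball (-ε) ⟨neg_le_neg hε.2, neg_le.1 hε.1⟩
    rw [mem_ball_zero_iff] at this ⊢
    rwa [norm_reflectCLM]
  isSolution ε hε := by
    have := (hg.isSolution (-ε) ⟨neg_le_neg hε.2, neg_le.1 hε.1⟩).reflect
    rwa [neg_neg] at this
  init := by
    simp only [neg_zero, hg.init, map_zero]

/-- The values of `Ω` and `Z` on `h` are not bounded in advance. By `hR` and `hloc` the coincidence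
set equals the set where the strict bounds hold for `h`; it is closed by the first description and
open by the second. -/
lemma IsSolutionCurve.eqOn {g h : ℝ → ℝ × ℝ × (Fin 2 → HolderX α)} {R : ℝ} (hε₀ : 0 ≤ ε₀)
    (hg : IsSolutionCurve b γ d ε₀ g) (hh : IsSolutionCurve b γ d ε₀ h)
    (hR : ∀ ε ∈ Icc (-ε₀) ε₀, |(g ε).1| < R ∧ |(g ε).2.1| < R)
    (hloc : ∀ ε ∈ Icc (-ε₀) ε₀, |(h ε).1| < R → |(h ε).2.1| < R → h ε = g ε) :
    EqOn h g (Icc (-ε₀) ε₀) := by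
  have : PreconnectedSpace (Icc (-ε₀) ε₀) := Subtype.preconnectedSpace isPreconnected_Icc
  have hgc := hg.contDiffOn.continuousOn.domRestrict
  have hhc := hh.contDiffOn.continuousOn.domRestrict
  set S : Set (Icc (-ε₀) ε₀) := {x | (Icc (-ε₀) ε₀).domRestrict h x = (Icc (-ε₀) ε₀).domRestrict g x}
    with hS
  have e : S = {x | |((Icc (-ε₀) ε₀).domRestrict h x).1| < R ∧
      |((Icc (-ε₀) ε₀).domRestrict h x).2.1| < R} := by
    ext x
    refine ⟨fun hx => ?_, fun hx => hloc x x.2 hx.1 hx.2⟩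
    have hx' : h x = g x := hx
    change |(h x).1| < R ∧ |(h x).2.1| < R
    rw [hx']
    exact hR x x.2
  have hclosed : IsClosed S := isClosed_eq hhc hgc
  have hopen : IsOpen S := by
    rw [e]
    exact (isOpen_lt hhc.fst.abs continuous_const).inter
      (isOpen_lt hhc.snd.fst.abs continuous_const)
  have huniv := IsClopen.eq_univ ⟨hclosed, hopen⟩
    ⟨⟨0, by simpa using hε₀⟩, (hh.init.trans hg.init.symm : h 0 = g 0)⟩
  intro ε hε
  have : (⟨ε, hε⟩ : Icc (-ε₀) ε₀) ∈ S := huniv ▸ mem_univ _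
  exact this

/-- The hypothesis is on the `ℓ¹` coefficient norm, not on the `C^{1+α}` norm, because the criterion
needs a Lipschitz bound for the derivative. -/
lemma strictlyConvex_patch [Fact (0 < α ∧ α < 1)] {ε : ℝ} {x : Fin 2 → Seq} {j : Fin 2}
    (h : |ε * b j| * ‖x j‖ ≤ 1 / 100) :
    let f : Fin 2 → HolderX α := fun j => Seq.toHolder α (x j)
    Function.Injective (boundaryMap b ε f j) ∧
      frontier (patch b ε f j) = range (boundaryMap b ε f j) ∧
      (0 : ℂ) ∈ patch b ε f j ∧ patch b ε f j ⊆ Metric.ball 0 2 ∧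
      IsStrictlyConvexDomain (patch b ε f j) := by
  have hn : ‖(ε * b j : ℂ)‖ = |ε * b j| := by
    rw [← ofReal_mul, norm_real, Real.norm_eq_abs]
  have hle : ∀ {z : ℂ} {c : ℝ}, 0 ≤ c → ‖z‖ ≤ ‖x j‖ * c → ‖(ε * b j : ℂ) * z‖ ≤ 1 / 100 * c := by
    intro z c hc hz
    rw [norm_mul, hn]
    have h1 := mul_le_mul_of_nonneg_left hz (abs_nonneg (ε * b j))
    have h2 := mul_le_mul_of_nonneg_right h hc
    linarith
  refine strictlyConvex_perturbation (g := fun w => (ε * b j : ℂ) * Seq.toHolder α (x j) w)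
    (g' := fun w => (ε * b j : ℂ) * circleDeriv (Seq.toHolder α (x j)) w) (fun w => ?_)
    (fun w => ?_) (fun w => ?_) (fun τ w => ?_)
  · have := ((Seq.toHolder α (x j)).hasCircleDeriv w).const_mul (ε * b j : ℂ)
    rwa [mul_assoc]
  · have := hle (z := Seq.toHolder α (x j) w) zero_le_one (by
      rw [Seq.toHolder_apply, mul_one]
      exact Seq.norm_val_le _ _)
    rwa [mul_one] at this
  · have := hle (z := circleDeriv (Seq.toHolder α (x j)) w) zero_le_one (by
      rw [Seq.circleDeriv_toHolder, mul_one]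
      exact Seq.norm_der_le _ _)
    rwa [mul_one] at this
  · rw [← mul_sub]
    refine hle (norm_nonneg _) ?_
    rw [Seq.circleDeriv_toHolder, Seq.circleDeriv_toHolder]
    exact Seq.norm_der_sub_le _ _ _

/-- The curve is kept as a curve `s` of coefficient sequences, so that convexity can still use its
`C^{1,1}` regularity. Only this curve has to satisfy `|Ω| ≥ |Ω₀| / 2`; competitors are compared with
it. -/
lemma exists_solutionCurve (α : ℝ) [Fact (0 < α ∧ α < 1)] (hb : ∀ j, 0 < b j)
    (hd : 2 * (b 0 + b 1) < d) (hγ : ∀ j, γ j ≠ 0) (hsum : γ 0 + γ 1 ≠ 0) :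
    ∃ ε₀ : ℝ, 0 < ε₀ ∧ ε₀ < 1 / 2 ∧ ∃ s : ℝ → State,
      IsSolutionCurve b γ d ε₀ (fun ε => stateToHolder α (s ε)) ∧
      (∀ h : ℝ → ℝ × ℝ × (Fin 2 → HolderX α), IsSolutionCurve b γ d ε₀ h →
        EqOn h (fun ε => stateToHolder α (s ε)) (Icc (-ε₀) ε₀)) ∧
      ∀ ε ∈ Icc (-ε₀) ε₀, ∀ j, |ε * b j| * ‖(s ε).2.2 j‖ ≤ 1 / 100 := by
  have hd0 : 0 < d := by linarith [hb 0, hb 1]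
  obtain ⟨s, hs, hs0, hsol⟩ := exists_curve α (b := b) hd0.ne' hγ hsum
  have hΩ0 : 0 < |Omega0 γ d| := abs_pos.2 (div_ne_zero hsum (by positivity))
  set R := |Omega0 γ d| + |Z0 γ d| + 1 with hR
  obtain ⟨r, hr0, hr⟩ := exists_forall_isSolution_eq (α := α) hb hd hγ (R := R)
    (m := |Omega0 γ d| / 2) (by positivity)
  have hc : ContinuousAt s 0 := hs.continuousAt
  have hcΩ : ContinuousAt (fun ε => |(s ε).1|) 0 := hc.fst.abs
  have hcZ : ContinuousAt (fun ε => |(s ε).2.1|) 0 := hc.snd.fst.abs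
  have hcT : ContinuousAt (fun ε => ‖(stateToHolder α (s ε)).2.2‖) 0 :=
    ((stateToHolder α).continuous.continuousAt.comp hc).snd.snd.norm
  have hcx : ∀ j, ContinuousAt (fun ε => |ε * b j| * ‖(s ε).2.2 j‖) 0 := fun j => by
    have h1 : ContinuousAt (fun ε => (s ε).2.2 j) 0 :=
      (continuous_apply j).continuousAt.comp hc.snd.snd
    exact (by fun_prop : Continuous fun ε : ℝ => |ε * b j|).continuousAt.mul h1.norm
  have hZ0 := abs_nonneg (Z0 γ d)
  have h1 : ∀ᶠ ε in 𝓝 (0 : ℝ), |(s ε).1| < R :=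
    hcΩ.eventually_lt continuousAt_const (by rw [hs0]; linarith)
  have h2 : ∀ᶠ ε in 𝓝 (0 : ℝ), |(s ε).2.1| < R :=
    hcZ.eventually_lt continuousAt_const (by rw [hs0]; linarith)
  have h3 : ∀ᶠ ε in 𝓝 (0 : ℝ), |Omega0 γ d| / 2 < |(s ε).1| :=
    continuousAt_const.eventually_lt hcΩ (by rw [hs0]; linarith)
  have h4 : ∀ᶠ ε in 𝓝 (0 : ℝ), ‖(stateToHolder α (s ε)).2.2‖ < 1 :=
    hcT.eventually_lt continuousAt_const (by
      have : (stateToHolder α (s 0)).2.2 = 0 := by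
        rw [hs0, stateToHolder_apply]
        funext j
        exact map_zero _
      rw [this, norm_zero]
      exact zero_lt_one)
  have h5 : ∀ᶠ ε in 𝓝 (0 : ℝ), ∀ j, |ε * b j| * ‖(s ε).2.2 j‖ < 1 / 100 :=
    eventually_all.2 fun j => (hcx j).eventually_lt continuousAt_const (by simp)
  have h6 : ∀ᶠ ε in 𝓝 (0 : ℝ), ContDiffAt ℝ 1 s ε := hs.eventually (by simp)
  obtain ⟨ρ, hρ, hball⟩ := Metric.eventually_nhds_iff.1
    (hsol.and (h1.and (h2.and (h3.and (h4.and (h5.and h6))))))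
  -- The half of `ρ` puts the closed interval inside the open ball, `r` gives uniqueness, and `1/4`
  -- keeps `ε₀` below `1/2`.
  set ε₀ := min (ρ / 2) (min r (1 / 4)) with hε₀
  have hε₀pos : 0 < ε₀ := lt_min (by positivity) (lt_min hr0 (by norm_num))
  have hmem : ∀ ε ∈ Icc (-ε₀) ε₀, dist ε 0 < ρ ∧ |ε| ≤ r := fun ε hε => by
    have h7 := abs_le.2 hε
    rw [Real.dist_0_eq_abs]
    have h8 : ε₀ ≤ ρ / 2 := min_le_left _ _
    exact ⟨by linarith, h7.trans ((min_le_right _ _).trans (min_le_left _ _))⟩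
  have hcurve : IsSolutionCurve b γ d ε₀ (fun ε => stateToHolder α (s ε)) :=
    { contDiffOn := fun ε hε =>
        ((stateToHolder α).contDiff.contDiffAt.comp ε
          (hball (hmem ε hε).1).2.2.2.2.2.2).contDiffWithinAt
      mem_ball := fun ε hε => mem_ball_zero_iff.2 (hball (hmem ε hε).1).2.2.2.2.1
      isSolution := fun ε hε => (hball (hmem ε hε).1).1
      init := by
        simp only [hs0, stateToHolder_apply]
        congr 2
        funext j
        exact map_zero _ }
  refine ⟨ε₀, hε₀pos, ?_, s, hcurve, fun h hh => hcurve.eqOn hε₀pos.le hh (R := R)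
    (fun ε hε => ⟨(hball (hmem ε hε).1).2.1, (hball (hmem ε hε).1).2.2.1⟩)
    fun ε hε hΩ hZ => ?_, fun ε hε j => ((hball (hmem ε hε).1).2.2.2.2.2.1 j).le⟩
  · exact ((min_le_right _ _).trans (min_le_right _ _)).trans_lt (by norm_num)
  · have hball' := hball (hmem ε hε).1
    have hmem_h := mem_ball_zero_iff.1 (hh.mem_ball ε hε)
    have hmem_g := mem_ball_zero_iff.1 (hcurve.mem_ball ε hε)
    obtain ⟨e1, e2, e3⟩ := hr ε (hmem ε hε).2
      (fun i => bif i then (stateToHolder α (s ε)).1 else (h ε).1)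
      (fun i => bif i then (stateToHolder α (s ε)).2.1 else (h ε).2.1)
      (fun i => bif i then (stateToHolder α (s ε)).2.2 else (h ε).2.2)
      (fun i => by cases i; exacts [hΩ.le, hball'.2.1.le])
      (fun i => by cases i; exacts [hZ.le, hball'.2.2.1.le])
      (fun i j => by
        cases i
        exacts [(norm_le_pi_norm _ j).trans hmem_h.le, (norm_le_pi_norm _ j).trans hmem_g.le])
      hball'.2.2.2.1.le
      (fun i => by cases i; exacts [hh.isSolution ε hε, hcurve.isSolution ε hε])
    exact (Prod.ext e1 (Prod.ext e2 e3)).symm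

end VortexPair

end

theorem mainTheorem1 (α : ℝ) (hα₀ : 0 < α) (hα₁ : α < 1) (b γ : Fin 2 → ℝ) (d : ℝ)
    (hb : ∀ j, 0 < b j) (hd : 2 * (b 0 + b 1) < d)
    (hγ : ∀ j, γ j ≠ 0) (hsum : γ 0 + γ 1 ≠ 0) :
    (∃ ε₀ : ℝ, 0 < ε₀ ∧ ε₀ < 1 / 2 ∧
      ∃ g : ℝ → ℝ × ℝ × (Fin 2 → VortexPair.HolderX α),
        VortexPair.IsSolutionCurve b γ d ε₀ g ∧
        (∀ h : ℝ → ℝ × ℝ × (Fin 2 → VortexPair.HolderX α),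
          VortexPair.IsSolutionCurve b γ d ε₀ h → Set.EqOn h g (Set.Icc (-ε₀) ε₀)) ∧
        (∀ ε ∈ Set.Icc (-ε₀) ε₀, ε ≠ 0 → (g ε).2.2 ≠ 0) ∧
        (∀ ε ∈ Set.Icc (-ε₀) ε₀,
          (g (-ε)).1 = (g ε).1 ∧ (g (-ε)).2.1 = (g ε).2.1 ∧
            ∀ j, (g (-ε)).2.2 j = ((g ε).2.2 j).reflect) ∧
        (∀ ε ∈ Set.Icc (-ε₀) ε₀, ε ≠ 0 → ∀ j,
          Function.Injective (VortexPair.boundaryMap b ε (g ε).2.2 j) ∧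
          frontier (VortexPair.patch b ε (g ε).2.2 j)
            = Set.range (VortexPair.boundaryMap b ε (g ε).2.2 j) ∧
          (0 : ℂ) ∈ VortexPair.patch b ε (g ε).2.2 j ∧
          VortexPair.patch b ε (g ε).2.2 j ⊆ Metric.ball 0 2 ∧
          VortexPair.IsStrictlyConvexDomain (VortexPair.patch b ε (g ε).2.2 j))) ∧
    (∀ ε Ω Z : ℝ, -(1 / 2) < ε → ε < 1 / 2 →
      ∀ f ∈ Metric.ball (0 : Fin 2 → VortexPair.HolderX α) 1,
        VortexPair.IsSolution b γ d ε Ω Z f →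
          VortexPair.IsSolution b γ d (-ε) Ω Z (fun j => (f j).reflect)) := by
  have : Fact (0 < α ∧ α < 1) := ⟨⟨hα₀, hα₁⟩⟩
  refine ⟨?_, fun ε Ω Z _ _ f _ hf => hf.reflect⟩
  obtain ⟨ε₀, hε₀, hε₀', s, hs, huniq, hsmall⟩ :=
    VortexPair.exists_solutionCurve α hb hd hγ hsum
  refine ⟨ε₀, hε₀, hε₀', fun ε => VortexPair.stateToHolder α (s ε), hs, huniq, ?_, ?_, ?_⟩
  · intro ε hε hne
    exact (hs.isSolution ε hε).ne_zero hb hd hγ hne ((abs_le.2 hε).trans_lt (by linarith))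
  · intro ε hε
    have hε' : -ε ∈ Set.Icc (-ε₀) ε₀ := ⟨neg_le_neg hε.2, neg_le.1 hε.1⟩
    -- The reflected curve is again a solution curve, so it coincides with the original one.
    -- Evaluation at `ε` gives the scalars and at `-ε` the perturbations.
    have h1 := huniq _ hs.reflect hε
    have h2 := huniq _ hs.reflect hε'
    have h3 := congrArg (fun p => p.2.2) h2
    simp only [neg_neg] at h3
    exact ⟨congrArg (fun p => p.1) h1, congrArg (fun p => p.2.1) h1, fun j => (congrFun h3 j).symm⟩
  · exact fun ε hε _ j => VortexPair.strictlyConvex_patch (hsmall ε hε j)
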